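/- Let $K$ be a field of characteristic different from $2$ and $3$, let $E/K$ be a quadratic étale extension (a separable quadratic field extension, or $E\simeq K\times K$) with non-identity $K$-automorphism $\iota$, and let $C$ be an octonion algebra over $E$ (an octonion algebra over $K\times K$ is a pair of octonion algebras over $K$) with norm $n$ and canonical involution $\bar{\ }$. Conventions: a quadratic form $q$ has associated symmetric bilinear form $b$ with $b(x,x)=q(x)$; a symmetric bilinear form $b$ is identified with $x\mapsto b(x,x)$; $\simeq$ denotes isometry; $\langle c\rangle q$ is $c\cdot q$; $\langle c_1,c_2,c_3\rangle q=\langle c_1\rangle q\perp\langle c_2\rangle q\perp\langle c_3\rangle q$. For an $E$-module $V$ let ${}^\iota V$ be $V$ with $e\in E$ acting as $\iota(e)$. For a quadratic form $q$ on $V$, the form ${}^\iota q(v)=\iota(q(v))$ is a quadratic form on ${}^\iota V$, and the multiplicative transfer $N_{E/K}(q)$ is the $K$-valued quadratic form obtained by restricting ${}^\iota q\otimes_E q$ to the $K$-space of tensors in ${}^\iota V\otimes_E V$ fixed by the switch map $x\otimes y\mapsto y\otimes x$. The bi-octonion algebra $(A,-)=N_{E/K}(C)$ is the $K$-algebra of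 tensors in ${}^\iota C\otimes_E C$ fixed by the switch map, with the restriction of the tensor product of the canonical involutions. The form $\lambda^2(n)$ is the exterior square of $n$, a form on $\bigwedge^2_E C$; it is $\perp_{i<j}\langle x_ix_j\rangle$ if $n\simeq\langle x_1,\dots,x_8\rangle$. The form $\operatorname{tr}_{E/K}(\lambda^2(n))$ is its composite with the trace $E\to K$. For $a,b\in A$ and $i\in\{1,2,3\}$ (indices mod $3$) let $T^i_{a,b}=(T_1,T_2,T_3)\in\operatorname{End}_K(A)^3$ with $$T_i=L_{\bar b}L_a-L_{\bar a}L_b,\quad T_{i+1}=R_{\bar b}R_a-R_{\bar a}R_b,\quad T_{i+2}=R_{\bar ab-\bar ba}+L_bL_{\bar a}-L_aL_{\bar b},$$ where $L$ and $R$ denote left and right multiplications, and let $\mathcal T_I$ be the $K$-span of all $T^i_{a,b}$. For $\gamma=(\gamma_1,\gamma_2,\gamma_3)\in (K^\times)^3$ let $$K(A,-,\gamma)=\mathcal T_I\oplus A[12]\oplus A[23]\oplus A[31],$$ where the $A[ij]$ are copies of $A$ and $a[ij]=-\gamma_i\gamma_j^{-1}\bar a[ji]$, with the bilinear product given by the commutator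 on $\mathcal T_I$ and, for $(i\ j\ k)$ a cyclic permutation of $(1\ 2\ 3)$, $$[a[ij],b[jk]]=-[b[jk],a[ij]]=ab[ik],\quad [T,a[ij]]=-[a[ij],T]=T_k(a)[ij],\quad [a[ij],b[ij]]=\gamma_i\gamma_j^{-1}T^i_{a,b}.$$ Then $K(A,-,\gamma)$ is a Lie algebra over $K$ (in particular, it is closed under this product), and its Killing form is isometric to $$\langle-15\rangle\big(\operatorname{tr}_{E/K}(\lambda^2(n))\perp\langle\gamma_1\gamma_2^{-1},\gamma_2\gamma_3^{-1},\gamma_3\gamma_1^{-1}\rangle N_{E/K}(n)\big).$$ -/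

import Mathlib

open scoped TensorProduct

noncomputable section

/-! ### Octonion algebras and exterior squares of quadratic forms -/

section Octonion

variable {E C : Type*} [CommRing E] [NonAssocRing C] [Module E C]

/-- The unital nonassociative `E`-algebra `C` is an octonion algebra with norm `n`: it is free of
rank `8`, and `n` is a nondegenerate quadratic form permitting composition. -/
structure IsOctonionAlgebra (n : QuadraticForm E C) : Prop where
  free : Module.Free E C
  finrank_eq : Module.finrank E C = 8
  nondegenerate : n.polarBilin.Nondegenerate
  map_mul : ∀ x y : C, n (x * y) = n x * n y

/-- The canonical involution `x ↦ n(x,1) 1 - x` of an octonion algebra with norm `n`, where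
`n(x,y) = n(x+y) - n(x) - n(y)`. -/
def octConj (n : QuadraticForm E C) : C →ₗ[E] C :=
  (n.polarBilin.flip 1).smulRight (1 : C) - LinearMap.id

end Octonion

section ExteriorSquare

variable {E V : Type*} [CommRing E] [AddCommGroup V] [Module E V] [Invertible (2 : E)]

/-- The exterior square `λ²(q)` of a quadratic form: the quadratic form on `⋀² V` whose
bilinear form is `(u ∧ v, u' ∧ v') ↦ b(u,u') b(v,v') - b(u,v') b(v,u')`, where `b` is the
symmetric bilinear form with `b(x,x) = q(x)`. -/
def lambdaSq (q : QuadraticForm E V) : QuadraticForm E (⋀[E]^2 V) :=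
  LinearMap.BilinMap.toQuadraticMap
    (exteriorPower.pairingDual E V 2 ∘ₗ exteriorPower.map 2 (QuadraticMap.associated q))

/-- The bilinear form of `λ²(q)` is given by determinants. -/
theorem lambdaSq_bilin_apply (q : QuadraticForm E V) (u v : Fin 2 → V) :
    (exteriorPower.pairingDual E V 2 ∘ₗ exteriorPower.map 2 (QuadraticMap.associated q))
      (exteriorPower.ιMulti E 2 u) (exteriorPower.ιMulti E 2 v) =
    (Matrix.of fun i j => QuadraticMap.associated q (u j) (v i)).det := by
  simp [exteriorPower.pairingDual_ιMulti_ιMulti]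

/-- `λ²(q)` takes the value `xᵢ xⱼ` on `eᵢ ∧ eⱼ` if `eᵢ`, `eⱼ` are orthogonal vectors with
`q(eᵢ) = xᵢ` and `q(eⱼ) = xⱼ`. -/
theorem lambdaSq_apply_of_orthogonal (q : QuadraticForm E V) (u v : V)
    (h : QuadraticMap.associated q u v = 0) :
    lambdaSq q (exteriorPower.ιMulti E 2 ![u, v]) = q u * q v := by
  have h2 := lambdaSq_bilin_apply q ![u, v] ![u, v]
  simp only [lambdaSq, LinearMap.BilinMap.toQuadraticMap_apply]
  rw [h2, Matrix.det_fin_two]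
  have h' : QuadraticMap.associated q v u = 0 := by
    rw [← h]; exact QuadraticMap.associated_isSymm E q v u
  simp only [Matrix.of_apply, Matrix.cons_val_zero, Matrix.cons_val_one, h, h']
  rw [QuadraticMap.associated_eq_self_apply, QuadraticMap.associated_eq_self_apply]
  ring

end ExteriorSquare

/-! ### Transfers along a quadratic étale extension -/

/-- The additive (Scharlau) transfer `tr_{E/K}(q) = Tr_{E/K} ∘ q`, a quadratic form over `K`. -/
def traceTransfer (K : Type*) {E V : Type*} [Field K] [CommRing E] [Algebra K E]
    [AddCommGroup V] [Module E V] [Module K V] [IsScalarTower K E V]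
    (q : QuadraticForm E V) : QuadraticForm K V :=
  (Algebra.trace K E).compQuadraticMap' q

theorem apply_apply_of_orderOf_eq_two {K E : Type*} [Field K] [CommRing E] [Algebra K E]
    {ι : E ≃ₐ[K] E} (hι : orderOf ι = 2) (e : E) : ι (ι e) = e := by
  have h := pow_orderOf_eq_one ι
  rw [hι, pow_two] at h
  exact DFunLike.congr_fun h e

/-- The conjugate module `ᶥV`: the additive group `V`, with `e` acting as `ι(e)`. -/
@[nolint unusedArguments]
def Conjugate {K E : Type*} [Field K] [CommRing E] [Algebra K E]
    (_ : E ≃ₐ[K] E) (V : Type*) : Type _ := V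

namespace Conjugate

variable {K E : Type*} [Field K] [CommRing E] [Algebra K E] (ι : E ≃ₐ[K] E)

section Module

variable {V : Type*} [AddCommGroup V] [Module E V] [Module K V]

instance : AddCommGroup (Conjugate ι V) := inferInstanceAs (AddCommGroup V)

instance : Module E (Conjugate ι V) := Module.compHom V (ι : E →+* E)

instance : Module K (Conjugate ι V) := inferInstanceAs (Module K V)

/-- The identity map `V → ᶥV`. -/
def of : V ≃ₗ[K] Conjugate ι V := LinearEquiv.refl K V

theorem smul_def (e : E) (v : Conjugate ι V) :
    e • v = of ι (ι e • (of ι).symm v) := rfl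

theorem of_symm_smul (e : E) (v : Conjugate ι V) :
    (of ι).symm (e • v) = ι e • (of ι).symm v := rfl

instance [IsScalarTower K E V] : IsScalarTower K E (Conjugate ι V) where
  smul_assoc k e v := by
    apply (of ι).symm.injective
    rw [of_symm_smul, map_smul, smul_assoc, map_smul, of_symm_smul]

/-- An `E`-linear endomorphism of `V`, seen as an endomorphism of `ᶥV`. -/
def map (f : V →ₗ[E] V) : Conjugate ι V →ₗ[E] Conjugate ι V where
  toFun v := of ι (f ((of ι).symm v))
  map_add' v w := by simp
  map_smul' e v := by simp [smul_def]

variable {ι} in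
/-- The conjugate form `ᶥq(v) = ι(q(v))` on `ᶥV`. -/
def quadraticForm (hι : orderOf ι = 2) (q : QuadraticForm E V) :
    QuadraticForm E (Conjugate ι V) where
  toFun v := ι (q ((of ι).symm v))
  toFun_smul e v := by
    rw [of_symm_smul, QuadraticMap.map_smul]
    simp [apply_apply_of_orderOf_eq_two hι]
  exists_companion' :=
    ⟨LinearMap.mk₂ E (fun v w => ι (QuadraticMap.polar q ((of ι).symm v) ((of ι).symm w)))
      (fun _ _ _ => by simp [QuadraticMap.polar_add_left])
      (fun _ _ _ => by
        simp [of_symm_smul, QuadraticMap.polar_smul_left, apply_apply_of_orderOf_eq_two hι])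
      (fun _ _ _ => by simp [QuadraticMap.polar_add_right])
      (fun _ _ _ => by
        simp [of_symm_smul, QuadraticMap.polar_smul_right, apply_apply_of_orderOf_eq_two hι]),
     fun v w => by simp [QuadraticMap.polar]⟩

end Module

section Algebra

variable {C : Type*} [NonAssocRing C] [Module E C]

instance : NonAssocRing (Conjugate ι C) := inferInstanceAs (NonAssocRing C)

instance [SMulCommClass E C C] : SMulCommClass E (Conjugate ι C) (Conjugate ι C) where
  smul_comm e x y := mul_smul_comm (ι e) (show C from x) (show C from y)|>.symm

instance [IsScalarTower E C C] : IsScalarTower E (Conjugate ι C) (Conjugate ι C) where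
  smul_assoc e x y := smul_mul_assoc (ι e) (show C from x) (show C from y)

end Algebra

end Conjugate

section Transfer

variable {K E : Type*} [Field K] [CommRing E] [Algebra K E] {ι : E ≃ₐ[K] E}

section Module

variable (hι : orderOf ι = 2) (V : Type*) [AddCommGroup V] [Module E V] [Module K V]
  [IsScalarTower K E V]

/-- The switch map `x ⊗ y ↦ y ⊗ x` on `ᶥV ⊗[E] V`. -/
def switch : (Conjugate ι V ⊗[E] V) →ₗ[K] (Conjugate ι V ⊗[E] V) where
  toFun := TensorProduct.liftAddHom
    (AddMonoidHom.mk' (fun x : Conjugate ι V =>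
      AddMonoidHom.mk' (fun y : V =>
        (Conjugate.of ι y) ⊗ₜ[E] ((Conjugate.of ι).symm x : V))
        (fun y y' => by simp [TensorProduct.add_tmul]))
      (fun x x' => by ext y; simp [TensorProduct.tmul_add]))
    (fun e x y => by
      change (Conjugate.of ι y) ⊗ₜ[E] (ι e • ((Conjugate.of ι).symm x : V)) =
        (Conjugate.of ι (e • y)) ⊗ₜ[E] ((Conjugate.of ι).symm x : V)
      rw [← TensorProduct.smul_tmul, Conjugate.smul_def, apply_apply_of_orderOf_eq_two hι]
      rfl)
  map_add' s t := map_add _ s t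
  map_smul' k t := by
    induction t with
    | zero => simp
    | add s t hs ht => simp only [smul_add, map_add, hs, ht]
    | tmul x y =>
      simp only [TensorProduct.smul_tmul', RingHom.id_apply]
      change (Conjugate.of ι y) ⊗ₜ[E] ((Conjugate.of ι).symm (k • x) : V) =
        k • (Conjugate.of ι y) ⊗ₜ[E] ((Conjugate.of ι).symm x : V)
      rw [map_smul, TensorProduct.tmul_smul]

@[simp]
theorem switch_tmul (x : Conjugate ι V) (y : V) :
    switch hι V (x ⊗ₜ[E] y) = (Conjugate.of ι y) ⊗ₜ[E] ((Conjugate.of ι).symm x : V) := rfl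

/-- The multiplicative transfer of the `E`-module `V`: the `K`-space of tensors in
`ᶥV ⊗[E] V` fixed by the switch map. -/
def transferSubmodule : Submodule K (Conjugate ι V ⊗[E] V) :=
  LinearMap.eqLocus (switch hι V) LinearMap.id

/-- The space underlying the multiplicative transfer `N_{E/K}`. -/
def Transfer : Type _ := ↥(transferSubmodule hι V)

instance : AddCommGroup (Transfer hι V) := inferInstanceAs (AddCommGroup ↥(transferSubmodule hι V))

instance : Module K (Transfer hι V) := inferInstanceAs (Module K ↥(transferSubmodule hι V))

/-- The inclusion `N_{E/K}(V) → ᶥV ⊗[E] V`. -/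
def Transfer.val : Transfer hι V →ₗ[K] (Conjugate ι V ⊗[E] V) := (transferSubmodule hι V).subtype

variable {V}

theorem Transfer.val_injective : Function.Injective (Transfer.val hι V) :=
  Subtype.val_injective

theorem Transfer.switch_val (t : Transfer hι V) : switch hι V (t.val hι V) = t.val hι V := t.2

/-- The quadratic form `ᶥq ⊗ q` on `ᶥV ⊗[E] V`. -/
def conjTensorForm [Invertible (2 : E)] (q : QuadraticForm E V) :
    QuadraticForm E (Conjugate ι V ⊗[E] V) :=
  (Conjugate.quadraticForm hι q).tmul q

/-- The multiplicative transfer `N_{E/K}(q)`: the restriction of `ᶥq ⊗ q` to `N_{E/K}(V)`. The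
values of this restriction lie in `K`, and `½ Tr_{E/K}` is the identity on `K`; see
`algebraMap_transferForm`. -/
def transferForm [Invertible (2 : K)] [Invertible (2 : E)] (q : QuadraticForm E V) :
    QuadraticForm K (Transfer hι V) :=
  (⅟(2 : K) • (Algebra.trace K E).compQuadraticMap' (conjTensorForm hι q)).comp (Transfer.val hι V)

theorem associated_conjTensorForm_switch [Invertible (2 : E)] (q : QuadraticForm E V)
    (s t : Conjugate ι V ⊗[E] V) :
    QuadraticMap.associated (conjTensorForm hι q) (switch hι V s) (switch hι V t) =
      ι (QuadraticMap.associated (conjTensorForm hι q) s t) := by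
  have h2 : ι (⅟(2 : E)) = ⅟(2 : E) := by
    apply (isUnit_of_invertible (2 : E)).mul_left_cancel
    have h := congrArg ι (mul_invOf_self (2 : E))
    rw [map_mul, map_ofNat, map_one] at h
    rw [h, mul_invOf_self]
  have key : ∀ v w : Conjugate ι V,
      QuadraticMap.associated (Conjugate.quadraticForm hι q) v w =
        ι (QuadraticMap.associated q ((Conjugate.of ι).symm v) ((Conjugate.of ι).symm w)) := by
    intro v w
    simp [QuadraticMap.associated_apply, Conjugate.quadraticForm, h2]
  have key' : ∀ v w : V, QuadraticMap.associated (Conjugate.quadraticForm hι q)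
      (Conjugate.of ι v) (Conjugate.of ι w) = ι (QuadraticMap.associated q v w) := by
    intro v w
    simp [key]
  have e : QuadraticMap.associated (conjTensorForm hι q) =
      LinearMap.BilinForm.tmul (QuadraticMap.associated (Conjugate.quadraticForm hι q))
        (QuadraticMap.associated q) := QuadraticForm.associated_tmul _ _
  rw [e]
  induction s with
  | zero => simp
  | add s s' hs hs' => simp only [map_add, LinearMap.add_apply, hs, hs']
  | tmul x y =>
    induction t with
    | zero => simp
    | add t t' ht ht' => simp only [map_add, ht, ht']
    | tmul x' y' =>
      rw [switch_tmul, switch_tmul, LinearMap.BilinForm.tensorDistrib_tmul,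
        LinearMap.BilinForm.tensorDistrib_tmul, key', key]
      simp [apply_apply_of_orderOf_eq_two hι, mul_comm]

theorem algebraMap_transferForm [Invertible (2 : K)] [Invertible (2 : E)]
    (hE : Module.finrank K E = 2) (q : QuadraticForm E V) (t : Transfer hι V) :
    algebraMap K E (transferForm hι q t) = conjTensorForm hι q (t.val hι V) := by
  have hfix : ι (conjTensorForm hι q (t.val hι V)) = conjTensorForm hι q (t.val hι V) := by
    have h := associated_conjTensorForm_switch hι q (t.val hι V) (t.val hι V)
    rw [t.switch_val, QuadraticMap.associated_eq_self_apply] at h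
    exact h.symm
  have hmem : ∃ c : K, algebraMap K E c = conjTensorForm hι q (t.val hι V) := by
    have : Module.Finite K E := Module.finite_of_finrank_pos (by omega)
    have : Nontrivial E := Module.nontrivial_of_finrank_pos (R := K) (by omega)
    set F : Submodule K E := LinearMap.eqLocus ι.toLinearMap LinearMap.id with hF
    have h1 : (1 : E) ∈ F := by simp [hF]
    have hlt : Module.finrank K F < 2 := by
      rw [← hE]
      refine Submodule.finrank_lt fun htop => ?_
      have : ι = 1 := by
        ext e
        have : e ∈ F := htop ▸ Submodule.mem_top
        exact this
      rw [this, orderOf_one] at hι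
      omega
    have hpos : 0 < Module.finrank K F :=
      Module.finrank_pos_iff_exists_ne_zero.2
        ⟨⟨1, h1⟩, fun h => one_ne_zero (congrArg Subtype.val h)⟩
    obtain ⟨c, hc⟩ := exists_smul_eq_of_finrank_eq_one (by omega : Module.finrank K F = 1)
      (x := ⟨1, h1⟩) (fun h => one_ne_zero (congrArg Subtype.val h))
      (⟨conjTensorForm hι q (t.val hι V), hfix⟩ : F)
    refine ⟨c, ?_⟩
    rw [Algebra.algebraMap_eq_smul_one]
    exact congrArg Subtype.val hc
  obtain ⟨c, hc⟩ := hmem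
  have : transferForm hι q t = c := by
    change ⅟(2 : K) • Algebra.trace K E (conjTensorForm hι q (t.val hι V)) = c
    rw [← hc, Algebra.trace_algebraMap, hE, nsmul_eq_mul, Nat.cast_ofNat, smul_eq_mul,
      invOf_mul_cancel_left]
  rw [this, hc]

end Module

section Algebra

variable (hι : orderOf ι = 2) {C : Type*} [NonAssocRing C] [Module E C] [SMulCommClass E C C]
  [IsScalarTower E C C] [Module K C] [IsScalarTower K E C]

theorem switch_mul (s t : Conjugate ι C ⊗[E] C) :
    switch hι C (s * t) = switch hι C s * switch hι C t := by
  induction s with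
  | zero => simp
  | add s s' hs hs' => simp only [add_mul, map_add, hs, hs']
  | tmul x y =>
    induction t with
    | zero => simp
    | add t t' ht ht' => simp only [mul_add, map_add, ht, ht']
    | tmul x' y' =>
      simp only [Algebra.TensorProduct.tmul_mul_tmul, switch_tmul]
      rfl

instance : NonUnitalNonAssocRing (Transfer hι C) where
  mul s t := ⟨s.val hι C * t.val hι C, by
    change switch hι C _ = _
    rw [switch_mul, s.switch_val, t.switch_val]; rfl⟩
  left_distrib r s t := Subtype.ext (mul_add (r.val hι C) (s.val hι C) (t.val hι C))
  right_distrib r s t := Subtype.ext (add_mul (r.val hι C) (s.val hι C) (t.val hι C))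
  zero_mul r := Subtype.ext (zero_mul (r.val hι C))
  mul_zero r := Subtype.ext (mul_zero (r.val hι C))

theorem Transfer.val_mul (s t : Transfer hι C) :
    (s * t).val hι C = s.val hι C * t.val hι C := rfl

instance : SMulCommClass K (Transfer hι C) (Transfer hι C) where
  smul_comm k s t := by
    apply Transfer.val_injective hι
    simp only [smul_eq_mul, map_smul, Transfer.val_mul]
    simp only [← algebraMap_smul E k, mul_smul_comm]

instance : IsScalarTower K (Transfer hι C) (Transfer hι C) where
  smul_assoc k s t := by
    apply Transfer.val_injective hι
    simp only [smul_eq_mul, map_smul, Transfer.val_mul]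
    simp only [← algebraMap_smul E k, smul_mul_assoc]

/-- The tensor product of the canonical involutions on `ᶥC ⊗[E] C`. -/
def conjTensorInvolution (ι : E ≃ₐ[K] E) (n : QuadraticForm E C) :
    (Conjugate ι C ⊗[E] C) →ₗ[E] (Conjugate ι C ⊗[E] C) :=
  TensorProduct.map (Conjugate.map ι (octConj n)) (octConj n)

theorem switch_conjTensorInvolution (n : QuadraticForm E C) (t : Conjugate ι C ⊗[E] C) :
    switch hι C (conjTensorInvolution ι n t) = conjTensorInvolution ι n (switch hι C t) := by
  induction t with
  | zero => simp
  | add t t' ht ht' => simp only [map_add, ht, ht']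
  | tmul x y => rfl

/-- The involution of `N_{E/K}(C)`, where `C` is an octonion algebra with norm `n`: the
restriction of the tensor product of the canonical involutions. -/
def transferInvolution (n : QuadraticForm E C) : Transfer hι C →ₗ[K] Transfer hι C :=
  ((conjTensorInvolution ι n).restrictScalars K).restrict (p := transferSubmodule hι C)
    (q := transferSubmodule hι C) fun t ht => by
      change switch hι C _ = _
      rw [LinearMap.restrictScalars_apply, switch_conjTensorInvolution]
      exact congrArg _ ht

end Algebra

end Transfer

/-! ### Lie algebras on subspaces closed under a bracket -/

section LieOn

variable {K W : Type*} [CommRing K] [AddCommGroup W] [Module K W]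

/-- The subspace `p` is closed under the bilinear product `β`, and `β` satisfies the Lie algebra
identities on `p`. -/
structure IsLieOn (β : W →ₗ[K] W →ₗ[K] W) (p : Submodule K W) : Prop where
  mem : ∀ x ∈ p, ∀ y ∈ p, β x y ∈ p
  self : ∀ x ∈ p, β x x = 0
  leibniz : ∀ x ∈ p, ∀ y ∈ p, ∀ z ∈ p, β x (β y z) = β (β x y) z + β y (β x z)

variable {β : W →ₗ[K] W →ₗ[K] W} {p : Submodule K W}

/-- The subspace `p` as a Lie algebra with bracket `β`. -/
@[nolint unusedArguments]
def LieOn (_ : IsLieOn β p) : Type _ := ↥p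

instance (h : IsLieOn β p) : AddCommGroup (LieOn h) := inferInstanceAs (AddCommGroup ↥p)

instance (h : IsLieOn β p) : Module K (LieOn h) := inferInstanceAs (Module K ↥p)

instance (h : IsLieOn β p) : LieRing (LieOn h) where
  bracket x y := ⟨β x.1 y.1, h.mem _ x.2 _ y.2⟩
  add_lie x y z := Subtype.ext (LinearMap.map_add₂ β x.1 y.1 z.1)
  lie_add x y z := Subtype.ext (map_add (β x.1) y.1 z.1)
  lie_self x := Subtype.ext (h.self _ x.2)
  leibniz_lie x y z := Subtype.ext (h.leibniz _ x.2 _ y.2 _ z.2)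

instance (h : IsLieOn β p) : LieAlgebra K (LieOn h) where
  lie_smul k x y := Subtype.ext (map_smul (β x.1) k y.1)

end LieOn

/-! ### The Allison–Faulkner construction -/

namespace AllisonFaulkner

variable {K A : Type*} [Field K] [NonUnitalNonAssocRing A] [Module K A] [SMulCommClass K A A]
  [IsScalarTower K A A] (bar : A →ₗ[K] A) (γ : Fin 3 → Kˣ)


/-- The triple `T^i_{a,b}`, with indices mod 3, as a function of its index `m`. -/
def tripleFun (i : Fin 3) (a b : A) : Fin 3 → Module.End K A :=
  let L : A → Module.End K A := LinearMap.mulLeft K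
  let R : A → Module.End K A := LinearMap.mulRight K
  fun m =>
    if m = i then L (bar b) ∘ₗ L a - L (bar a) ∘ₗ L b
    else if m = i + 1 then R (bar b) ∘ₗ R a - R (bar a) ∘ₗ R b
    else R (bar a * b - bar b * a) + L b ∘ₗ L (bar a) - L a ∘ₗ L (bar b)

/-- The triple `T^i_{a,b}` as a bilinear function of `(a, b)`. -/
def triple (i : Fin 3) : A →ₗ[K] A →ₗ[K] (Fin 3 → Module.End K A) :=
  LinearMap.mk₂ K (tripleFun bar i)
    (fun a a' b => by
      funext m; ext x
      simp only [tripleFun, Pi.add_apply]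
      split_ifs <;> simp [add_mul, mul_add, mul_sub] <;> abel)
    (fun c a b => by
      funext m; ext x
      simp only [tripleFun, Pi.smul_apply]
      split_ifs <;> simp [mul_sub, smul_sub, smul_mul_assoc, mul_smul_comm])
    (fun a b b' => by
      funext m; ext x
      simp only [tripleFun, Pi.add_apply]
      split_ifs <;> simp [add_mul, mul_add, mul_sub] <;> abel)
    (fun c a b => by
      funext m; ext x
      simp only [tripleFun, Pi.smul_apply]
      split_ifs <;> simp [mul_sub, smul_sub, smul_mul_assoc, mul_smul_comm])

/-- The span `𝒯_I` of the triples `T^i_{a,b}` in `End(A)³`. -/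
def innerTriples : Submodule K (Fin 3 → Module.End K A) :=
  Submodule.span K {T | ∃ (i : Fin 3) (a b : A), T = tripleFun bar i a b}

/-- The ambient space `End(A)³ ⊕ A³` of the construction. In a pair `(T, a)` the entry `a k`
stands for `a[ij]`, where `(i j k)` is a cyclic permutation of the three indices, i.e.
`i = k + 1` and `j = k + 2` mod 3. -/
abbrev Ambient (K A : Type*) [Field K] [NonUnitalNonAssocRing A] [Module K A] : Type _ :=
  (Fin 3 → Module.End K A) × (Fin 3 → A)

/-- The product on `End(A)³ ⊕ A³` determined by
`[a[ij], b[jk]] = -[b[jk], a[ij]] = ab[ik]`, `[T, a[ij]] = -[a[ij], T] = T_k(a)[ij]` and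
`[a[ij], b[ij]] = γ_i γ_j⁻¹ T^i_{a,b}` for `(i j k)` cyclic, by the commutator in `End(A)³`, and
by the identification `a[ij] = -γ_i γ_j⁻¹ \overline{a}[ji]`. By the last one,
`[a[jk], b[ki]] = ab[ji] = -γ_j γ_i⁻¹ \overline{ab}[ij]`. -/
def bracketFun (x y : Ambient K A) : Ambient K A :=
  (x.1 * y.1 - y.1 * x.1 + ∑ k : Fin 3,
      ((γ (k + 1) : K) * (γ (k + 2) : K)⁻¹) • triple bar (k + 1) (x.2 k) (y.2 k),
   fun k => x.1 k (y.2 k) - y.1 k (x.2 k)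
      - ((γ (k + 2) : K) * (γ (k + 1) : K)⁻¹) •
          bar (x.2 (k + 1) * y.2 (k + 2) - y.2 (k + 1) * x.2 (k + 2)))

/-- `bracketFun` as a bilinear map. -/
def bracket : Ambient K A →ₗ[K] Ambient K A →ₗ[K] Ambient K A :=
  LinearMap.mk₂ K (bracketFun bar γ)
    (fun x x' y => by
      ext1
      · simp [bracketFun, Finset.sum_add_distrib, smul_add, add_mul, mul_add]; abel
      · funext k
        simp [bracketFun, add_mul, mul_add, smul_sub, smul_add]; abel)
    (fun c x y => by
      ext1
      · simp [bracketFun, Finset.smul_sum, smul_add, smul_sub, smul_comm c]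
      · funext k
        simp [bracketFun, smul_sub, smul_mul_assoc, mul_smul_comm, smul_comm c])
    (fun x y y' => by
      ext1
      · simp [bracketFun, Finset.sum_add_distrib, smul_add, add_mul, mul_add]; abel
      · funext k
        simp [bracketFun, add_mul, mul_add, smul_sub, smul_add]; abel)
    (fun c x y => by
      ext1
      · simp [bracketFun, Finset.smul_sum, smul_add, smul_sub, smul_comm c]
      · funext k
        simp [bracketFun, smul_sub, smul_mul_assoc, mul_smul_comm, smul_comm c])

/-- The subspace `K(A,-,γ) = 𝒯_I ⊕ A[12] ⊕ A[23] ⊕ A[31]`. -/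
def space : Submodule K (Ambient K A) :=
  (innerTriples bar).prod ⊤

end AllisonFaulkner

end

/-!
Because the norm of a composition algebra permits composition, its endomorphisms `T^i_{a,b}` obey
local triality: they form skew triples which are related by the product, and they depend
equivariantly on `(a, b)` under such triples. The identities expressing this are linear in each
variable, so they pass to tensor products and from there to the transfer, where they are exactly
the Jacobi identity of `K(A,-,γ)`.

For `w ∈ ⋀² C` let `D_w` be the triple of skew endomorphisms of `C` with `D_{u ∧ v} = T_{u,v}`.
Then `w ↦ ᶥD_w ⊗ 1 + 1 ⊗ D_w` identifies `⋀² C` with `𝒯_I`. Surjectivity comes down to the fact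
that a related skew triple of `C` is determined by its last component: a triple whose last
component is zero consists of multiplications by a trace zero element of the middle nucleus, and
there is none in rank greater than `4`.

The Killing form is invariant, and `[a[ij], b[ij]]` and `[T, a[ij]]` express the elements of `𝒯_I`
and their action through the entries, so all its values follow from those on `A[ij]`. There it is
the trace of an endomorphism of `A` built from products with `a` and `b`, which over `ᶥC ⊗ C` is
`60` times the tensor product of the polar forms.
-/

noncomputable section

open QuadraticMap (polar)

/-! ### Composition algebras -/

/-- The unital nonassociative algebra `C` is a composition algebra with norm `n`: the norm is
nondegenerate, unital and multiplicative. No condition is put on the rank, since triality only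
uses the norm; octonion algebras are the case of rank `8`. -/
structure IsCompositionAlgebra {E C : Type*} [CommRing E] [NonAssocRing C] [Module E C]
    (n : QuadraticForm E C) : Prop where
  nondegenerate : n.polarBilin.Nondegenerate
  map_one : n 1 = 1
  map_mul : ∀ x y : C, n (x * y) = n x * n y

section Nondegenerate

variable {E V : Type*} [CommRing E] [AddCommGroup V] [Module E V] {q : QuadraticForm E V}

theorem eq_of_forall_polar_eq (hq : q.polarBilin.Nondegenerate) {x y : V}
    (h : ∀ z, polar q x z = polar q y z) : x = y := by
  rw [← sub_eq_zero]
  refine hq.1 _ fun z => ?_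
  rw [QuadraticMap.polarBilin_apply_apply, QuadraticMap.polar_sub_left, h, sub_self]

theorem isSkewAdjoint_polarBilin_iff {f : Module.End E V} :
    q.polarBilin.IsSkewAdjoint f ↔ ∀ x y, polar q (f x) y = -polar q x (f y) := by
  simp only [LinearMap.IsSkewAdjoint, LinearMap.IsAdjointPair, Pi.neg_apply,
    QuadraticMap.polarBilin_apply_apply, QuadraticMap.polar_neg_right]

theorem polar_apply_left_of_isSkewAdjoint {f : Module.End E V} (hf : q.polarBilin.IsSkewAdjoint f)
    (x y : V) : polar q (f x) y = -polar q x (f y) :=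
  isSkewAdjoint_polarBilin_iff.1 hf x y

end Nondegenerate

section Composition

variable {E C : Type*} [CommRing E] [NonAssocRing C] [Module E C] {n : QuadraticForm E C}

theorem octConj_apply (x : C) : octConj n x = polar n x 1 • (1 : C) - x := rfl

namespace IsCompositionAlgebra

theorem polar_one_one (hn : IsCompositionAlgebra n) : polar n 1 1 = 2 := by
  rw [QuadraticMap.polar_self, hn.map_one, nsmul_eq_mul, mul_one, Nat.cast_ofNat]

theorem polar_mul_left (hn : IsCompositionAlgebra n) (x y z : C) :
    polar n (z * x) (z * y) = n z * polar n x y := by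
  simp only [polar, ← mul_add, hn.map_mul]; ring

theorem polar_mul_right (hn : IsCompositionAlgebra n) (x y z : C) :
    polar n (x * z) (y * z) = polar n x y * n z := by
  simp only [polar, ← add_mul, hn.map_mul]; ring

theorem polar_mul_mul (hn : IsCompositionAlgebra n) (x y z w : C) :
    polar n (x * z) (y * w) + polar n (x * w) (y * z) = polar n x y * polar n z w := by
  have h := hn.polar_mul_right x y (z + w)
  simp only [mul_add, QuadraticMap.polar_add_left, QuadraticMap.polar_add_right,
    hn.polar_mul_right, QuadraticMap.map_add n z w] at h
  linear_combination h

theorem polar_octConj_one (hn : IsCompositionAlgebra n) (x : C) :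
    polar n (octConj n x) 1 = polar n x 1 := by
  rw [octConj_apply, QuadraticMap.polar_sub_left, QuadraticMap.polar_smul_left, hn.polar_one_one,
    smul_eq_mul]
  ring

theorem octConj_octConj (hn : IsCompositionAlgebra n) (x : C) : octConj n (octConj n x) = x := by
  rw [octConj_apply (octConj n x), hn.polar_octConj_one, octConj_apply, sub_sub_cancel]

theorem polar_octConj_octConj (hn : IsCompositionAlgebra n) (x y : C) :
    polar n (octConj n x) (octConj n y) = polar n x y := by
  simp only [octConj_apply, QuadraticMap.polar_sub_left, QuadraticMap.polar_smul_left,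
    QuadraticMap.polar_sub_right, QuadraticMap.polar_smul_right, hn.polar_one_one, smul_eq_mul,
    QuadraticMap.polar_comm n 1 y]
  ring

theorem polar_octConj_left (hn : IsCompositionAlgebra n) (x y : C) :
    polar n (octConj n x) y = polar n x (octConj n y) := by
  rw [← hn.polar_octConj_octConj, hn.octConj_octConj]

section Right

variable [SMulCommClass E C C]

theorem polar_mul_eq_right (hn : IsCompositionAlgebra n) (x y z : C) :
    polar n (x * z) y = polar n x (y * octConj n z) := by
  have h := hn.polar_mul_mul x y z 1
  simp only [mul_one] at h
  rw [octConj_apply, mul_sub, mul_smul_comm, mul_one, QuadraticMap.polar_sub_right,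
    QuadraticMap.polar_smul_right, smul_eq_mul]
  linear_combination h

theorem mul_mul_octConj_add (hn : IsCompositionAlgebra n) (x y z : C) :
    (z * x) * octConj n y + (z * y) * octConj n x = polar n x y • z := by
  refine eq_of_forall_polar_eq hn.nondegenerate fun w => ?_
  have h := hn.polar_mul_mul z w x y
  rw [QuadraticMap.polar_add_left, hn.polar_mul_eq_right, hn.polar_mul_eq_right (z * y),
    hn.octConj_octConj, hn.octConj_octConj, QuadraticMap.polar_smul_left, smul_eq_mul]
  linear_combination h

theorem mul_octConj_mul_add_right (hn : IsCompositionAlgebra n) (x y z : C) :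
    (z * octConj n x) * y + (z * octConj n y) * x = polar n x y • z := by
  have h := hn.mul_mul_octConj_add (octConj n x) (octConj n y) z
  rwa [hn.octConj_octConj, hn.octConj_octConj, hn.polar_octConj_octConj] at h

end Right

section Left

variable [IsScalarTower E C C]

theorem polar_mul_eq_left (hn : IsCompositionAlgebra n) (x y z : C) :
    polar n (z * x) y = polar n x (octConj n z * y) := by
  have h := hn.polar_mul_mul z 1 x y
  simp only [one_mul] at h
  rw [octConj_apply, sub_mul, smul_mul_assoc, one_mul, QuadraticMap.polar_sub_right,
    QuadraticMap.polar_smul_right, smul_eq_mul]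
  rw [QuadraticMap.polar_comm n (z * y)] at h
  linear_combination h

theorem octConj_mul_mul_add (hn : IsCompositionAlgebra n) (x y z : C) :
    octConj n x * (y * z) + octConj n y * (x * z) = polar n x y • z := by
  refine eq_of_forall_polar_eq hn.nondegenerate fun w => ?_
  have h := hn.polar_mul_mul x y z w
  rw [QuadraticMap.polar_add_left, hn.polar_mul_eq_left, hn.polar_mul_eq_left (x * z),
    hn.octConj_octConj, hn.octConj_octConj, QuadraticMap.polar_smul_left, smul_eq_mul,
    QuadraticMap.polar_comm n (y * z)]
  linear_combination h

theorem mul_octConj_mul_add_left (hn : IsCompositionAlgebra n) (x y z : C) :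
    x * (octConj n y * z) + y * (octConj n x * z) = polar n x y • z := by
  have h := hn.octConj_mul_mul_add (octConj n x) (octConj n y) z
  rwa [hn.octConj_octConj, hn.octConj_octConj, hn.polar_octConj_octConj] at h

theorem octConj_mul_add (hn : IsCompositionAlgebra n) (x y : C) :
    octConj n x * y + octConj n y * x = polar n x y • (1 : C) := by
  simpa using hn.octConj_mul_mul_add x y 1

end Left

variable [SMulCommClass E C C] [IsScalarTower E C C]

theorem octConj_mul (hn : IsCompositionAlgebra n) (x y : C) :
    octConj n (x * y) = octConj n y * octConj n x := by
  refine eq_of_forall_polar_eq hn.nondegenerate fun z => ?_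
  rw [hn.polar_octConj_left, hn.polar_mul_eq_left, ← hn.polar_mul_eq_right,
    hn.polar_mul_eq_left _ _ (octConj n y), hn.octConj_octConj, QuadraticMap.polar_comm]

end IsCompositionAlgebra

end Composition

/-! ### Triality -/

section Triality

variable {R B : Type*} [CommRing R] [NonUnitalNonAssocRing B] [Module R B] [SMulCommClass R B B]
  [IsScalarTower R B B] (bar : B →ₗ[R] B)

/-- The components of the triples `T^i_{a,b}`, over an arbitrary commutative ring: the component
of index `i + j` of `T^i_{a,b}` is `triality bar j a b`. -/
def triality : Fin 3 → B →ₗ[R] B →ₗ[R] Module.End R B :=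
  let L : B →ₗ[R] Module.End R B := LinearMap.mul R B
  let alt (D : B →ₗ[R] B →ₗ[R] Module.End R B) := D.flip - D
  let comp := LinearMap.mul R (Module.End R B)
  ![alt (comp.compl₁₂ (L ∘ₗ bar) L), alt (comp.compl₁₂ (L.flip ∘ₗ bar) L.flip),
    alt (comp.compl₁₂ L (L ∘ₗ bar)) - alt ((L.compl₁₂ bar LinearMap.id).compr₂ L.flip)]

theorem triality_zero_apply (a b x : B) :
    triality bar 0 a b x = bar b * (a * x) - bar a * (b * x) := rfl

theorem triality_one_apply (a b x : B) :
    triality bar 1 a b x = (x * a) * bar b - (x * b) * bar a := rfl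

theorem triality_two_apply (a b x : B) : triality bar 2 a b x =
    b * (bar a * x) - a * (bar b * x) - (x * (bar b * a) - x * (bar a * b)) := rfl

theorem triality_self (j : Fin 3) (a : B) : triality bar j a a = 0 := by
  ext x
  fin_cases j
  · exact sub_self (bar a * (a * x))
  · exact sub_self (x * a * bar a)
  · simp [triality_two_apply]

theorem triality_swap (j : Fin 3) (a b : B) : triality bar j a b = -triality bar j b a :=
  (LinearMap.IsAlt.neg (triality_self bar j) b a).symm

/-- The triples `s` of endomorphisms compatible with the product up to triality:
`s_k` twisted by the involution acts on products `xy` like `s_{k+1}` on `x` and `s_{k+2}`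
on `y`. -/
def relatedTriples : Submodule R (Fin 3 → Module.End R B) where
  carrier := {s | ∀ k x y, s k (bar (x * y)) = bar (s (k + 1) x * y + x * s (k + 2) y)}
  add_mem' hs ht k x y := by
    simp only [Pi.add_apply, LinearMap.add_apply, hs k x y, ht k x y, ← map_add]
    congr 1
    noncomm_ring
  zero_mem' k x y := by simp
  smul_mem' c s hs k x y := by
    simp only [Pi.smul_apply, LinearMap.smul_apply, hs k x y, smul_mul_assoc, mul_smul_comm,
      ← smul_add, map_smul]

end Triality

theorem AllisonFaulkner.tripleFun_apply {K A : Type*} [Field K] [NonUnitalNonAssocRing A]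
    [Module K A] [SMulCommClass K A A] [IsScalarTower K A A] (bar : A →ₗ[K] A) (i : Fin 3)
    (a b : A) (m : Fin 3) : tripleFun bar i a b m = triality bar (m - i) a b := by
  ext x
  obtain ⟨j, rfl⟩ : ∃ j, m = j + i := ⟨m - i, (sub_add_cancel m i).symm⟩
  rw [add_sub_cancel_right]
  simp only [tripleFun, add_eq_right, add_comm i 1, add_left_inj]
  fin_cases j
  · rfl
  · rfl
  · simp [triality_two_apply, mul_sub]
    abel

namespace IsCompositionAlgebra

variable {E C : Type*} [CommRing E] [NonAssocRing C] [Module E C] {n : QuadraticForm E C}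
  [SMulCommClass E C C] [IsScalarTower E C C]

theorem triality_two (hn : IsCompositionAlgebra n) (a b x : C) :
    triality (octConj n) 2 a b x = (2 : E) • (polar n a x • b - polar n b x • a) := by
  have h1 := hn.mul_octConj_mul_add_left x a b
  have h2 := hn.mul_octConj_mul_add_left x b a
  have h3 := congrArg (b * ·) (hn.octConj_mul_add x a)
  have h4 := congrArg (a * ·) (hn.octConj_mul_add x b)
  simp only [mul_add, mul_smul_comm, mul_one] at h3 h4
  rw [triality_two_apply, QuadraticMap.polar_comm n a, QuadraticMap.polar_comm n b]
  linear_combination (norm := module) h1 - h2 + h3 - h4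

theorem polar_triality (hn : IsCompositionAlgebra n) (j : Fin 3) (a b x y : C) :
    polar n (triality (octConj n) j a b x) y =
      polar n (triality (octConj n) (1 - j) x y a) b := by
  have h01 (a b x y : C) : polar n (triality (octConj n) 0 a b x) y =
      polar n (triality (octConj n) 1 x y a) b := by
    rw [triality_zero_apply, triality_one_apply, QuadraticMap.polar_sub_left,
      QuadraticMap.polar_sub_left, hn.polar_mul_eq_left (a * x), hn.polar_mul_eq_left (b * x),
      hn.polar_mul_eq_right _ b, hn.polar_mul_eq_right _ b]
    simp only [hn.octConj_octConj]
    rw [QuadraticMap.polar_comm n (b * x), QuadraticMap.polar_comm n (a * y)]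
  fin_cases j
  · exact h01 a b x y
  · exact (h01 x y a b).symm
  · change polar n (triality (octConj n) 2 a b x) y = polar n (triality (octConj n) 2 x y a) b
    rw [hn.triality_two, hn.triality_two]
    simp only [QuadraticMap.polar_sub_left, QuadraticMap.polar_smul_left, smul_eq_mul,
      QuadraticMap.polar_comm n x, QuadraticMap.polar_comm n y]
    ring

theorem isSkewAdjoint_triality (hn : IsCompositionAlgebra n) (j : Fin 3) (a b : C) :
    n.polarBilin.IsSkewAdjoint (triality (octConj n) j a b) :=
  isSkewAdjoint_polarBilin_iff.2 fun x y => by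
    rw [hn.polar_triality, triality_swap, LinearMap.neg_apply, QuadraticMap.polar_neg_left,
      ← sub_sub_cancel 1 j, ← hn.polar_triality, QuadraticMap.polar_comm, sub_sub_cancel]

theorem polar_mul_octConj_rotate (hn : IsCompositionAlgebra n) (x y z : C) :
    polar n (x * y) (octConj n z) = polar n (y * z) (octConj n x) := by
  rw [hn.polar_mul_eq_left, hn.polar_mul_eq_right]

/-- The cyclic symmetry of the trilinear form `n(xy, z̄)` makes the three relations of a related
triple of skew maps equivalent to each other. -/
theorem mem_relatedTriples_iff (hn : IsCompositionAlgebra n) {s : Fin 3 → Module.End E C}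
    (hs : ∀ k, n.polarBilin.IsSkewAdjoint (s k)) (k : Fin 3) :
    s ∈ relatedTriples (octConj n) ↔ ∀ x y z, polar n (s (k + 1) x * y) (octConj n z)
      + polar n (x * s (k + 2) y) (octConj n z) + polar n (x * y) (octConj n (s k z)) = 0 := by
  have relation (i : Fin 3) (x y z : C) : polar n (octConj n (s (i + 1) x * y + x * s (i + 2) y)) z
      - polar n (s i (octConj n (x * y))) z = polar n (s (i + 1) x * y) (octConj n z)
        + polar n (x * s (i + 2) y) (octConj n z) + polar n (x * y) (octConj n (s i z)) := by
    rw [polar_apply_left_of_isSkewAdjoint (hs i), hn.polar_octConj_left, hn.polar_octConj_left,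
      QuadraticMap.polar_add_left, sub_neg_eq_add]
  have rotate (i : Fin 3) (h : ∀ x y z, polar n (s (i + 1) x * y) (octConj n z)
      + polar n (x * s (i + 2) y) (octConj n z) + polar n (x * y) (octConj n (s i z)) = 0)
      (x y z : C) : polar n (s (i + 1 + 1) x * y) (octConj n z)
        + polar n (x * s (i + 1 + 2) y) (octConj n z)
        + polar n (x * y) (octConj n (s (i + 1) z)) = 0 := by
    have h' := h z x y
    rw [hn.polar_mul_octConj_rotate, hn.polar_mul_octConj_rotate z,
      hn.polar_mul_octConj_rotate z x] at h'
    rw [show i + 1 + 1 = i + 2 by grind, show i + 1 + 2 = i by grind]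
    linear_combination h'
  refine ⟨fun h x y z => by rw [← relation, h, sub_self], fun h i x y => ?_⟩
  refine eq_of_forall_polar_eq hn.nondegenerate fun z => ?_
  rw [eq_comm, ← sub_eq_zero, relation]
  obtain rfl | rfl | rfl : i = k ∨ i = k + 1 ∨ i = k + 1 + 1 := by clear h; decide +revert
  · exact h x y z
  · exact rotate _ h x y z
  · exact rotate _ (rotate _ h) x y z

theorem triality_zero_mul_add_mul_triality_one (hn : IsCompositionAlgebra n) (a b x y : C) :
    triality (octConj n) 0 a b x * y + x * triality (octConj n) 1 a b y =
      (2 : E) • (polar n (x * y) (octConj n a) • octConj n b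
        - polar n (x * y) (octConj n b) • octConj n a) := by
  have hleft (a b : C) := hn.mul_octConj_mul_add_right (octConj n (a * x)) y (octConj n b)
  have hright (a b : C) := hn.mul_octConj_mul_add_left x (octConj n (y * a)) (octConj n b)
  have hpolar (a : C) := (hn.polar_octConj_left (a * x) y).trans
    (hn.polar_mul_octConj_rotate a x y)
  simp only [hn.octConj_octConj, hn.octConj_mul] at hleft hright hpolar
  simp only [hpolar, ← hn.polar_mul_eq_right] at hleft hright
  simp only [triality_zero_apply, triality_one_apply, sub_mul, mul_sub]
  linear_combination (norm := module) hleft a b - hleft b a + hright a b - hright b a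

theorem triality_mem_relatedTriples (hn : IsCompositionAlgebra n) (a b : C) :
    (fun k => triality (octConj n) k a b) ∈ relatedTriples (octConj n) := by
  rw [hn.mem_relatedTriples_iff (fun k => hn.isSkewAdjoint_triality k a b) 2]
  intro x y z
  have h := congrArg (fun v => polar n v (octConj n z))
    (hn.triality_zero_mul_add_mul_triality_one a b x y)
  simp only [QuadraticMap.polar_add_left, QuadraticMap.polar_sub_left,
    QuadraticMap.polar_smul_left, hn.polar_octConj_octConj, smul_eq_mul] at h
  change polar n (triality (octConj n) 0 a b x * y) _
    + polar n (x * triality (octConj n) 1 a b y) _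
    + polar n (x * y) (octConj n (triality (octConj n) 2 a b z)) = 0
  rw [h, hn.triality_two]
  simp only [map_sub, map_smul, QuadraticMap.polar_sub_right, QuadraticMap.polar_smul_right,
    smul_eq_mul]
  ring

/-- `T^i_{a,b}` depends equivariantly on `(a, b)`: related skew triples act on `a` and `b`
through the component of index `i + 2`. -/
theorem lie_triality (hn : IsCompositionAlgebra n) {s : Fin 3 → Module.End E C}
    (hs : ∀ k, n.polarBilin.IsSkewAdjoint (s k)) (hr : s ∈ relatedTriples (octConj n))
    (i j : Fin 3) (a b : C) : ⁅s (j + i), triality (octConj n) j a b⁆ =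
      triality (octConj n) j (s (i + 2) a) b + triality (octConj n) j a (s (i + 2) b) := by
  have i11 : i + 1 + 1 = i + 2 := by grind
  have i12 : i + 1 + 2 = i := by grind
  ext x
  rw [Ring.lie_def, LinearMap.sub_apply, Module.End.mul_apply, Module.End.mul_apply,
    LinearMap.add_apply]
  fin_cases j
  · have hcomp (a b : C) : s i (octConj n b * (a * x)) = octConj n (s (i + 2) b) * (a * x)
        + octConj n b * (s (i + 2) a * x) + octConj n b * (a * s i x) := by
      have h := hr i (octConj n (a * x)) b
      rw [hn.octConj_mul, hn.octConj_octConj] at h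
      rw [h, map_add, hn.octConj_mul, hr (i + 1) a x, hn.octConj_mul (octConj n (a * x)),
        hn.octConj_octConj, hn.octConj_octConj, i11, i12, mul_add]
      abel
    simp only [Fin.zero_eta, zero_add, triality_zero_apply, map_sub, hcomp]
    abel
  · have hcomp (a b : C) : s (i + 1) (x * a * octConj n b) = x * a * octConj n (s (i + 2) b)
        + x * s (i + 2) a * octConj n b + s (i + 1) x * a * octConj n b := by
      have h := hr (i + 1) b (octConj n (x * a))
      rw [hn.octConj_mul, hn.octConj_octConj] at h
      rw [h, map_add, hn.octConj_mul, i12, hr i x a, hn.octConj_mul b, hn.octConj_octConj,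
        hn.octConj_octConj, i11, add_mul]
      abel
    simp only [Fin.mk_one, add_comm 1 i, triality_one_apply, map_sub, hcomp]
    abel
  · simp only [Fin.reduceFinMk, add_comm 2 i, hn.triality_two, map_sub, map_smul,
      polar_apply_left_of_isSkewAdjoint (hs (i + 2))]
    module

theorem triality_octConj_mul_add (hn : IsCompositionAlgebra n) (j : Fin 3) (a b c : C) :
    triality (octConj n) j a (octConj n (b * c))
      + triality (octConj n) (j - 1) b (octConj n (c * a))
      + triality (octConj n) (j - 2) c (octConj n (a * b)) = 0 := by
  ext x
  refine eq_of_forall_polar_eq hn.nondegenerate fun y => ?_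
  have h := (hn.mem_relatedTriples_iff (fun k => hn.isSkewAdjoint_triality k x y) (1 - j)).1
    (hn.triality_mem_relatedTriples x y) b c a
  rw [hn.polar_mul_eq_right, hn.polar_mul_eq_left, ← hn.octConj_mul, ← hn.octConj_mul] at h
  simp only [LinearMap.add_apply, LinearMap.zero_apply, QuadraticMap.polar_add_left,
    QuadraticMap.polar_zero_left]
  rw [hn.polar_triality j, hn.polar_triality (j - 1), hn.polar_triality (j - 2),
    show 1 - (j - 1) = 1 - j + 1 by grind,
    show 1 - (j - 2) = 1 - j + 2 by grind,
    QuadraticMap.polar_comm n _ (octConj n (b * c)), hn.polar_octConj_left (b * c)]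
  linear_combination h

end IsCompositionAlgebra

/-! ### Traces and ranks -/

section Trace

variable {K E V : Type*} [CommRing K] [CommRing E] [Algebra K E] [AddCommGroup V] [Module E V]
  [Module K V] [IsScalarTower K E V] [Module.Free K E] [Module.Finite K E] [Module.Free E V]
  [Module.Finite E V]

theorem trace_restrictScalars_smulRight (φ : V →ₗ[E] E) (v : V) :
    LinearMap.trace K V ((φ.smulRight v).restrictScalars K) = Algebra.trace K E (φ v) := by
  have : Module.Free K V := .trans (S := E)
  have : Module.Finite K V := Module.Finite.trans E V
  have hcomp : (φ.smulRight v).restrictScalars K =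
      (LinearMap.toSpanSingleton E V v).restrictScalars K ∘ₗ φ.restrictScalars K := by
    ext x; simp
  rw [hcomp, LinearMap.trace_comp_comm', Algebra.trace_apply]
  congr 1
  ext e
  simp [mul_comm]

theorem trace_restrictScalars (f : Module.End E V) :
    LinearMap.trace K V (f.restrictScalars K) = Algebra.trace K E (LinearMap.trace E V f) := by
  let b := Module.Free.chooseBasis E V
  have hf : f = ∑ i, (b.coord i).smulRight (f (b i)) := b.ext fun j => by
    simp [LinearMap.sum_apply, Finsupp.single_apply, ite_smul]
  have hsum : f.restrictScalars K = ∑ i, ((b.coord i).smulRight (f (b i))).restrictScalars K := by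
    conv_lhs => rw [hf]
    exact map_sum (LinearMap.restrictScalarsₗ K E V V K) _ _
  rw [hsum, map_sum]
  conv_rhs => rw [hf]
  simp only [map_sum, trace_restrictScalars_smulRight, LinearMap.trace_smulRight]

end Trace

theorem eq_zero_of_smul_id_eq_sum_smulRight {R V κ : Type*} [CommRing R] [IsReduced R]
    [AddCommGroup V] [Module R V] [Module.Free R V] [Module.Finite R V] [Fintype κ]
    (hκ : Fintype.card κ < Module.finrank R V) {c : R} {φ : κ → V →ₗ[R] R} {v : κ → V}
    (h : c • LinearMap.id = ∑ k, (φ k).smulRight (v k)) : c = 0 := by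
  nontriviality R
  let b := Module.finBasis R V
  let A : Matrix (Fin (Module.finrank R V)) κ R := .of fun i k => b.repr (v k) i
  let B : Matrix κ (Fin (Module.finrank R V)) R := .of fun k j => φ k (b j)
  have hAB : A * B = c • 1 := by
    ext i j
    have := congrArg (fun f => b.repr (f (b j)) i) h
    simp only [LinearMap.smul_apply, LinearMap.id_apply, LinearMap.sum_apply, map_sum, map_smul,
      LinearMap.smulRight_apply, Module.Basis.repr_self, Finsupp.coe_finsetSum, Finset.sum_apply,
      Finsupp.smul_apply, smul_eq_mul, Finsupp.single_apply] at this
    simp only [A, B, Matrix.mul_apply, Matrix.of_apply, Matrix.smul_apply, Matrix.one_apply,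
      smul_eq_mul, eq_comm (a := i), this, mul_comm]
  have hle : Fintype.card κ ≤ Fintype.card (Fin (Module.finrank R V)) := by
    rw [Fintype.card_fin]
    exact hκ.le
  classical
  have hdet := congrArg (Polynomial.eval 0) (Matrix.charpoly_mul_comm_of_le A B hle)
  rw [Matrix.eval_charpoly, hAB, map_zero, zero_sub, ← neg_smul, Matrix.det_smul, Matrix.det_one,
    mul_one, Polynomial.eval_mul, Polynomial.eval_pow, Polynomial.eval_X, Fintype.card_fin,
    zero_pow (Nat.sub_ne_zero_of_lt hκ), zero_mul] at hdet
  exact neg_eq_zero.1 (pow_eq_zero_iff (Nat.ne_zero_of_lt hκ) |>.1 hdet)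

section DualFamily

variable {E V ι : Type*} [CommRing E] [IsArtinianRing E] [AddCommGroup V] [Module E V]
  {q : QuadraticForm E V}

theorem exists_dual_family [Fintype ι] (hq : q.polarBilin.Nondegenerate)
    (b : Module.Basis ι E V) : ∃ f : ι → V, (∀ v, ∑ i, polar q (f i) v • b i = v) ∧
      ∀ v, ∑ i, polar q (b i) v • f i = v := by
  classical
  have : Module.Finite E V := Module.Finite.of_basis b
  have hinj : Function.Injective (b.toDualEquiv.symm.toLinearMap ∘ₗ q.polarBilin) :=
    b.toDualEquiv.symm.injective.comp fun x y h =>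
      eq_of_forall_polar_eq hq fun z => DFunLike.congr_fun h z
  have hbij := IsArtinian.bijective_of_injective_endomorphism _ hinj
  choose f hf using fun i => hbij.2 (b.toDualEquiv.symm (b.coord i))
  have hcoord (i : ι) (v : V) : polar q (f i) v = b.coord i v :=
    DFunLike.congr_fun (b.toDualEquiv.symm.injective (hf i)) v
  have hb (v : V) : ∑ i, polar q (f i) v • b i = v := by
    simp only [hcoord, Module.Basis.coord_apply, b.sum_repr]
  refine ⟨f, hb, fun v => eq_of_forall_polar_eq hq fun z => ?_⟩
  conv_rhs => rw [← hb z]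
  simp only [← QuadraticMap.polarBilin_apply_apply, map_sum, LinearMap.sum_apply, map_smul,
    LinearMap.smul_apply, smul_eq_mul]
  simp only [QuadraticMap.polarBilin_apply_apply, QuadraticMap.polar_comm q v, mul_comm]

theorem trace_eq_zero_of_isSkewAdjoint [Module.Free E V] [Module.Finite E V]
    (h2 : IsUnit (2 : E)) (hq : q.polarBilin.Nondegenerate) {s : Module.End E V}
    (hs : q.polarBilin.IsSkewAdjoint s) : LinearMap.trace E V s = 0 := by
  obtain ⟨f, he, hf⟩ := exists_dual_family hq (Module.Free.chooseBasis E V)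
  set e := Module.Free.chooseBasis E V
  have expand (g h : Module.Free.ChooseBasisIndex E V → V)
      (hgh : ∀ v, ∑ i, polar q (g i) v • h i = v) :
      LinearMap.trace E V s = ∑ i, polar q (g i) (s (h i)) := by
    have : s = ∑ i, (q.polarBilin (g i)).smulRight (s (h i)) := by
      ext x
      conv_lhs => rw [← hgh x]
      simp
    conv_lhs => rw [this]
    simp
  refine h2.mul_right_eq_zero.1 ?_
  rw [two_mul]
  nth_rw 1 [expand f e he]
  rw [expand e f hf, ← Finset.sum_add_distrib]
  refine Finset.sum_eq_zero fun i _ => ?_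
  rw [QuadraticMap.polar_comm, polar_apply_left_of_isSkewAdjoint hs, add_comm, add_neg_cancel]

end DualFamily
/-! ### The middle nucleus of a composition algebra -/

namespace IsCompositionAlgebra

variable {E C : Type*} [CommRing E] [NonAssocRing C] [Module E C] {n : QuadraticForm E C}

theorem octConj_mul_mul_self [IsScalarTower E C C] (hn : IsCompositionAlgebra n) (x z : C) :
    octConj n x * (x * z) = n x • z :=
  eq_of_forall_polar_eq hn.nondegenerate fun w => by
    rw [hn.polar_mul_eq_left, hn.octConj_octConj, hn.polar_mul_left, QuadraticMap.polar_smul_left,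
      smul_eq_mul]

theorem mul_mul_octConj_self [SMulCommClass E C C] (hn : IsCompositionAlgebra n) (x z : C) :
    (z * x) * octConj n x = n x • z :=
  eq_of_forall_polar_eq hn.nondegenerate fun w => by
    rw [hn.polar_mul_eq_right, hn.octConj_octConj, hn.polar_mul_right,
      QuadraticMap.polar_smul_left, smul_eq_mul, mul_comm]

theorem octConj_sub_octConj (hn : IsCompositionAlgebra n) (x : C) :
    octConj n (x - octConj n x) = -(x - octConj n x) := by
  rw [map_sub, hn.octConj_octConj, neg_sub]

theorem map_sub_octConj (hn : IsCompositionAlgebra n) (x : C) :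
    n (x - octConj n x) = 4 * n x - polar n x 1 ^ 2 := by
  rw [show x - octConj n x = (2 : E) • x + -(polar n x 1 • 1) by rw [octConj_apply]; module,
    QuadraticMap.map_add n, QuadraticMap.map_neg, QuadraticMap.map_smul, QuadraticMap.map_smul,
    QuadraticMap.polar_neg_right, QuadraticMap.polar_smul_left, QuadraticMap.polar_smul_right,
    hn.map_one]
  simp only [smul_eq_mul]
  ring

theorem polar_sub_octConj (hn : IsCompositionAlgebra n) {p : C} (hp : octConj n p = -p) (x : C) :
    polar n (x - octConj n x) p = 2 * polar n x p := by
  rw [QuadraticMap.polar_sub_left, hn.polar_octConj_left, hp, QuadraticMap.polar_neg_right]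
  ring

section Nucleus

variable [SMulCommClass E C C] {p : C}

theorem mul_mul_eq_of_mem_nucleus (hn : IsCompositionAlgebra n) (hp : octConj n p = -p)
    (h : ∀ x y : C, (x * p) * y = x * (p * y)) (x y : C) : x * (y * p) = (x * y) * p := by
  have h1 := hn.mul_mul_octConj_add y p x
  have h2 := congrArg (x * ·) (hn.mul_mul_octConj_add y p 1)
  simp only [one_mul, hp, mul_neg, mul_add, mul_smul_comm, mul_one, ← h] at h1 h2
  linear_combination (norm := module) h1 - h2

variable [IsScalarTower E C C]

theorem two_smul_mul_mul_of_mem_nucleus (hn : IsCompositionAlgebra n) (hp : octConj n p = -p)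
    (h : ∀ x y : C, (x * p) * y = x * (p * y)) {x : C} (hx : octConj n x = -x) (y : C) :
    (2 : E) • (x * (y * p)) = polar n x p • y + (polar n (x * p) y • 1 + polar n 1 y • (x * p)
      - polar n x y • p - polar n p y • x) := by
  have hxp : polar n (x * p) 1 = -polar n x p := by
    rw [hn.polar_mul_eq_right, hp, one_mul, QuadraticMap.polar_neg_right]
  have hconj : octConj n (x * p) * y = -(polar n x p • y) - x * (p * y) := by
    rw [octConj_apply, hxp, sub_mul, smul_mul_assoc, one_mul, neg_smul, h]
  have h1 := hn.octConj_mul_mul_add y (x * p) 1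
  have h2 := hn.octConj_mul_mul_add y x p
  have h3 := congrArg (x * ·) (hn.octConj_mul_add p y)
  simp only [hp, mul_add, neg_mul, mul_neg, octConj_apply y, sub_mul, smul_mul_assoc, one_mul,
    mul_sub, mul_smul_comm, mul_one, hx] at h1 h2 h3
  rw [hconj] at h1
  rw [QuadraticMap.polar_comm n (x * p), QuadraticMap.polar_comm n 1,
    QuadraticMap.polar_comm n x y]
  linear_combination (norm := module) h1 - h2 - h3

variable [IsReduced E] [Module.Free E C] [Module.Finite E C]

/-- With `M = L_x R_p`, the operator `2M - n(x,p)` has rank at most `4`, hence so has its product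
with `2M + n(x,p)`, which is the scalar `4 n(x) n(p) - n(x,p)²`. -/
theorem polar_sq_of_mem_nucleus (hn : IsCompositionAlgebra n) (hC : 4 < Module.finrank E C)
    (hp : octConj n p = -p) (h : ∀ x y : C, (x * p) * y = x * (p * y)) {x : C}
    (hx : octConj n x = -x) : polar n x p ^ 2 = 4 * n x * n p := by
  let M : Module.End E C := LinearMap.mulLeft E x ∘ₗ LinearMap.mulRight E p
  let φ : Fin 4 → C →ₗ[E] E :=
    ![n.polarBilin (x * p), n.polarBilin 1, -n.polarBilin x, -n.polarBilin p]
  let v : Fin 4 → C := ![1, x * p, p, x]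
  have hxx (z : C) : x * (x * z) = -(n x • z) := by
    rw [← hn.octConj_mul_mul_self, hx, neg_mul, neg_neg]
  have hpp (z : C) : (z * p) * p = -(n p • z) := by
    rw [← hn.mul_mul_octConj_self, hp, mul_neg, neg_neg]
  have hMM (y : C) : M (M y) = (n x * n p) • y := by
    change x * (x * (y * p) * p) = _
    rw [← hn.mul_mul_eq_of_mem_nucleus hp h, hpp, mul_neg, mul_neg, mul_smul_comm, mul_smul_comm,
      hxx, smul_neg, neg_neg, smul_smul, mul_comm]
  have hM (y : C) : (2 : E) • M y = polar n x p • y + ∑ k, φ k y • v k := by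
    rw [Fin.sum_univ_four]
    refine (hn.two_smul_mul_mul_of_mem_nucleus hp h hx y).trans ?_
    simp [φ, v, sub_eq_add_neg, add_assoc]
  have key : (4 * n x * n p - polar n x p ^ 2) • LinearMap.id =
      ∑ k, (φ k).smulRight ((2 : E) • M (v k) + polar n x p • v k) := by
    ext y
    have h1 := congrArg M (hM y)
    have h2 := hM y
    simp only [map_smul, map_add, map_sum, hMM] at h1
    simp only [LinearMap.smul_apply, LinearMap.id_apply, LinearMap.sum_apply,
      LinearMap.smulRight_apply, smul_add, Finset.sum_add_distrib, smul_comm _ (2 : E),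
      smul_comm _ (polar n x p), ← Finset.smul_sum]
    linear_combination (norm := module) (2 : E) • h1 + polar n x p • h2
  have hzero := eq_zero_of_smul_id_eq_sum_smulRight (by simpa using hC) key
  linear_combination -hzero

theorem eq_zero_of_mem_nucleus (hn : IsCompositionAlgebra n) (h2 : IsUnit (2 : E))
    (hC : 4 < Module.finrank E C) (hp : octConj n p = -p)
    (h : ∀ x y : C, (x * p) * y = x * (p * y)) : p = 0 := by
  have hsq (x : C) : polar n x p ^ 2 = (4 * n x - polar n x 1 ^ 2) * n p := by
    have := hn.polar_sq_of_mem_nucleus hC hp h (hn.octConj_sub_octConj x)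
    rw [hn.polar_sub_octConj hp, hn.map_sub_octConj] at this
    refine (h2.mul h2).mul_left_cancel ?_
    linear_combination this
  have hpolarized (x y : C) : polar n x p * polar n y p =
      (2 * polar n x y - polar n x 1 * polar n y 1) * n p := by
    have := hsq (x + y)
    rw [QuadraticMap.polar_add_left, QuadraticMap.polar_add_left, QuadraticMap.map_add n] at this
    refine h2.mul_left_cancel ?_
    linear_combination this - hsq x - hsq y
  have hrank : (2 * n p) • LinearMap.id =
      ∑ k : Fin 2, (![n.polarBilin p, n.polarBilin 1] k).smulRight (![p, n p • 1] k) := by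
    ext x
    refine eq_of_forall_polar_eq hn.nondegenerate fun y => ?_
    simp only [Fin.sum_univ_two, LinearMap.add_apply, LinearMap.smul_apply, LinearMap.id_apply,
      LinearMap.smulRight_apply, Matrix.cons_val_zero, Matrix.cons_val_one,
      QuadraticMap.polarBilin_apply_apply, QuadraticMap.polar_add_left,
      QuadraticMap.polar_smul_left, smul_eq_mul, QuadraticMap.polar_comm n p,
      QuadraticMap.polar_comm n 1]
    linear_combination -hpolarized x y
  have hnp : n p = 0 := h2.mul_right_eq_zero.1
    (eq_zero_of_smul_id_eq_sum_smulRight (by rw [Fintype.card_fin]; lia) hrank)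
  refine eq_of_forall_polar_eq hn.nondegenerate fun x => ?_
  rw [QuadraticMap.polar_zero_left, QuadraticMap.polar_comm]
  exact pow_eq_zero_iff two_ne_zero |>.1 (by rw [hsq, hnp, mul_zero])

/-- If `s 2 = 0`, then `s 0` is right multiplication by an element `p` of the middle nucleus and
`s 1` is left multiplication by `-p`. -/
theorem eq_zero_of_mem_relatedTriples (hn : IsCompositionAlgebra n) (h2 : IsUnit (2 : E))
    (hC : 4 < Module.finrank E C) {s : Fin 3 → Module.End E C}
    (hs : n.polarBilin.IsSkewAdjoint (s 0)) (hr : s ∈ relatedTriples (octConj n))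
    (h : s 2 = 0) : s = 0 := by
  have hadd (x y : C) : s 0 x * y + x * s 1 y = 0 := by
    have := hr 2 x y
    rw [h, LinearMap.zero_apply] at this
    rw [← hn.octConj_octConj (s 0 x * y + x * s 1 y)]
    exact (congrArg (octConj n) this.symm).trans (map_zero _)
  have hs1 (y : C) : s 1 y = -(s 0 1 * y) := by
    have := hadd 1 y
    rw [one_mul] at this
    exact eq_neg_of_add_eq_zero_right this
  have hs0 (x : C) : s 0 x = x * s 0 1 := by
    have := hadd x 1
    rw [hs1, mul_one, mul_one, mul_neg] at this
    exact add_neg_eq_zero.1 this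
  have hconj : octConj n (s 0 1) = -s 0 1 := by
    have := polar_apply_left_of_isSkewAdjoint hs 1 1
    rw [QuadraticMap.polar_comm n 1, eq_neg_iff_add_eq_zero, ← two_mul,
      h2.mul_right_eq_zero] at this
    rw [octConj_apply, this, zero_smul, zero_sub]
  have hp : s 0 1 = 0 := hn.eq_zero_of_mem_nucleus h2 hC hconj fun x y => by
    have := hadd x y
    rw [hs0 x, hs1, mul_neg] at this
    exact add_neg_eq_zero.1 this
  funext k
  fin_cases k
  · ext x
    exact (hs0 x).trans (by rw [hp, mul_zero]; rfl)
  · ext y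
    exact (hs1 y).trans (by rw [hp, zero_mul, neg_zero]; rfl)
  · exact h

end Nucleus

end IsCompositionAlgebra

/-! ### Exterior squares -/

section Wedge

variable {R V M : Type*} [CommRing R] [AddCommGroup V] [Module R V] [AddCommGroup M] [Module R M]

/-- The exterior product `u ∧ v` of two vectors, as a bilinear map. -/
def wedge : V →ₗ[R] V →ₗ[R] ⋀[R]^2 V :=
  LinearMap.mk₂ R (fun u v => exteriorPower.ιMulti R 2 ![u, v])
    (fun u u' v => (exteriorPower.ιMulti R 2).map_vecCons_add ![v] u u')
    (fun c u v => (exteriorPower.ιMulti R 2).map_vecCons_smul ![v] c u)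
    (fun u v v' => by
      have h := (exteriorPower.ιMulti R 2).map_update_add ![u, v] 1 v v'
      have e : ∀ w : V, Function.update ![u, v] 1 w = ![u, w] := fun w => by
        ext i; fin_cases i <;> rfl
      rwa [e, e, e] at h)
    (fun c u v => by
      have h := (exteriorPower.ιMulti R 2).map_update_smul ![u, v] 1 c v
      have e : ∀ w : V, Function.update ![u, v] 1 w = ![u, w] := fun w => by
        ext i; fin_cases i <;> rfl
      rwa [e, e] at h)

theorem wedge_self (u : V) : wedge (R := R) u u = 0 :=
  (exteriorPower.ιMulti R 2).map_eq_zero_of_eq ![u, u] (i := 0) (j := 1) rfl (by decide)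

theorem wedge_swap (u v : V) : wedge (R := R) u v = - wedge v u := by
  have h := wedge_self (R := R) (u + v)
  simp only [map_add, LinearMap.add_apply, wedge_self, zero_add, add_zero] at h
  exact eq_neg_of_add_eq_zero_right h

theorem span_wedge : Submodule.span R {w : ⋀[R]^2 V | ∃ u v, w = wedge u v} = ⊤ := by
  rw [eq_top_iff, ← exteriorPower.ιMulti_span R 2 V]
  refine Submodule.span_mono ?_
  rintro _ ⟨a, rfl⟩
  refine ⟨a 0, a 1, congrArg _ ?_⟩
  ext i; fin_cases i <;> rfl

theorem wedge_induction {p : ⋀[R]^2 V → Prop} (hw : ∀ u v, p (wedge u v))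
    (hz : p 0) (ha : ∀ x y, p x → p y → p (x + y)) (w : ⋀[R]^2 V) : p w := by
  have h : w ∈ Submodule.span R {w : ⋀[R]^2 V | ∃ u v, w = wedge u v} := by
    rw [span_wedge]; trivial
  induction h using Submodule.closure_induction with
  | zero => exact hz
  | add x y _ _ hx hy => exact ha x y hx hy
  | smul_mem c x hx =>
    obtain ⟨u, v, rfl⟩ := hx
    rw [← LinearMap.smul_apply, ← map_smul]
    exact hw _ _

/-- The linear map on `⋀² V` induced by an alternating bilinear map. -/
def wedgeLift (f : V →ₗ[R] V →ₗ[R] M) (hf : ∀ v, f v v = 0) : ⋀[R]^2 V →ₗ[R] M :=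
  exteriorPower.alternatingMapLinearEquiv
    { toFun := fun v => f (v 0) (v 1)
      map_update_add' := fun v i x y => by fin_cases i <;> simp
      map_update_smul' := fun v i c x => by fin_cases i <;> simp
      map_eq_zero_of_eq' := fun v i j h hij => by
        have : v 0 = v 1 := by
          fin_cases i <;> fin_cases j <;> first | exact h | exact h.symm | exact absurd rfl hij
        simp [this, hf] }

theorem wedgeLift_wedge (f : V →ₗ[R] V →ₗ[R] M) (hf : ∀ v, f v v = 0) (u v : V) :
    wedgeLift f hf (wedge u v) = f u v :=
  exteriorPower.alternatingMapLinearEquiv_apply_ιMulti _ _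

theorem polar_eq_two_mul_associated [Invertible (2 : R)] (q : QuadraticForm R V) (x y : V) :
    polar q x y = 2 * QuadraticMap.associated q x y := by
  rw [← QuadraticMap.polarBilin_apply_apply, ← QuadraticMap.two_nsmul_associated R q]
  exact (two_smul ℕ _).trans (two_mul _).symm

/-- The bilinear form on `⋀² V` underlying `lambdaSq q`; it is half of the polar form. -/
def lambdaSqBilin [Invertible (2 : R)] (q : QuadraticForm R V) :
    LinearMap.BilinForm R (⋀[R]^2 V) :=
  exteriorPower.pairingDual R V 2 ∘ₗ exteriorPower.map 2 (QuadraticMap.associated q)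

theorem four_mul_lambdaSqBilin_wedge [Invertible (2 : R)] (q : QuadraticForm R V)
    (u v u' v' : V) :
    4 * lambdaSqBilin q (wedge u v) (wedge u' v') =
      polar q u u' * polar q v v' - polar q u v' * polar q v u' := by
  have h := lambdaSq_bilin_apply q ![u, v] ![u', v']
  rw [Matrix.det_fin_two] at h
  refine (congrArg (4 * ·) h).trans ?_
  simp only [polar_eq_two_mul_associated, Matrix.of_apply, Matrix.cons_val_zero,
    Matrix.cons_val_one]
  ring

end Wedge

/-! ### The triality Lie algebra of a composition algebra -/

section SkewTriples

variable {E C : Type*} [CommRing E] [NonAssocRing C] [Module E C] [SMulCommClass E C C]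
  [IsScalarTower E C C]

/-- The triality Lie algebra: the related triples of endomorphisms which are skew for the norm. -/
def skewTriples (n : QuadraticForm E C) : Submodule E (Fin 3 → Module.End E C) :=
  Submodule.pi Set.univ (fun _ => n.polarBilin.skewAdjointSubmodule) ⊓ relatedTriples (octConj n)

theorem mem_skewTriples {n : QuadraticForm E C} {s : Fin 3 → Module.End E C} :
    s ∈ skewTriples n ↔
      (∀ k, n.polarBilin.IsSkewAdjoint (s k)) ∧ s ∈ relatedTriples (octConj n) := by
  simp [skewTriples, Submodule.mem_pi]

/-- The map `u ∧ v ↦ triality (octConj n) j u v`. -/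
def wedgeTriality (n : QuadraticForm E C) (j : Fin 3) : ⋀[E]^2 C →ₗ[E] Module.End E C :=
  wedgeLift (triality (octConj n) j) (triality_self _ j)

theorem wedgeTriality_wedge (n : QuadraticForm E C) (j : Fin 3) (u v : C) :
    wedgeTriality n j (wedge u v) = triality (octConj n) j u v :=
  wedgeLift_wedge _ _ _ _

end SkewTriples

namespace IsCompositionAlgebra

variable {E C : Type*} [CommRing E] [NonAssocRing C] [Module E C] {n : QuadraticForm E C}
  [SMulCommClass E C C] [IsScalarTower E C C]

theorem wedgeTriality_mem_skewTriples (hn : IsCompositionAlgebra n) (w : ⋀[E]^2 C) :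
    (fun k => wedgeTriality n k w) ∈ skewTriples n := by
  induction w using wedge_induction with
  | hw u v =>
    simp only [wedgeTriality_wedge]
    exact mem_skewTriples.2
      ⟨fun k => hn.isSkewAdjoint_triality k u v, hn.triality_mem_relatedTriples u v⟩
  | hz => simp only [map_zero]; exact (skewTriples n).zero_mem
  | ha x y hx hy => simp only [map_add]; exact (skewTriples n).add_mem hx hy

variable [IsArtinianRing E] [Module.Free E C] [Module.Finite E C]

/-- Contracting `wedgeTriality n 2 w` with a pair of dual bases recovers `4 w`. -/
theorem wedgeTriality_two_injective (hn : IsCompositionAlgebra n) (h2 : IsUnit (2 : E)) :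
    Function.Injective (wedgeTriality n 2) := by
  obtain ⟨f, -, hf⟩ := exists_dual_family hn.nondegenerate (Module.Free.chooseBasis E C)
  set e := Module.Free.chooseBasis E C
  have contract (w : ⋀[E]^2 C) : ∑ i, wedge (f i) (wedgeTriality n 2 w (e i)) = (4 : E) • w := by
    induction w using wedge_induction with
    | hw u v =>
      have hwedge (u v : C) : ∑ i, polar n u (e i) • wedge (R := E) (f i) v = wedge u v := by
        conv_rhs => rw [← hf u]
        simp [QuadraticMap.polar_comm n u]
      simp only [wedgeTriality_wedge, hn.triality_two, map_smul, map_sub, ← Finset.smul_sum,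
        Finset.sum_sub_distrib, hwedge]
      rw [wedge_swap v u]
      module
    | hz => simp
    | ha x y hx hy => simp only [map_add, LinearMap.add_apply, Finset.sum_add_distrib, hx, hy,
        smul_add]
  intro w w' hw
  have h4 : IsUnit (4 : E) := by simpa only [← two_add_two_eq_four, ← two_mul] using h2.mul h2
  rw [← h4.smul_left_cancel, ← contract, ← contract, hw]

theorem exists_wedgeTriality_two_eq (hn : IsCompositionAlgebra n) (h2 : IsUnit (2 : E))
    {s : Module.End E C} (hs : n.polarBilin.IsSkewAdjoint s) : ∃ w, wedgeTriality n 2 w = s := by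
  obtain ⟨f, he, hf⟩ := exists_dual_family hn.nondegenerate (Module.Free.chooseBasis E C)
  set e := Module.Free.chooseBasis E C
  obtain ⟨c, hc⟩ := (h2.mul h2).exists_left_inv
  refine ⟨c • ∑ i, wedge (f i) (s (e i)), ?_⟩
  ext x
  have h1 : ∑ i, polar n (f i) x • s (e i) = s x := by
    conv_rhs => rw [← he x]
    simp
  have h2 : ∑ i, polar n (s (e i)) x • f i = -s x := by
    simp only [polar_apply_left_of_isSkewAdjoint hs, neg_smul, Finset.sum_neg_distrib, hf]
  simp only [map_smul, map_sum, LinearMap.smul_apply, LinearMap.sum_apply, wedgeTriality_wedge,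
    hn.triality_two, ← Finset.smul_sum, Finset.sum_sub_distrib, h1, h2]
  linear_combination (norm := module) congrArg (· • s x) hc

theorem exists_wedgeTriality_eq (hn : IsCompositionAlgebra n) [IsReduced E]
    (h2 : IsUnit (2 : E)) (hC : 4 < Module.finrank E C) {s : Fin 3 → Module.End E C}
    (hs : s ∈ skewTriples n) : ∃ w, ∀ k, wedgeTriality n k w = s k := by
  obtain ⟨w, hw⟩ := hn.exists_wedgeTriality_two_eq h2 ((mem_skewTriples.1 hs).1 2)
  have hsub := mem_skewTriples.1 ((skewTriples n).sub_mem (hn.wedgeTriality_mem_skewTriples w) hs)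
  have hzero := hn.eq_zero_of_mem_relatedTriples h2 hC (hsub.1 0) hsub.2 (sub_eq_zero.2 hw)
  exact ⟨w, fun k => sub_eq_zero.1 (congrFun hzero k)⟩

theorem two_mul_trace_mulLeft_mulLeft (hn : IsCompositionAlgebra n) (h2 : IsUnit (2 : E))
    (a b : C) :
    2 * LinearMap.trace E C (LinearMap.mulLeft E (octConj n a) ∘ₗ LinearMap.mulLeft E b) =
      Module.finrank E C * polar n a b := by
  nontriviality E
  have htriality : triality (octConj n) 0 b a = (2 : E) •
      (LinearMap.mulLeft E (octConj n a) ∘ₗ LinearMap.mulLeft E b)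
      - polar n a b • LinearMap.id := by
    ext x
    simp only [triality_zero_apply, LinearMap.sub_apply, LinearMap.smul_apply,
      LinearMap.comp_apply, LinearMap.mulLeft_apply, LinearMap.id_apply]
    linear_combination (norm := module) -hn.octConj_mul_mul_add a b x
  have htrace := trace_eq_zero_of_isSkewAdjoint h2 hn.nondegenerate
    (hn.isSkewAdjoint_triality 0 b a)
  rw [htriality, map_sub, map_smul, map_smul, LinearMap.trace_id, smul_eq_mul,
    smul_eq_mul] at htrace
  linear_combination htrace

theorem two_mul_trace_mulRight_mulRight (hn : IsCompositionAlgebra n) (h2 : IsUnit (2 : E))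
    (a b : C) :
    2 * LinearMap.trace E C (LinearMap.mulRight E (octConj n a) ∘ₗ LinearMap.mulRight E b) =
      Module.finrank E C * polar n a b := by
  nontriviality E
  have htriality : triality (octConj n) 1 b a = (2 : E) •
      (LinearMap.mulRight E (octConj n a) ∘ₗ LinearMap.mulRight E b)
      - polar n a b • LinearMap.id := by
    ext x
    simp only [triality_one_apply, LinearMap.sub_apply, LinearMap.smul_apply,
      LinearMap.comp_apply, LinearMap.mulRight_apply, LinearMap.id_apply]
    linear_combination (norm := module) -hn.mul_mul_octConj_add a b x
  have htrace := trace_eq_zero_of_isSkewAdjoint h2 hn.nondegenerate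
    (hn.isSkewAdjoint_triality 1 b a)
  rw [htriality, map_sub, map_smul, map_smul, LinearMap.trace_id, smul_eq_mul,
    smul_eq_mul] at htrace
  linear_combination htrace

end IsCompositionAlgebra

/-! ### Octonion algebras -/

namespace IsOctonionAlgebra

variable {E C : Type*} [CommRing E] [NonAssocRing C] [Module E C] {n : QuadraticForm E C}

theorem nontrivial (hn : IsOctonionAlgebra n) : Nontrivial E := by
  by_contra h
  rw [not_nontrivial_iff_subsingleton] at h
  have := hn.finrank_eq
  rw [Module.finrank, rank_subsingleton, map_one] at this
  lia

theorem finite (hn : IsOctonionAlgebra n) : Module.Finite E C :=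
  have := hn.nontrivial
  have := hn.free
  Module.finite_of_finrank_pos (by rw [hn.finrank_eq]; lia)

theorem isCompositionAlgebra (hn : IsOctonionAlgebra n) : IsCompositionAlgebra n where
  nondegenerate := hn.nondegenerate
  map_one := by
    have := hn.nontrivial
    have := hn.free
    have : Nontrivial C := Module.nontrivial_of_finrank_pos (R := E) (by rw [hn.finrank_eq]; lia)
    have := Module.Free.instFaithfulSMulOfNontrivial E C
    refine FaithfulSMul.eq_of_smul_eq_smul (α := C) fun x => ?_
    refine eq_of_forall_polar_eq hn.nondegenerate fun y => ?_
    have hone (z : C) : n 1 * n z = n z := by rw [← hn.map_mul, one_mul]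
    rw [one_smul, QuadraticMap.polar_smul_left, smul_eq_mul, polar, mul_sub, mul_sub, hone, hone,
      hone]
  map_mul := hn.map_mul

end IsOctonionAlgebra

/-! ### The Allison–Faulkner product -/

/-- The identities of an algebra with involution under which the Allison–Faulkner construction
gives a Lie algebra. -/
structure IsTrialitarian {R B : Type*} [CommRing R] [NonUnitalNonAssocRing B] [Module R B]
    [SMulCommClass R B B] [IsScalarTower R B B] (bar : B →ₗ[R] B) : Prop where
  bar_bar : ∀ a, bar (bar a) = a
  bar_mul : ∀ a b, bar (a * b) = bar b * bar a
  triality_mem : ∀ a b, (fun k => triality bar k a b) ∈ relatedTriples bar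
  lie_triality : ∀ i j a b c d, ⁅triality bar (j + i) c d, triality bar j a b⁆ =
    triality bar j (triality bar (i + 2) c d a) b + triality bar j a (triality bar (i + 2) c d b)
  triality_two_add : ∀ a b c,
    triality bar 2 a b c + triality bar 2 b c a + triality bar 2 c a b = 0
  triality_bar_mul_add : ∀ j a b c, triality bar j a (bar (b * c))
    + triality bar (j - 1) b (bar (c * a)) + triality bar (j - 2) c (bar (a * b)) = 0

theorem sum_fin_three {M : Type*} [AddCommMonoid M] (k : Fin 3) (f : Fin 3 → M) :
    ∑ m, f m = f k + f (k + 1) + f (k + 2) := by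
  rw [← Equiv.sum_comp (Equiv.addLeft k) f, Fin.sum_univ_three]
  simp only [Equiv.coe_addLeft, add_zero]

namespace AllisonFaulkner

variable {K A : Type*} [Field K] [NonUnitalNonAssocRing A] [Module K A] [SMulCommClass K A A]
  [IsScalarTower K A A] (bar : A →ₗ[K] A)

theorem triple_apply (i : Fin 3) (a b : A) (m : Fin 3) :
    triple bar i a b m = triality bar (m - i) a b :=
  tripleFun_apply bar i a b m

theorem triple_self (i : Fin 3) (a : A) : triple bar i a a = 0 := by
  funext m
  rw [triple_apply, triality_self, Pi.zero_apply]

theorem triple_mem_innerTriples (i : Fin 3) (a b : A) : triple bar i a b ∈ innerTriples bar :=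
  Submodule.subset_span ⟨i, a, b, rfl⟩

/-- The component in `𝒯_I` of the product of two elements of `A[12] ⊕ A[23] ⊕ A[31]`. -/
def innerProduct (γ : Fin 3 → Kˣ) :
    (Fin 3 → A) →ₗ[K] (Fin 3 → A) →ₗ[K] Fin 3 → Module.End K A :=
  ∑ k : Fin 3, ((γ (k + 1) : K) * (γ (k + 2) : K)⁻¹) •
    (triple bar (k + 1)).compl₁₂ (LinearMap.proj k) (LinearMap.proj k)

/-- The component in `A[12] ⊕ A[23] ⊕ A[31]` of the product of two elements of this space, up to
sign. -/
def outerProduct (γ : Fin 3 → Kˣ) : (Fin 3 → A) →ₗ[K] (Fin 3 → A) →ₗ[K] Fin 3 → A :=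
  LinearMap.mk₂ K (fun a b k => ((γ (k + 2) : K) * (γ (k + 1) : K)⁻¹) •
      bar (a (k + 1) * b (k + 2) - b (k + 1) * a (k + 2)))
    (fun a a' b => by ext k; simp [add_mul, mul_add]; module)
    (fun c a b => by ext k; simp [smul_mul_assoc, mul_smul_comm]; module)
    (fun a b b' => by ext k; simp [add_mul, mul_add]; module)
    (fun c a b => by ext k; simp [smul_mul_assoc, mul_smul_comm]; module)

variable (γ : Fin 3 → Kˣ)

theorem innerProduct_apply (a b : Fin 3 → A) : innerProduct bar γ a b =
    ∑ k : Fin 3, ((γ (k + 1) : K) * (γ (k + 2) : K)⁻¹) • triple bar (k + 1) (a k) (b k) := by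
  simp [innerProduct, LinearMap.sum_apply]

theorem outerProduct_apply (a b : Fin 3 → A) (k : Fin 3) : outerProduct bar γ a b k =
    ((γ (k + 2) : K) * (γ (k + 1) : K)⁻¹) • bar (a (k + 1) * b (k + 2) - b (k + 1) * a (k + 2)) :=
  rfl

theorem bracket_apply (x y : Ambient K A) : bracket bar γ x y =
    (x.1 * y.1 - y.1 * x.1 + innerProduct bar γ x.2 y.2,
      x.1 • y.2 - y.1 • x.2 - outerProduct bar γ x.2 y.2) := by
  rw [innerProduct_apply]
  rfl

theorem innerProduct_self (a : Fin 3 → A) : innerProduct bar γ a a = 0 := by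
  simp only [innerProduct_apply, triple_self, smul_zero, Finset.sum_const_zero]

theorem innerProduct_swap (a b : Fin 3 → A) :
    innerProduct bar γ a b = -innerProduct bar γ b a :=
  (LinearMap.IsAlt.neg (innerProduct_self bar γ) b a).symm

theorem outerProduct_self (a : Fin 3 → A) : outerProduct bar γ a a = 0 := by
  funext k
  rw [outerProduct_apply, sub_self, map_zero, smul_zero, Pi.zero_apply]

theorem outerProduct_swap (a b : Fin 3 → A) :
    outerProduct bar γ a b = -outerProduct bar γ b a :=
  (LinearMap.IsAlt.neg (outerProduct_self bar γ) b a).symm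

theorem innerProduct_mem_innerTriples (a b : Fin 3 → A) :
    innerProduct bar γ a b ∈ innerTriples bar := by
  rw [innerProduct_apply]
  exact Submodule.sum_mem _ fun k _ =>
    Submodule.smul_mem _ _ (triple_mem_innerTriples bar _ _ _)

theorem innerProduct_smul_apply (a b c : Fin 3 → A) (k : Fin 3) :
    (innerProduct bar γ a b • c) k =
      ((γ (k + 1) : K) * (γ (k + 2) : K)⁻¹) • triality bar 2 (a k) (b k) (c k)
      + ((γ (k + 2) : K) * (γ k : K)⁻¹) • triality bar 1 (a (k + 1)) (b (k + 1)) (c k)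
      + ((γ k : K) * (γ (k + 1) : K)⁻¹) • triality bar 0 (a (k + 2)) (b (k + 2)) (c k) := by
  simp only [innerProduct_apply, Pi.smul_apply', Finset.sum_apply, Pi.smul_apply, triple_apply,
    Module.End.smul_def, LinearMap.sum_apply, LinearMap.smul_apply]
  rw [sum_fin_three k, show k + 1 + 1 = k + 2 by grind, show k + 1 + 2 = k by grind,
    show k + 2 + 1 = k by grind, show k + 2 + 2 = k + 1 by grind, show k - (k + 1) = 2 by grind,
    show k - (k + 2) = 1 by grind, sub_self]

end AllisonFaulkner

namespace IsTrialitarian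

open AllisonFaulkner

variable {K A : Type*} [Field K] [NonUnitalNonAssocRing A] [Module K A] [SMulCommClass K A A]
  [IsScalarTower K A A] {bar : A →ₗ[K] A}

theorem innerTriples_le_relatedTriples (h : IsTrialitarian bar) :
    innerTriples bar ≤ relatedTriples bar := by
  refine Submodule.span_le.2 ?_
  rintro _ ⟨i, a, b, rfl⟩ k x y
  simpa only [tripleFun_apply, sub_add_eq_add_sub] using h.triality_mem a b (k - i) x y

theorem innerTriples_mul_triple (h : IsTrialitarian bar) {T : Fin 3 → Module.End K A}
    (hT : T ∈ innerTriples bar) (i : Fin 3) (a b : A) :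
    T * triple bar i a b = triple bar i a b * T + triple bar i (T (i + 2) a) b
      + triple bar i a (T (i + 2) b) := by
  induction hT using Submodule.span_induction with
  | mem T hT =>
    obtain ⟨l, c, d, rfl⟩ := hT
    funext m
    have hlie := h.lie_triality (i - l) (m - i) a b c d
    rw [sub_add_sub_cancel, sub_add_eq_add_sub, Ring.lie_def, sub_eq_iff_eq_add] at hlie
    simp only [Pi.mul_apply, Pi.add_apply, triple_apply, tripleFun_apply, hlie]
    abel
  | zero => simp
  | add S T _ _ hS hT =>
    simp only [add_mul, mul_add, hS, hT, Pi.add_apply, LinearMap.add_apply, map_add]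
    abel
  | smul c T _ hT =>
    simp only [smul_mul_assoc, mul_smul_comm, hT, Pi.smul_apply, LinearMap.smul_apply, map_smul,
      ← smul_add]

theorem commutator_mem_innerTriples (h : IsTrialitarian bar) {S T : Fin 3 → Module.End K A}
    (hS : S ∈ innerTriples bar) (hT : T ∈ innerTriples bar) :
    S * T - T * S ∈ innerTriples bar := by
  induction hT using Submodule.span_induction with
  | mem T hT =>
    obtain ⟨i, a, b, rfl⟩ := hT
    change S * triple bar i a b - triple bar i a b * S ∈ _
    rw [h.innerTriples_mul_triple hS, add_assoc, add_sub_cancel_left]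
    exact Submodule.add_mem _ (triple_mem_innerTriples bar _ _ _)
      (triple_mem_innerTriples bar _ _ _)
  | zero => simp
  | add T T' _ _ hT hT' =>
    rw [mul_add, add_mul, add_sub_add_comm]
    exact Submodule.add_mem _ hT hT'
  | smul c T _ hT =>
    rw [mul_smul_comm, smul_mul_assoc, ← smul_sub]
    exact Submodule.smul_mem _ _ hT

theorem innerTriples_mul_innerProduct (h : IsTrialitarian bar) (γ : Fin 3 → Kˣ)
    {T : Fin 3 → Module.End K A} (hT : T ∈ innerTriples bar) (a b : Fin 3 → A) :
    T * innerProduct bar γ a b = innerProduct bar γ a b * T + innerProduct bar γ (T • a) b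
      + innerProduct bar γ a (T • b) := by
  simp only [innerProduct_apply, Finset.mul_sum, Finset.sum_mul, ← Finset.sum_add_distrib,
    mul_smul_comm, smul_mul_assoc, h.innerTriples_mul_triple hT, ← smul_add,
    show ∀ k : Fin 3, k + 1 + 2 = k by decide, Pi.smul_apply', Module.End.smul_def]

theorem innerTriples_smul_outerProduct (h : IsTrialitarian bar) (γ : Fin 3 → Kˣ)
    {T : Fin 3 → Module.End K A} (hT : T ∈ innerTriples bar) (a b : Fin 3 → A) :
    T • outerProduct bar γ a b = outerProduct bar γ (T • a) b + outerProduct bar γ a (T • b) := by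
  funext k
  have hrel := h.innerTriples_le_relatedTriples hT k
  simp only [Pi.smul_apply', Pi.add_apply, outerProduct_apply, Module.End.smul_def, map_smul,
    map_sub, map_add, hrel]
  module

theorem triple_bar_mul_add (h : IsTrialitarian bar) (k : Fin 3) (a b c : A) :
    triple bar (k + 1) a (bar (b * c)) + triple bar (k + 2) b (bar (c * a))
      + triple bar k c (bar (a * b)) = 0 := by
  funext m
  have hsum := h.triality_bar_mul_add (m - (k + 1)) a b c
  rw [show m - (k + 1) - 1 = m - (k + 2) by grind, show m - (k + 1) - 2 = m - k by grind] at hsum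
  simpa only [Pi.add_apply, triple_apply, Pi.zero_apply] using hsum

theorem sum_triple_bar_mul_add (h : IsTrialitarian bar) (a b c : Fin 3 → A) :
    ∑ k : Fin 3, triple bar (k + 1) (a k) (bar (b (k + 1) * c (k + 2)))
      + ∑ k : Fin 3, triple bar (k + 1) (b k) (bar (c (k + 1) * a (k + 2)))
      + ∑ k : Fin 3, triple bar (k + 1) (c k) (bar (a (k + 1) * b (k + 2))) = 0 := by
  have hsum (k : Fin 3) := h.triple_bar_mul_add k (a k) (b (k + 1)) (c (k + 2))
  have h0 := hsum 0
  have h1 := hsum 1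
  have h2 := hsum 2
  simp only [Fin.sum_univ_three]
  simp only [Fin.isValue, Fin.reduceAdd] at h0 h1 h2 ⊢
  linear_combination (norm := abel) h0 + h1 + h2

theorem innerProduct_outerProduct_add (h : IsTrialitarian bar) (γ : Fin 3 → Kˣ)
    (a b c : Fin 3 → A) : innerProduct bar γ a (outerProduct bar γ b c)
      + innerProduct bar γ b (outerProduct bar γ c a)
      + innerProduct bar γ c (outerProduct bar γ a b) = 0 := by
  have key (a b c : Fin 3 → A) : innerProduct bar γ a (outerProduct bar γ b c) =
      ∑ k : Fin 3, triple bar (k + 1) (a k) (bar (b (k + 1) * c (k + 2)))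
        - ∑ k : Fin 3, triple bar (k + 1) (a k) (bar (c (k + 1) * b (k + 2))) := by
    rw [innerProduct_apply, ← Finset.sum_sub_distrib]
    refine Finset.sum_congr rfl fun k _ => ?_
    have hγ : (γ (k + 1) : K) * (γ (k + 2) : K)⁻¹ * (γ (k + 2) * (γ (k + 1) : K)⁻¹) = 1 := by
      field_simp
    rw [outerProduct_apply, map_smul, smul_smul, hγ, one_smul, map_sub, map_sub]
  rw [key, key, key]
  linear_combination (norm := abel)
    h.sum_triple_bar_mul_add a b c - h.sum_triple_bar_mul_add a c b

theorem outerProduct_outerProduct_apply (h : IsTrialitarian bar) (γ : Fin 3 → Kˣ)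
    (a b c : Fin 3 → A) (k : Fin 3) : outerProduct bar γ a (outerProduct bar γ b c) k =
      ((γ (k + 2) : K) * (γ k : K)⁻¹) •
        ((b k * c (k + 1) - c k * b (k + 1)) * bar (a (k + 1)))
      - ((γ k : K) * (γ (k + 1) : K)⁻¹) •
        (bar (a (k + 2)) * (b (k + 2) * c k - c (k + 2) * b k)) := by
  have hγ₁ : ((γ (k + 2) : K) * (γ (k + 1) : K)⁻¹) * ((γ (k + 1) : K) * (γ k : K)⁻¹) =
      (γ (k + 2) : K) * (γ k : K)⁻¹ := by field_simp
  have hγ₂ : ((γ (k + 2) : K) * (γ (k + 1) : K)⁻¹) * ((γ k : K) * (γ (k + 2) : K)⁻¹) =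
      (γ k : K) * (γ (k + 1) : K)⁻¹ := by field_simp
  rw [outerProduct_apply, outerProduct_apply, outerProduct_apply,
    show k + 1 + 1 = k + 2 by grind, show k + 1 + 2 = k by grind, show k + 2 + 1 = k by grind,
    show k + 2 + 2 = k + 1 by grind, mul_smul_comm, smul_mul_assoc, map_sub, map_smul, map_smul,
    h.bar_mul, h.bar_mul, h.bar_bar, h.bar_bar, smul_sub, smul_smul, smul_smul, hγ₁, hγ₂]

theorem innerProduct_smul_add (h : IsTrialitarian bar) (γ : Fin 3 → Kˣ) (a b c : Fin 3 → A) :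
    innerProduct bar γ a b • c + innerProduct bar γ b c • a + innerProduct bar γ c a • b =
      outerProduct bar γ a (outerProduct bar γ b c) + outerProduct bar γ b (outerProduct bar γ c a)
        + outerProduct bar γ c (outerProduct bar γ a b) := by
  funext k
  have hcyclic := congrArg (((γ (k + 1) : K) * (γ (k + 2) : K)⁻¹) • ·)
    (h.triality_two_add (a k) (b k) (c k))
  simp only [smul_add, smul_zero] at hcyclic
  simp only [Pi.add_apply, innerProduct_smul_apply, h.outerProduct_outerProduct_apply,
    triality_zero_apply, triality_one_apply, sub_mul, mul_sub]
  linear_combination (norm := module) hcyclic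

theorem leibniz_fst (h : IsTrialitarian bar) (γ : Fin 3 → Kˣ) {x y z : Ambient K A}
    (hx : x.1 ∈ innerTriples bar) (hy : y.1 ∈ innerTriples bar) (hz : z.1 ∈ innerTriples bar) :
    (bracket bar γ x (bracket bar γ y z)).1 =
      (bracket bar γ (bracket bar γ x y) z).1 + (bracket bar γ y (bracket bar γ x z)).1 := by
  have houter := h.innerProduct_outerProduct_add γ x.2 y.2 z.2
  rw [outerProduct_swap bar γ z.2 x.2, innerProduct_swap bar γ z.2 (outerProduct _ _ _ _),
    map_neg] at houter
  simp only [bracket_apply, mul_add, mul_sub, add_mul, sub_mul, map_sub,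
    LinearMap.sub_apply, h.innerTriples_mul_innerProduct γ hx,
    h.innerTriples_mul_innerProduct γ hy, h.innerTriples_mul_innerProduct γ hz, mul_assoc,
    innerProduct_swap bar γ (y.1 • x.2) z.2, innerProduct_swap bar γ y.2 (z.1 • x.2)]
  linear_combination (norm := abel) -houter

theorem leibniz_snd (h : IsTrialitarian bar) (γ : Fin 3 → Kˣ) {x y z : Ambient K A}
    (hx : x.1 ∈ innerTriples bar) (hy : y.1 ∈ innerTriples bar) (hz : z.1 ∈ innerTriples bar) :
    (bracket bar γ x (bracket bar γ y z)).2 =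
      (bracket bar γ (bracket bar γ x y) z).2 + (bracket bar γ y (bracket bar γ x z)).2 := by
  have hinner := h.innerProduct_smul_add γ x.2 y.2 z.2
  rw [outerProduct_swap bar γ z.2 x.2, outerProduct_swap bar γ z.2 (outerProduct _ _ _ _),
    innerProduct_swap bar γ z.2 x.2, map_neg, neg_smul] at hinner
  simp only [bracket_apply, smul_sub, add_smul, sub_smul, mul_smul, map_sub,
    LinearMap.sub_apply, h.innerTriples_smul_outerProduct γ hx,
    h.innerTriples_smul_outerProduct γ hy, h.innerTriples_smul_outerProduct γ hz,
    outerProduct_swap bar γ (y.1 • x.2) z.2, outerProduct_swap bar γ y.2 (z.1 • x.2)]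
  linear_combination (norm := abel) -hinner

theorem isLieOn (h : IsTrialitarian bar) (γ : Fin 3 → Kˣ) :
    IsLieOn (bracket bar γ) (space bar) where
  mem := by
    rintro x ⟨hx, -⟩ y ⟨hy, -⟩
    rw [bracket_apply]
    exact ⟨Submodule.add_mem _ (h.commutator_mem_innerTriples hx hy)
      (innerProduct_mem_innerTriples bar γ x.2 y.2), trivial⟩
  self := by
    rintro x -
    rw [bracket_apply, innerProduct_self, outerProduct_self, sub_self, sub_self, add_zero, sub_zero]
    rfl
  leibniz := by
    rintro x ⟨hx, -⟩ y ⟨hy, -⟩ z ⟨hz, -⟩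
    exact Prod.ext (h.leibniz_fst γ hx hy hz) (h.leibniz_snd γ hx hy hz)

end IsTrialitarian

/-! ### Tensor products of composition algebras -/

section EndTensor

variable {E M N : Type*} [CommRing E] [AddCommGroup M] [Module E M] [AddCommGroup N] [Module E N]

theorem lie_rTensor_rTensor (f g : Module.End E M) :
    ⁅f.rTensor N, g.rTensor N⁆ = LinearMap.rTensor N ⁅f, g⁆ := by
  rw [Ring.lie_def, Ring.lie_def, LinearMap.rTensor_sub, LinearMap.rTensor_mul,
    LinearMap.rTensor_mul]

theorem lie_lTensor_lTensor (f g : Module.End E N) :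
    ⁅f.lTensor M, g.lTensor M⁆ = LinearMap.lTensor M ⁅f, g⁆ := by
  rw [Ring.lie_def, Ring.lie_def, LinearMap.lTensor_sub, LinearMap.lTensor_mul,
    LinearMap.lTensor_mul]

theorem lie_rTensor_lTensor (f : Module.End E M) (g : Module.End E N) :
    ⁅f.rTensor N, g.lTensor M⁆ = 0 := by
  rw [Ring.lie_def, sub_eq_zero]
  exact (LinearMap.rTensor_comp_lTensor M f g).trans (LinearMap.lTensor_comp_rTensor M f g).symm

theorem two_smul_tmul_sub_tmul {p q x : M} {p' q' x' : N} {r r' : E} (h : p + q = r • x)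
    (h' : p' + q' = r' • x') : (2 : E) • (p ⊗ₜ[E] p' - q ⊗ₜ[E] q') =
      r' • ((p - q) ⊗ₜ[E] x') + r • (x ⊗ₜ[E] (p' - q')) := by
  rw [← TensorProduct.tmul_smul, ← h', TensorProduct.smul_tmul', ← h]
  simp only [TensorProduct.tmul_add, TensorProduct.add_tmul, TensorProduct.sub_tmul,
    TensorProduct.tmul_sub]
  module

end EndTensor

section Tensor

variable {E C D : Type*} [CommRing E] [NonAssocRing C] [Module E C] [NonAssocRing D] [Module E D]
  [SMulCommClass E C C] [IsScalarTower E C C] [SMulCommClass E D D] [IsScalarTower E D D]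

theorem rTensor_mem_relatedTriples {σ : C →ₗ[E] C} (τ : D →ₗ[E] D)
    {s : Fin 3 → Module.End E C} (hs : s ∈ relatedTriples σ) :
    (fun k => (s k).rTensor D) ∈ relatedTriples (TensorProduct.map σ τ) := by
  intro k x y
  induction x with
  | zero => simp only [zero_mul, map_zero, add_zero]
  | add x x' hx hx' =>
    simp only [add_mul, map_add] at hx hx' ⊢
    linear_combination (norm := abel) hx + hx'
  | tmul x x' =>
    induction y with
    | zero => simp only [mul_zero, map_zero, add_zero]
    | add y y' hy hy' =>
      simp only [mul_add, map_add] at hy hy' ⊢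
      linear_combination (norm := abel) hy + hy'
    | tmul y y' =>
      simp only [Algebra.TensorProduct.tmul_mul_tmul, TensorProduct.map_tmul,
        LinearMap.rTensor_tmul, hs k, map_add, TensorProduct.add_tmul]

theorem lTensor_mem_relatedTriples (σ : C →ₗ[E] C) {τ : D →ₗ[E] D}
    {s : Fin 3 → Module.End E D} (hs : s ∈ relatedTriples τ) :
    (fun k => (s k).lTensor C) ∈ relatedTriples (TensorProduct.map σ τ) := by
  intro k x y
  induction x with
  | zero => simp only [zero_mul, map_zero, add_zero]
  | add x x' hx hx' =>
    simp only [add_mul, map_add] at hx hx' ⊢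
    linear_combination (norm := abel) hx + hx'
  | tmul x x' =>
    induction y with
    | zero => simp only [mul_zero, map_zero, add_zero]
    | add y y' hy hy' =>
      simp only [mul_add, map_add] at hy hy' ⊢
      linear_combination (norm := abel) hy + hy'
    | tmul y y' =>
      simp only [Algebra.TensorProduct.tmul_mul_tmul, TensorProduct.map_tmul,
        LinearMap.lTensor_tmul, hs k, map_add, TensorProduct.tmul_add]

/-- The tensor product of the canonical involutions of two composition algebras. -/
abbrev tensorConj (n : QuadraticForm E C) (m : QuadraticForm E D) : C ⊗[E] D →ₗ[E] C ⊗[E] D :=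
  TensorProduct.map (octConj n) (octConj m)

namespace IsCompositionAlgebra

variable {n : QuadraticForm E C} {m : QuadraticForm E D}

theorem polar_octConj_mul_rotate (hn : IsCompositionAlgebra n) (x y z : C) :
    polar n x (octConj n (y * z)) = polar n y (octConj n (z * x)) := by
  rw [← hn.polar_octConj_left, QuadraticMap.polar_comm, hn.polar_mul_octConj_rotate,
    QuadraticMap.polar_comm, hn.polar_octConj_left]

theorem two_smul_triality_tmul (hn : IsCompositionAlgebra n) (hm : IsCompositionAlgebra m)
    (j : Fin 3) (a b : C) (a' b' : D) :
    (2 : E) • triality (tensorConj n m) j (a ⊗ₜ a') (b ⊗ₜ b') =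
      polar m a' b' • (triality (octConj n) j a b).rTensor D
        + polar n a b • (triality (octConj m) j a' b').lTensor C := by
  ext x x'
  simp only [TensorProduct.AlgebraTensorModule.curry_apply, LinearMap.restrictScalars_self,
    TensorProduct.curry_apply, LinearMap.smul_apply, LinearMap.add_apply,
    LinearMap.rTensor_tmul, LinearMap.lTensor_tmul]
  fin_cases j
  · simp only [Fin.zero_eta, triality_zero_apply, TensorProduct.map_tmul,
      Algebra.TensorProduct.tmul_mul_tmul]
    exact two_smul_tmul_sub_tmul ((add_comm _ _).trans (hn.octConj_mul_mul_add a b x))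
      ((add_comm _ _).trans (hm.octConj_mul_mul_add a' b' x'))
  · simp only [Fin.mk_one, triality_one_apply, TensorProduct.map_tmul,
      Algebra.TensorProduct.tmul_mul_tmul]
    exact two_smul_tmul_sub_tmul (hn.mul_mul_octConj_add a b x) (hm.mul_mul_octConj_add a' b' x')
  · simp only [Fin.reduceFinMk, triality_two_apply, TensorProduct.map_tmul,
      Algebra.TensorProduct.tmul_mul_tmul]
    have hleft := two_smul_tmul_sub_tmul
      ((add_comm _ _).trans (hn.mul_octConj_mul_add_left a b x))
      ((add_comm _ _).trans (hm.mul_octConj_mul_add_left a' b' x'))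
    have hright := two_smul_tmul_sub_tmul
      (show x * (octConj n b * a) + x * (octConj n a * b) = polar n a b • x by
        rw [← mul_add, add_comm, hn.octConj_mul_add, mul_smul_comm, mul_one])
      (show x' * (octConj m b' * a') + x' * (octConj m a' * b') = polar m a' b' • x' by
        rw [← mul_add, add_comm, hm.octConj_mul_add, mul_smul_comm, mul_one])
    simp only [TensorProduct.sub_tmul, TensorProduct.tmul_sub] at hleft hright ⊢
    linear_combination (norm := module) hleft - hright

variable [Invertible (2 : E)]

theorem triality_tmul (hn : IsCompositionAlgebra n) (hm : IsCompositionAlgebra m) (j : Fin 3)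
    (a b : C) (a' b' : D) : triality (tensorConj n m) j (a ⊗ₜ a') (b ⊗ₜ b') =
      (⅟2 * polar m a' b') • (triality (octConj n) j a b).rTensor D
        + (⅟2 * polar n a b) • (triality (octConj m) j a' b').lTensor C := by
  rw [mul_smul, mul_smul, ← smul_add, ← hn.two_smul_triality_tmul hm, smul_smul, invOf_mul_self,
    one_smul]

theorem triality_tensorConj_mem_relatedTriples (hn : IsCompositionAlgebra n)
    (hm : IsCompositionAlgebra m) (a b : C ⊗[E] D) :
    (fun k => triality (tensorConj n m) k a b) ∈ relatedTriples (tensorConj n m) := by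
  induction a with
  | zero =>
    simp only [map_zero, LinearMap.zero_apply]
    exact zero_mem _
  | add a a' ha ha' =>
    simp only [map_add, LinearMap.add_apply]
    exact add_mem ha ha'
  | tmul a a' =>
    induction b with
    | zero =>
      simp only [map_zero]
      exact zero_mem _
    | add b b' hb hb' =>
      simp only [map_add]
      exact add_mem hb hb'
    | tmul b b' =>
      simp only [hn.triality_tmul hm]
      exact add_mem
        (Submodule.smul_mem _ _
          (rTensor_mem_relatedTriples _ (hn.triality_mem_relatedTriples a b)))
        (Submodule.smul_mem _ _
          (lTensor_mem_relatedTriples _ (hm.triality_mem_relatedTriples a' b')))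

theorem lie_rTensor_triality (hn : IsCompositionAlgebra n) (hm : IsCompositionAlgebra m)
    {s : Fin 3 → Module.End E C} (hs : s ∈ skewTriples n) (i j : Fin 3) (a b : C ⊗[E] D) :
    ⁅(s (j + i)).rTensor D, triality (tensorConj n m) j a b⁆ =
      triality (tensorConj n m) j ((s (i + 2)).rTensor D a) b
        + triality (tensorConj n m) j a ((s (i + 2)).rTensor D b) := by
  obtain ⟨hskew, hrel⟩ := mem_skewTriples.1 hs
  rw [Ring.lie_def]
  induction a with
  | zero => simp only [map_zero, LinearMap.zero_apply, mul_zero, zero_mul, add_zero, sub_zero]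
  | add a a' ha ha' =>
    simp only [map_add, LinearMap.add_apply, mul_add, add_mul]
    linear_combination (norm := abel) ha + ha'
  | tmul a a' =>
    induction b with
    | zero => simp only [map_zero, mul_zero, zero_mul, add_zero, sub_zero]
    | add b b' hb hb' =>
      simp only [map_add, mul_add, add_mul]
      linear_combination (norm := abel) hb + hb'
    | tmul b b' =>
      have hlie := lie_rTensor_rTensor (N := D) (s (j + i)) (triality (octConj n) j a b)
      have hcomm := lie_rTensor_lTensor (s (j + i)) (triality (octConj m) j a' b')
      rw [Ring.lie_def, hn.lie_triality hskew hrel, LinearMap.rTensor_add] at hlie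
      rw [Ring.lie_def] at hcomm
      simp only [LinearMap.rTensor_tmul, hn.triality_tmul hm, mul_add, add_mul, mul_smul_comm,
        smul_mul_assoc, polar_apply_left_of_isSkewAdjoint (hskew _)]
      linear_combination (norm := module)
        (⅟(2 : E) * polar m a' b') • hlie + (⅟(2 : E) * polar n a b) • hcomm

theorem lie_lTensor_triality (hn : IsCompositionAlgebra n) (hm : IsCompositionAlgebra m)
    {s : Fin 3 → Module.End E D} (hs : s ∈ skewTriples m) (i j : Fin 3) (a b : C ⊗[E] D) :
    ⁅(s (j + i)).lTensor C, triality (tensorConj n m) j a b⁆ =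
      triality (tensorConj n m) j ((s (i + 2)).lTensor C a) b
        + triality (tensorConj n m) j a ((s (i + 2)).lTensor C b) := by
  obtain ⟨hskew, hrel⟩ := mem_skewTriples.1 hs
  rw [Ring.lie_def]
  induction a with
  | zero => simp only [map_zero, LinearMap.zero_apply, mul_zero, zero_mul, add_zero, sub_zero]
  | add a a' ha ha' =>
    simp only [map_add, LinearMap.add_apply, mul_add, add_mul]
    linear_combination (norm := abel) ha + ha'
  | tmul a a' =>
    induction b with
    | zero => simp only [map_zero, mul_zero, zero_mul, add_zero, sub_zero]
    | add b b' hb hb' =>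
      simp only [map_add, mul_add, add_mul]
      linear_combination (norm := abel) hb + hb'
    | tmul b b' =>
      have hlie := lie_lTensor_lTensor (M := C) (s (j + i)) (triality (octConj m) j a' b')
      have hcomm := lie_rTensor_lTensor (triality (octConj n) j a b) (s (j + i))
      rw [Ring.lie_def, hm.lie_triality hskew hrel, LinearMap.lTensor_add] at hlie
      rw [Ring.lie_def] at hcomm
      simp only [LinearMap.lTensor_tmul, hn.triality_tmul hm, mul_add, add_mul, mul_smul_comm,
        smul_mul_assoc, polar_apply_left_of_isSkewAdjoint (hskew _)]
      linear_combination (norm := module)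
        (⅟(2 : E) * polar n a b) • hlie - (⅟(2 : E) * polar m a' b') • hcomm

theorem lie_triality_tensorConj (hn : IsCompositionAlgebra n) (hm : IsCompositionAlgebra m)
    (i j : Fin 3) (a b c d : C ⊗[E] D) :
    ⁅triality (tensorConj n m) (j + i) c d, triality (tensorConj n m) j a b⁆ =
      triality (tensorConj n m) j (triality (tensorConj n m) (i + 2) c d a) b
        + triality (tensorConj n m) j a (triality (tensorConj n m) (i + 2) c d b) := by
  rw [Ring.lie_def]
  induction c with
  | zero => simp only [map_zero, LinearMap.zero_apply, mul_zero, zero_mul, add_zero, sub_zero]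
  | add c c' hc hc' =>
    simp only [map_add, LinearMap.add_apply, mul_add, add_mul]
    linear_combination (norm := abel) hc + hc'
  | tmul c c' =>
    induction d with
    | zero => simp only [map_zero, LinearMap.zero_apply, mul_zero, zero_mul, add_zero, sub_zero]
    | add d d' hd hd' =>
      simp only [map_add, LinearMap.add_apply, mul_add, add_mul]
      linear_combination (norm := abel) hd + hd'
    | tmul d d' =>
      have hleft := hn.lie_rTensor_triality hm
        (mem_skewTriples.2 ⟨fun k => hn.isSkewAdjoint_triality k c d,
          hn.triality_mem_relatedTriples c d⟩) i j a b
      have hright := hn.lie_lTensor_triality hm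
        (mem_skewTriples.2 ⟨fun k => hm.isSkewAdjoint_triality k c' d',
          hm.triality_mem_relatedTriples c' d'⟩) i j a b
      rw [Ring.lie_def] at hleft hright
      rw [hn.triality_tmul hm, hn.triality_tmul hm]
      simp only [LinearMap.add_apply, LinearMap.smul_apply, map_add, map_smul, mul_add, add_mul,
        mul_smul_comm, smul_mul_assoc]
      linear_combination (norm := module)
        (⅟(2 : E) * polar m c' d') • hleft + (⅟(2 : E) * polar n c d) • hright

theorem triality_tensorConj_two_add (hn : IsCompositionAlgebra n) (hm : IsCompositionAlgebra m)
    (a b c : C ⊗[E] D) : triality (tensorConj n m) 2 a b c + triality (tensorConj n m) 2 b c a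
      + triality (tensorConj n m) 2 c a b = 0 := by
  induction a with
  | zero => simp only [map_zero, LinearMap.zero_apply, add_zero]
  | add a a' ha ha' =>
    simp only [map_add, LinearMap.add_apply]
    linear_combination (norm := abel) ha + ha'
  | tmul a a' =>
    induction b with
    | zero => simp only [map_zero, LinearMap.zero_apply, add_zero]
    | add b b' hb hb' =>
      simp only [map_add, LinearMap.add_apply]
      linear_combination (norm := abel) hb + hb'
    | tmul b b' =>
      induction c with
      | zero => simp only [map_zero, LinearMap.zero_apply, add_zero]
      | add c c' hc hc' =>
        simp only [map_add, LinearMap.add_apply]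
        linear_combination (norm := abel) hc + hc'
      | tmul c c' =>
        simp only [hn.triality_tmul hm, LinearMap.add_apply, LinearMap.smul_apply,
          LinearMap.rTensor_tmul, LinearMap.lTensor_tmul, hn.triality_two, hm.triality_two,
          TensorProduct.tmul_sub, TensorProduct.sub_tmul, TensorProduct.tmul_smul,
          ← TensorProduct.smul_tmul', QuadraticMap.polar_comm n c, QuadraticMap.polar_comm m c',
          QuadraticMap.polar_comm n b a, QuadraticMap.polar_comm m b' a']
        module

theorem triality_tensorConj_mul_add (hn : IsCompositionAlgebra n) (hm : IsCompositionAlgebra m)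
    (j : Fin 3) (a b c : C ⊗[E] D) :
    triality (tensorConj n m) j a (tensorConj n m (b * c))
      + triality (tensorConj n m) (j - 1) b (tensorConj n m (c * a))
      + triality (tensorConj n m) (j - 2) c (tensorConj n m (a * b)) = 0 := by
  induction a with
  | zero => simp only [map_zero, mul_zero, zero_mul, LinearMap.zero_apply, add_zero]
  | add a a' ha ha' =>
    simp only [map_add, LinearMap.add_apply, mul_add, add_mul]
    linear_combination (norm := abel) ha + ha'
  | tmul a a' =>
    induction b with
    | zero => simp only [map_zero, mul_zero, zero_mul, LinearMap.zero_apply, add_zero]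
    | add b b' hb hb' =>
      simp only [map_add, LinearMap.add_apply, mul_add, add_mul]
      linear_combination (norm := abel) hb + hb'
    | tmul b b' =>
      induction c with
      | zero => simp only [map_zero, mul_zero, zero_mul, LinearMap.zero_apply, add_zero]
      | add c c' hc hc' =>
        simp only [map_add, LinearMap.add_apply, mul_add, add_mul]
        linear_combination (norm := abel) hc + hc'
      | tmul c c' =>
        simp only [Algebra.TensorProduct.tmul_mul_tmul, TensorProduct.map_tmul,
          hn.triality_tmul hm]
        rw [← hn.polar_octConj_mul_rotate a b c, hn.polar_octConj_mul_rotate c a b,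
          ← hm.polar_octConj_mul_rotate a' b' c', hm.polar_octConj_mul_rotate c' a' b']
        have hleft := congrArg (LinearMap.rTensor D) (hn.triality_octConj_mul_add j a b c)
        have hright := congrArg (LinearMap.lTensor C) (hm.triality_octConj_mul_add j a' b' c')
        simp only [LinearMap.rTensor_add, LinearMap.rTensor_zero, LinearMap.lTensor_add,
          LinearMap.lTensor_zero] at hleft hright
        linear_combination (norm := module)
          (⅟(2 : E) * polar m a' (octConj m (b' * c'))) • hleft
            + (⅟(2 : E) * polar n a (octConj n (b * c))) • hright

theorem isTrialitarian_tensorConj (hn : IsCompositionAlgebra n) (hm : IsCompositionAlgebra m) :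
    IsTrialitarian (tensorConj n m) where
  bar_bar a := by
    induction a with
    | zero => rw [map_zero, map_zero]
    | add a a' ha ha' => rw [map_add, map_add, ha, ha']
    | tmul a a' => rw [TensorProduct.map_tmul, TensorProduct.map_tmul, hn.octConj_octConj,
        hm.octConj_octConj]
  bar_mul a b := by
    induction a with
    | zero => simp only [zero_mul, map_zero, mul_zero]
    | add a a' ha ha' => rw [map_add, mul_add, add_mul, map_add, ha, ha']
    | tmul a a' =>
      induction b with
      | zero => simp only [mul_zero, map_zero, zero_mul]
      | add b b' hb hb' => rw [map_add, mul_add, add_mul, map_add, hb, hb']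
      | tmul b b' => simp only [TensorProduct.map_tmul, Algebra.TensorProduct.tmul_mul_tmul,
          hn.octConj_mul, hm.octConj_mul]
  triality_mem := hn.triality_tensorConj_mem_relatedTriples hm
  lie_triality := hn.lie_triality_tensorConj hm
  triality_two_add := hn.triality_tensorConj_two_add hm
  triality_bar_mul_add := hn.triality_tensorConj_mul_add hm

end IsCompositionAlgebra

end Tensor

/-! ### The multiplicative transfer -/

section Injective

variable {R S A B : Type*} [CommRing R] [NonUnitalNonAssocRing A]
  [Module R A] [SMulCommClass R A A] [IsScalarTower R A A] [CommRing S]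
  [NonUnitalNonAssocRing B] [Module S B] [SMulCommClass S B B] [IsScalarTower S B B]
  {bar : B →ₗ[S] B} {bar' : A →ₗ[R] A}

theorem map_triality (φ : A →ₙ+* B) (hbar : ∀ x, φ (bar' x) = bar (φ x)) (j : Fin 3) (a b x : A) :
    φ (triality bar' j a b x) = triality bar j (φ a) (φ b) (φ x) := by
  fin_cases j
  · simp only [Fin.zero_eta, triality_zero_apply, map_sub, map_mul, hbar]
  · simp only [Fin.mk_one, triality_one_apply, map_sub, map_mul, hbar]
  · simp only [Fin.reduceFinMk, triality_two_apply, map_sub, map_mul, hbar]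

theorem IsTrialitarian.of_injective (h : IsTrialitarian bar) (φ : A →ₙ+* B)
    (hφ : Function.Injective φ) (hbar : ∀ x, φ (bar' x) = bar (φ x)) : IsTrialitarian bar' := by
  constructor
  · intro a
    apply hφ
    rw [hbar, hbar, h.bar_bar]
  · intro a b
    apply hφ
    rw [hbar, map_mul φ, map_mul φ, h.bar_mul, hbar, hbar]
  · intro a b k x y
    apply hφ
    have hrel := h.triality_mem (φ a) (φ b) k (φ x) (φ y)
    simpa only [map_triality φ hbar, hbar, map_mul, map_add] using hrel
  · intro i j a b c d
    ext x
    apply hφ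
    have hlie := congr($(h.lie_triality i j (φ a) (φ b) (φ c) (φ d)) (φ x))
    simpa only [Ring.lie_def, LinearMap.sub_apply, Module.End.mul_apply, LinearMap.add_apply,
      map_triality φ hbar, map_add, map_sub] using hlie
  · intro a b c
    apply hφ
    simpa only [map_triality φ hbar, map_add, map_zero] using
      h.triality_two_add (φ a) (φ b) (φ c)
  · intro j a b c
    ext x
    apply hφ
    have hsum := congr($(h.triality_bar_mul_add j (φ a) (φ b) (φ c)) (φ x))
    simpa only [LinearMap.add_apply, LinearMap.zero_apply, map_triality φ hbar, hbar, map_mul,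
      map_add, map_zero] using hsum

end Injective

section QuadraticExtension

variable {K E : Type*} [Field K] [CommRing E] [Algebra K E] {ι : E ≃ₐ[K] E}

theorem exists_algebraMap_eq_of_apply_eq_self (hE : Module.finrank K E = 2) (hι : ι ≠ 1) {x : E}
    (hx : ι x = x) : ∃ c : K, algebraMap K E c = x := by
  have : Nontrivial E := Module.nontrivial_of_finrank_pos (R := K) (by lia)
  by_contra! hxK
  have hindep : LinearIndependent K ![1, x] :=
    (LinearIndependent.pair_iff' one_ne_zero).2 fun c => by
      rw [← Algebra.algebraMap_eq_smul_one]
      exact hxK c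
  have hspan := hindep.span_eq_top_of_card_eq_finrank (by rw [hE, Fintype.card_fin])
  refine hι (AlgEquiv.toLinearMap_injective (LinearMap.ext_on_range hspan fun i => ?_))
  fin_cases i
  · exact map_one ι
  · exact hx

theorem exists_units_apply_eq_neg [IsReduced E] (hE : Module.finrank K E = 2)
    (hι : orderOf ι = 2) : ∃ d : Eˣ, ι d = -d := by
  have hι1 : ι ≠ 1 := fun h => by simp [h] at hι
  obtain ⟨e, he⟩ := DFunLike.ne_iff.1 hι1
  have hd : ι (e - ι e) = -(e - ι e) := by
    rw [map_sub, apply_apply_of_orderOf_eq_two hι, neg_sub]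
  obtain ⟨c, hc⟩ := exists_algebraMap_eq_of_apply_eq_self hE hι1
    (show ι ((e - ι e) * (e - ι e)) = (e - ι e) * (e - ι e) by rw [map_mul, hd, neg_mul_neg])
  have hc0 : c ≠ 0 := by
    rintro rfl
    rw [map_zero, eq_comm, ← pow_two, pow_eq_zero_iff two_ne_zero] at hc
    exact he (sub_eq_zero.1 hc).symm
  have hunit : IsUnit (e - ι e) :=
    isUnit_of_mul_isUnit_left (hc ▸ hc0.isUnit.map (algebraMap K E))
  exact ⟨hunit.unit, hd⟩

theorem inv_apply_eq_neg {d : Eˣ} (hd : ι d = -d) : ι ↑d⁻¹ = -↑d⁻¹ := by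
  refine d.isUnit.mul_left_cancel ?_
  have hinv := congrArg ι d.mul_inv
  rw [map_mul, hd, map_one] at hinv
  linear_combination -hinv + d.mul_inv

end QuadraticExtension

namespace Conjugate

variable {K E : Type*} [Field K] [CommRing E] [Algebra K E] {ι : E ≃ₐ[K] E}

section Module

variable {V : Type*} [AddCommGroup V] [Module E V] {q : QuadraticForm E V}

/-- The basis of `ᶥV` underlying a basis of `V`. -/
def basis (hι : orderOf ι = 2) {I : Type*} (b : Module.Basis I E V) :
    Module.Basis I E (Conjugate ι V) :=
  @Module.Basis.mapCoeffs I E V _ _ _ b E _ (instModule ι) (ι : E ≃+* E) fun e v =>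
    congrArg (fun e' : E => e' • v) (apply_apply_of_orderOf_eq_two hι e)

theorem free (hι : orderOf ι = 2) [Module.Free E V] : Module.Free E (Conjugate ι V) :=
  Module.Free.of_basis (basis hι (Module.Free.chooseBasis E V))

theorem finite (hι : orderOf ι = 2) [Module.Free E V] [Module.Finite E V] :
    Module.Finite E (Conjugate ι V) :=
  Module.Finite.of_basis (basis hι (Module.Free.chooseBasis E V))

theorem finrank_eq (hι : orderOf ι = 2) [Module.Free E V] [Module.Finite E V]
    [Nontrivial E] :
    Module.finrank E (Conjugate ι V) = Module.finrank E V := by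
  rw [Module.finrank_eq_card_basis (basis hι (Module.Free.chooseBasis E V)),
    Module.finrank_eq_card_basis (Module.Free.chooseBasis E V)]

variable [Module K V]

theorem polar_quadraticForm (hι : orderOf ι = 2) (x y : Conjugate ι V) :
    polar (quadraticForm hι q) x y = ι (polar q ((of ι).symm x) ((of ι).symm y)) := by
  simp only [polar, quadraticForm, QuadraticMap.coe_mk, map_add, map_sub]

theorem nondegenerate_quadraticForm (hι : orderOf ι = 2) (hq : q.polarBilin.Nondegenerate) :
    (quadraticForm hι q).polarBilin.Nondegenerate := by
  have hsep (x : Conjugate ι V) (hx : ∀ y, polar (quadraticForm hι q) x y = 0) : x = 0 := by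
    refine (of ι).symm.injective (eq_of_forall_polar_eq hq fun z => ?_)
    have hz := hx (of ι z)
    rw [polar_quadraticForm, LinearEquiv.symm_apply_apply, EmbeddingLike.map_eq_zero_iff] at hz
    rw [hz, map_zero, QuadraticMap.polar_zero_left]
  refine ⟨hsep, fun x hx => hsep x fun y => ?_⟩
  rw [QuadraticMap.polar_comm]
  exact hx y

end Module

section Algebra

variable {C : Type*} [NonAssocRing C] [Module E C] [Module K C]

/-- The module structure of `ᶥC`, over the additive group of the ring `ᶥC`. -/
instance ringModule (ι : E ≃ₐ[K] E) :
    @Module E (Conjugate ι C) _ NonUnitalNonAssocSemiring.toAddCommMonoid :=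
  instModule ι

/-- The norm `ᶥn` on the algebra `ᶥC`. -/
abbrev norm (hι : orderOf ι = 2) (n : QuadraticForm E C) : QuadraticForm E (Conjugate ι C) :=
  quadraticForm hι n

variable {n : QuadraticForm E C}

theorem isCompositionAlgebra_norm (hι : orderOf ι = 2) (hn : IsCompositionAlgebra n) :
    IsCompositionAlgebra (norm hι n) where
  nondegenerate := nondegenerate_quadraticForm hι hn.nondegenerate
  map_one := (congrArg ι hn.map_one).trans (map_one ι)
  map_mul _ _ := (congrArg ι (hn.map_mul _ _)).trans (map_mul ι _ _)

theorem octConj_norm (hι : orderOf ι = 2) : octConj (norm hι n) = map ι (octConj n) := by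
  ext x
  rw [octConj_apply, polar_quadraticForm, smul_def, apply_apply_of_orderOf_eq_two hι]
  rfl

end Algebra

end Conjugate

section Switch

variable {K E V : Type*} [Field K] [CommRing E] [Algebra K E] {ι : E ≃ₐ[K] E} (hι : orderOf ι = 2)
  [AddCommGroup V] [Module E V] [Module K V] [IsScalarTower K E V]

theorem switch_smul (e : E) (t : Conjugate ι V ⊗[E] V) :
    switch hι V (e • t) = ι e • switch hι V t := by
  induction t with
  | zero => rw [smul_zero, map_zero, smul_zero]
  | add s t hs ht => simp only [smul_add, map_add, hs, ht]
  | tmul x y =>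
    rw [← TensorProduct.tmul_smul, switch_tmul, switch_tmul, TensorProduct.smul_tmul',
      Conjugate.smul_def, apply_apply_of_orderOf_eq_two hι]
    rfl

theorem switch_switch (t : Conjugate ι V ⊗[E] V) : switch hι V (switch hι V t) = t := by
  induction t with
  | zero => rw [map_zero, map_zero]
  | add s t hs ht => simp only [map_add, hs, ht]
  | tmul x y => rfl

namespace Transfer

variable [Invertible (2 : K)]

/-- The projection `t ↦ ½ (t + switch t)` onto the tensors fixed by the switch map. -/
def symmetrize : (Conjugate ι V ⊗[E] V) →ₗ[K] Transfer hι V :=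
  LinearMap.codRestrict (transferSubmodule hι V) (⅟(2 : K) • (LinearMap.id + switch hι V))
    fun t => by
      change switch hι V (⅟(2 : K) • (t + switch hι V t)) = ⅟(2 : K) • (t + switch hι V t)
      rw [map_smul, map_add, switch_switch, add_comm]

theorem val_symmetrize (t : Conjugate ι V ⊗[E] V) :
    (symmetrize hι t).val hι V = ⅟(2 : K) • (t + switch hι V t) := rfl

variable {hι} in
theorem symmetrize_of_switch_eq {t : Conjugate ι V ⊗[E] V} {a : Transfer hι V}
    (ht : t + switch hι V t = (2 : K) • a.val hι V) : symmetrize hι t = a := by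
  refine val_injective hι ?_
  rw [val_symmetrize, ht, invOf_smul_smul]

/-- A unit `d` with `ι d = -d` gives the eigenspace decomposition
`ᶥV ⊗ V = N_{E/K}(V) ⊕ d N_{E/K}(V)` of the switch map. -/
def prodEquiv {d : Eˣ} (hd : ι d = -d) :
    (Transfer hι V × Transfer hι V) ≃ₗ[K] (Conjugate ι V ⊗[E] V) :=
  LinearEquiv.ofLinearMap
    ((val hι V).coprod (Algebra.lsmul K K _ (d : E) ∘ₗ val hι V))
    ((symmetrize hι).prod (symmetrize hι ∘ₗ Algebra.lsmul K K _ (↑d⁻¹ : E)))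
    (LinearMap.ext fun t => by
      change ⅟(2 : K) • (t + switch hι V t) +
        (d : E) • ⅟(2 : K) • ((↑d⁻¹ : E) • t + switch hι V ((↑d⁻¹ : E) • t)) = t
      rw [switch_smul, inv_apply_eq_neg hd, smul_comm (d : E) (⅟(2 : K)), neg_smul,
        ← sub_eq_add_neg, smul_sub (d : E), smul_smul (d : E), smul_smul (d : E), d.mul_inv,
        one_smul, one_smul, ← smul_add, add_add_sub_cancel, ← two_smul K, invOf_smul_smul])
    (LinearMap.ext fun ⟨a, b⟩ => by
      refine Prod.ext (symmetrize_of_switch_eq ?_) (symmetrize_of_switch_eq ?_)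
      · change a.val hι V + (d : E) • b.val hι V +
          switch hι V (a.val hι V + (d : E) • b.val hι V) = (2 : K) • a.val hι V
        rw [map_add, switch_smul, switch_val, switch_val, hd, neg_smul, two_smul]
        abel
      · change (↑d⁻¹ : E) • (a.val hι V + (d : E) • b.val hι V) +
          switch hι V ((↑d⁻¹ : E) • (a.val hι V + (d : E) • b.val hι V)) = (2 : K) • b.val hι V
        rw [switch_smul, map_add, switch_smul, switch_val, switch_val, hd, inv_apply_eq_neg hd,
          smul_add, smul_add, neg_smul, smul_smul, smul_smul, neg_mul_neg, d.inv_mul, one_smul,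
          two_smul]
        abel)

theorem prodEquiv_apply {d : Eˣ} (hd : ι d = -d) (a b : Transfer hι V) :
    prodEquiv hι hd (a, b) = a.val hι V + (d : E) • b.val hι V := rfl

end Transfer

end Switch

namespace Transfer

variable {K E V : Type*} [Field K] [CommRing E] [Algebra K E] {ι : E ≃ₐ[K] E} (hι : orderOf ι = 2)
  [AddCommGroup V] [Module E V] [Module K V] [IsScalarTower K E V] [Module.Free E V]
  [Module.Finite E V]

theorem finite [Module.Finite K E] : Module.Finite K (Transfer hι V) := by
  have := Conjugate.finite (V := V) hι
  have : Module.Finite K (Conjugate ι V ⊗[E] V) := Module.Finite.trans E _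
  exact Module.Finite.of_injective (val hι V) (val_injective hι)

theorem trace_eq [Invertible (2 : K)] [IsReduced E] (hE : Module.finrank K E = 2)
    (f : Module.End E (Conjugate ι V ⊗[E] V)) (g : Module.End K (Transfer hι V))
    (hfg : ∀ a, (g a).val hι V = f (a.val hι V)) :
    LinearMap.trace K _ g = ⅟(2 : K) * Algebra.trace K E (LinearMap.trace E _ f) := by
  have : Module.Finite K E := Module.finite_of_finrank_pos (by lia)
  have := Conjugate.free (V := V) hι
  have := Conjugate.finite (V := V) hι
  have := finite (V := V) hι
  obtain ⟨d, hd⟩ := exists_units_apply_eq_neg hE hι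
  have hconj : f.restrictScalars K = (prodEquiv hι hd).conj (g.prodMap g) := by
    ext t
    obtain ⟨⟨a, b⟩, rfl⟩ := (prodEquiv hι hd).surjective t
    rw [LinearEquiv.conj_apply_apply, LinearEquiv.symm_apply_apply, LinearMap.prodMap_apply,
      prodEquiv_apply, prodEquiv_apply, hfg, hfg, LinearMap.restrictScalars_apply, map_add,
      map_smul]
  rw [← trace_restrictScalars, hconj, LinearMap.trace_conj', LinearMap.trace_prodMap', ← two_mul,
    invOf_mul_cancel_left]

end Transfer

section Algebra

variable {K E C : Type*} [Field K] [CommRing E] [Algebra K E] {ι : E ≃ₐ[K] E}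
  (hι : orderOf ι = 2) [NonAssocRing C] [Module E C] [Module K C] [IsScalarTower K E C]
  [SMulCommClass E C C] [IsScalarTower E C C] (n : QuadraticForm E C)

/-- The inclusion `N_{E/K}(C) → ᶥC ⊗ C` as a ring homomorphism. -/
def Transfer.valHom : Transfer hι C →ₙ+* (Conjugate ι C ⊗[E] C) where
  __ := (Transfer.val hι C).toAddMonoidHom
  map_mul' := Transfer.val_mul hι

theorem Transfer.val_involution (x : Transfer hι C) :
    (transferInvolution hι n x).val hι C =
      tensorConj (Conjugate.norm hι n) n (x.val hι C) := by
  rw [tensorConj, Conjugate.octConj_norm]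
  rfl

variable {n}

theorem Transfer.val_triality (j : Fin 3) (a b x : Transfer hι C) :
    (triality (transferInvolution hι n) j a b x).val hι C =
      triality (tensorConj (Conjugate.norm hι n) n) j (a.val hι C) (b.val hι C) (x.val hι C) :=
  map_triality (Transfer.valHom hι) (Transfer.val_involution hι n) j a b x

theorem IsCompositionAlgebra.isTrialitarian_transferInvolution (hn : IsCompositionAlgebra n)
    [Invertible (2 : E)] : IsTrialitarian (transferInvolution hι n) :=
  ((Conjugate.isCompositionAlgebra_norm hι hn).isTrialitarian_tensorConj hn).of_injective
    (Transfer.valHom hι) (Transfer.val_injective hι) (Transfer.val_involution hι n)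

end Algebra

/-! ### The Killing form of an Allison–Faulkner algebra -/

theorem trace_eq_trace_add_sum_trace {R M N P I : Type*} [CommRing R]
    [AddCommGroup M] [Module R M] [Module.Free R M] [Module.Finite R M]
    [AddCommGroup N] [Module R N] [Module.Free R N] [Module.Finite R N]
    [AddCommGroup P] [Module R P] [Module.Free R P] [Module.Finite R P] [Fintype I]
    (i : N →ₗ[R] M) (p : M →ₗ[R] N) (j : I → P →ₗ[R] M) (q : I → M →ₗ[R] P)
    (hsum : ∀ x, i (p x) + ∑ k, j k (q k x) = x) (f : Module.End R M) :
    LinearMap.trace R M f =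
      LinearMap.trace R N (p ∘ₗ f ∘ₗ i) + ∑ k, LinearMap.trace R P (q k ∘ₗ f ∘ₗ j k) := by
  have hf : (f ∘ₗ i) ∘ₗ p + ∑ k, (f ∘ₗ j k) ∘ₗ q k = f := by
    ext x
    simpa only [LinearMap.add_apply, LinearMap.sum_apply, LinearMap.comp_apply, map_add, map_sum]
      using congrArg f (hsum x)
  conv_lhs => rw [← hf]
  simp only [map_add, map_sum, LinearMap.trace_comp_comm' p, LinearMap.trace_comp_comm' (q _)]

/-- The endomorphism `c ↦ T²_{b,c}(a) + T²_{a,c}(b) + ā(bc) + (cb)ā`, where `T²` is the last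
component of the triples of the Allison–Faulkner construction. Its trace is, up to a factor, the
Killing form on `A[ij]`. -/
def killingEnd {R B : Type*} [CommRing R] [NonUnitalNonAssocRing B] [Module R B]
    [SMulCommClass R B B] [IsScalarTower R B B] (bar : B →ₗ[R] B) :
    B →ₗ[R] B →ₗ[R] Module.End R B :=
  let L : B →ₗ[R] Module.End R B := LinearMap.mul R B
  let S : B →ₗ[R] B →ₗ[R] Module.End R B := LinearMap.lflip.toLinearMap ∘ₗ triality bar 2
  let comp := LinearMap.mul R (Module.End R B)
  S.flip + S + comp.compl₁₂ (L ∘ₗ bar) L + comp.compl₁₂ (L.flip ∘ₗ bar) L.flip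

theorem killingEnd_apply {R B : Type*} [CommRing R] [NonUnitalNonAssocRing B] [Module R B]
    [SMulCommClass R B B] [IsScalarTower R B B] (bar : B →ₗ[R] B) (a b c : B) :
    killingEnd bar a b c =
      triality bar 2 b c a + triality bar 2 a c b + bar a * (b * c) + (c * b) * bar a :=
  rfl

namespace AllisonFaulkner

variable {K A : Type*} [Field K] [NonUnitalNonAssocRing A] [Module K A] [SMulCommClass K A A]
  [IsScalarTower K A A]

/-- The triple `T^i_{a,b}` as a bilinear function of `(a, b)` with values in `𝒯_I`. -/
def innerTriple (bar : A →ₗ[K] A) (i : Fin 3) : A →ₗ[K] A →ₗ[K] innerTriples bar :=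
  LinearMap.mk₂ K (fun a b => ⟨triple bar i a b, triple_mem_innerTriples bar i a b⟩)
    (fun a a' b => Subtype.ext (LinearMap.map_add₂ (triple bar i) a a' b))
    (fun c a b => Subtype.ext (LinearMap.map_smul₂ (triple bar i) c a b))
    (fun a b b' => Subtype.ext (map_add (triple bar i a) b b'))
    (fun c a b => Subtype.ext (map_smul (triple bar i a) c b))

theorem coe_innerTriple (bar : A →ₗ[K] A) (i : Fin 3) (a b : A) :
    (innerTriple bar i a b : Fin 3 → Module.End K A) = triple bar i a b :=
  rfl

variable {bar : A →ₗ[K] A} {γ : Fin 3 → Kˣ} (h : IsLieOn (bracket bar γ) (space bar))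

/-- The inclusion of `𝒯_I` in `K(A,-,γ)`. -/
def ofInner : innerTriples bar →ₗ[K] LieOn h where
  toFun T := ⟨(T, 0), T.2, trivial⟩
  map_add' _ _ := Subtype.ext (Prod.ext rfl (add_zero (0 : Fin 3 → A)).symm)
  map_smul' c _ := Subtype.ext (Prod.ext rfl (smul_zero c).symm)

/-- The inclusion `a ↦ a[ij]` of `A` in `K(A,-,γ)`, where `(i j k)` is cyclic. -/
def ofEntry (k : Fin 3) : A →ₗ[K] LieOn h where
  toFun a := ⟨(0, Pi.single k a), Submodule.zero_mem _, trivial⟩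
  map_add' a b := Subtype.ext (Prod.ext (add_zero _).symm
    ((LinearMap.single K (fun _ => A) k).map_add a b))
  map_smul' c a := Subtype.ext (Prod.ext (smul_zero c).symm
    ((LinearMap.single K (fun _ => A) k).map_smul c a))

/-- The component in `𝒯_I` of an element of `K(A,-,γ)`. -/
def innerPart : LieOn h →ₗ[K] innerTriples bar where
  toFun x := ⟨x.1.1, x.2.1⟩
  map_add' _ _ := rfl
  map_smul' _ _ := rfl

/-- The component in `A[ij]` of an element of `K(A,-,γ)`, where `(i j k)` is cyclic. -/
def entry (k : Fin 3) : LieOn h →ₗ[K] A where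
  toFun x := x.1.2 k
  map_add' _ _ := rfl
  map_smul' _ _ := rfl

@[simp]
theorem innerPart_ofInner (T : innerTriples bar) : innerPart h (ofInner h T) = T := rfl

@[simp]
theorem innerPart_ofEntry (k : Fin 3) (a : A) : innerPart h (ofEntry h k a) = 0 := rfl

@[simp]
theorem entry_ofInner (k : Fin 3) (T : innerTriples bar) : entry h k (ofInner h T) = 0 := rfl

theorem entry_ofEntry (k l : Fin 3) (a : A) :
    entry h k (ofEntry h l a) = (Pi.single l a : Fin 3 → A) k := rfl

@[simp]
theorem entry_ofEntry_same (k : Fin 3) (a : A) : entry h k (ofEntry h k a) = a := by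
  rw [entry_ofEntry, Pi.single_eq_same]

theorem entry_ofEntry_of_ne {k l : Fin 3} (hkl : k ≠ l) (a : A) :
    entry h k (ofEntry h l a) = 0 := by
  rw [entry_ofEntry, Pi.single_eq_of_ne hkl]

variable {h} in
theorem lieOn_ext {x y : LieOn h} (hinner : innerPart h x = innerPart h y)
    (hentry : ∀ k, entry h k x = entry h k y) : x = y :=
  Subtype.ext (Prod.ext (congrArg Subtype.val hinner) (funext hentry))

theorem ofInner_add_sum_ofEntry (x : LieOn h) :
    ofInner h (innerPart h x) + ∑ k, ofEntry h k (entry h k x) = x := by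
  refine lieOn_ext ?_ fun l => ?_
  · simp
  · simp [entry_ofEntry, Finset.sum_pi_single]

theorem innerPart_lie (x y : LieOn h) : (innerPart h ⁅x, y⁆ : Fin 3 → Module.End K A) =
    innerPart h x * innerPart h y - innerPart h y * innerPart h x + ∑ k : Fin 3,
      ((γ (k + 1) : K) * (γ (k + 2) : K)⁻¹) • triple bar (k + 1) (entry h k x) (entry h k y) :=
  rfl

theorem entry_lie (k : Fin 3) (x y : LieOn h) : entry h k ⁅x, y⁆ =
    (innerPart h x : Fin 3 → Module.End K A) k (entry h k y)
      - (innerPart h y : Fin 3 → Module.End K A) k (entry h k x)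
      - ((γ (k + 2) : K) * (γ (k + 1) : K)⁻¹) •
          bar (entry h (k + 1) x * entry h (k + 2) y - entry h (k + 1) y * entry h (k + 2) x) :=
  rfl

theorem entry_lie_ofInner_ofInner (k : Fin 3) (S T : innerTriples bar) :
    entry h k ⁅ofInner h S, ofInner h T⁆ = 0 := by
  simp [entry_lie]

theorem lie_ofInner_ofEntry (T : innerTriples bar) (k : Fin 3) (a : A) :
    ⁅ofInner h T, ofEntry h k a⁆ = ofEntry h k ((T : Fin 3 → Module.End K A) k a) := by
  refine lieOn_ext (Subtype.ext ?_) fun l => ?_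
  · simp [innerPart_lie]
  · rcases eq_or_ne l k with rfl | hl
    · simp [entry_lie]
    · simp [entry_lie, entry_ofEntry_of_ne h hl]

theorem lie_ofEntry_ofInner (k : Fin 3) (a : A) (T : innerTriples bar) :
    ⁅ofEntry h k a, ofInner h T⁆ = -ofEntry h k ((T : Fin 3 → Module.End K A) k a) := by
  rw [← lie_skew, lie_ofInner_ofEntry]

theorem lie_ofEntry_ofEntry (k : Fin 3) (a b : A) : ⁅ofEntry h k a, ofEntry h k b⁆ =
    ((γ (k + 1) : K) * (γ (k + 2) : K)⁻¹) • ofInner h (innerTriple bar (k + 1) a b) := by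
  refine lieOn_ext (Subtype.ext ?_) fun l => ?_
  · rw [innerPart_lie, Finset.sum_eq_single k]
    · simp [coe_innerTriple]
    · intro l _ hl
      simp [entry_ofEntry_of_ne h hl]
    · simp
  · have hne : l + 1 ≠ l + 2 := by grind
    rcases eq_or_ne (l + 1) k with rfl | hl
    · simp [entry_lie, entry_ofEntry_of_ne h hne.symm]
    · simp [entry_lie, entry_ofEntry_of_ne h hl]

theorem lie_ofEntry_ofEntry_add_one (k : Fin 3) (a b : A) :
    ⁅ofEntry h k a, ofEntry h (k + 1) b⁆ =
      -ofEntry h (k + 2) (((γ (k + 1) : K) * (γ k : K)⁻¹) • bar (a * b)) := by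
  refine lieOn_ext (Subtype.ext ?_) fun l => ?_
  · rw [innerPart_lie, Finset.sum_eq_zero]
    · simp
    · intro l _
      rcases eq_or_ne l k with rfl | hl
      · simp [entry_ofEntry_of_ne h (show l ≠ l + 1 by grind)]
      · simp [entry_ofEntry_of_ne h hl]
  · rw [entry_lie]
    simp only [innerPart_ofEntry, entry_ofEntry, map_neg]
    fin_cases k <;> fin_cases l <;> simp

theorem lie_ofEntry_ofEntry_add_two (k : Fin 3) (a b : A) :
    ⁅ofEntry h k a, ofEntry h (k + 2) b⁆ =
      ofEntry h (k + 1) (((γ k : K) * (γ (k + 2) : K)⁻¹) • bar (b * a)) := by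
  have hlie := lie_ofEntry_ofEntry_add_one h (k + 2) b a
  rw [show k + 2 + 1 = k by grind, show k + 2 + 2 = k + 1 by grind] at hlie
  rw [← lie_skew, hlie, neg_neg]

theorem lie_lie_ofEntry_ofInner (k : Fin 3) (a b : A) (T : innerTriples bar) :
    ⁅ofEntry h k a, ⁅ofEntry h k b, ofInner h T⁆⁆ =
      -((γ (k + 1) : K) * (γ (k + 2) : K)⁻¹) •
        ofInner h (innerTriple bar (k + 1) a ((T : Fin 3 → Module.End K A) k b)) := by
  rw [lie_ofEntry_ofInner, lie_neg, lie_ofEntry_ofEntry, neg_smul]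

theorem lie_lie_ofEntry_ofEntry (k : Fin 3) (a b c : A) :
    ⁅ofEntry h k a, ⁅ofEntry h k b, ofEntry h k c⁆⁆ =
      -((γ (k + 1) : K) * (γ (k + 2) : K)⁻¹) • ofEntry h k (triality bar 2 b c a) := by
  rw [lie_ofEntry_ofEntry, lie_smul, lie_ofEntry_ofInner, coe_innerTriple, triple_apply,
    show k - (k + 1) = 2 by grind, smul_neg, neg_smul]

theorem lie_lie_ofEntry_ofEntry_add_one (hbar : ∀ a, bar (bar a) = a)
    (hmul : ∀ a b, bar (a * b) = bar b * bar a) (k : Fin 3) (a b c : A) :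
    ⁅ofEntry h k a, ⁅ofEntry h k b, ofEntry h (k + 1) c⁆⁆ =
      -((γ (k + 1) : K) * (γ (k + 2) : K)⁻¹) • ofEntry h (k + 1) (bar a * (b * c)) := by
  have hγ : (γ k : K) * (γ (k + 2) : K)⁻¹ * (γ (k + 1) * (γ k : K)⁻¹) =
      γ (k + 1) * (γ (k + 2) : K)⁻¹ := by field_simp
  rw [lie_ofEntry_ofEntry_add_one, lie_neg, lie_ofEntry_ofEntry_add_two, smul_mul_assoc,
    map_smul bar, hmul (bar (b * c)), hbar, smul_smul, hγ, map_smul, neg_smul]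

theorem lie_lie_ofEntry_ofEntry_add_two (hbar : ∀ a, bar (bar a) = a)
    (hmul : ∀ a b, bar (a * b) = bar b * bar a) (k : Fin 3) (a b c : A) :
    ⁅ofEntry h k a, ⁅ofEntry h k b, ofEntry h (k + 2) c⁆⁆ =
      -((γ (k + 1) : K) * (γ (k + 2) : K)⁻¹) • ofEntry h (k + 2) ((c * b) * bar a) := by
  have hγ : (γ (k + 1) : K) * (γ k : K)⁻¹ * (γ k * (γ (k + 2) : K)⁻¹) =
      γ (k + 1) * (γ (k + 2) : K)⁻¹ := by field_simp
  rw [lie_ofEntry_ofEntry_add_two, lie_ofEntry_ofEntry_add_one, mul_smul_comm,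
    map_smul bar, hmul a, hbar, smul_smul, hγ, map_smul, neg_smul]

variable [Module.Finite K A]

instance : Module.Finite K (LieOn h) := inferInstanceAs (Module.Finite K (space bar))

theorem killingForm_eq_trace_add_sum_trace (x y : LieOn h) : killingForm K (LieOn h) x y =
    LinearMap.trace K _
      (innerPart h ∘ₗ (LieAlgebra.ad K _ x ∘ₗ LieAlgebra.ad K _ y) ∘ₗ ofInner h)
    + ∑ k, LinearMap.trace K _
      (entry h k ∘ₗ (LieAlgebra.ad K _ x ∘ₗ LieAlgebra.ad K _ y) ∘ₗ ofEntry h k) := by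
  rw [killingForm_apply_apply, trace_eq_trace_add_sum_trace (ofInner h) (innerPart h) (ofEntry h)
    (entry h) (ofInner_add_sum_ofEntry h)]

theorem killingForm_ofEntry_ofEntry (hbar : ∀ a, bar (bar a) = a)
    (hmul : ∀ a b, bar (a * b) = bar b * bar a) (k : Fin 3) (a b : A) :
    killingForm K (LieOn h) (ofEntry h k a) (ofEntry h k b) =
      -((γ (k + 1) : K) * (γ (k + 2) : K)⁻¹) * LinearMap.trace K A (killingEnd bar a b) := by
  set g := -((γ (k + 1) : K) * (γ (k + 2) : K)⁻¹) with hg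
  let F := LieAlgebra.ad K (LieOn h) (ofEntry h k a) ∘ₗ LieAlgebra.ad K _ (ofEntry h k b)
  let eval : innerTriples bar →ₗ[K] A :=
    LinearMap.applyₗ b ∘ₗ LinearMap.proj k ∘ₗ (innerTriples bar).subtype
  have hinner : innerPart h ∘ₗ F ∘ₗ ofInner h = g • (innerTriple bar (k + 1) a ∘ₗ eval) := by
    ext1 T
    exact congrArg (innerPart h) (lie_lie_ofEntry_ofInner h k a b T)
  have heval : eval ∘ₗ innerTriple bar (k + 1) a = (triality bar 2 a).flip b := by
    ext1 c
    change triple bar (k + 1) a c k b = triality bar 2 a c b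
    rw [triple_apply, show k - (k + 1) = 2 by grind]
  have h₀ : entry h k ∘ₗ F ∘ₗ ofEntry h k = g • (triality bar 2 b).flip a := by
    ext1 c
    exact (congrArg (entry h k) (lie_lie_ofEntry_ofEntry h k a b c)).trans (by simp [hg])
  have h₁ : entry h (k + 1) ∘ₗ F ∘ₗ ofEntry h (k + 1) =
      g • (LinearMap.mulLeft K (bar a) ∘ₗ LinearMap.mulLeft K b) := by
    ext1 c
    exact (congrArg (entry h (k + 1))
      (lie_lie_ofEntry_ofEntry_add_one h hbar hmul k a b c)).trans (by simp [hg])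
  have h₂ : entry h (k + 2) ∘ₗ F ∘ₗ ofEntry h (k + 2) =
      g • (LinearMap.mulRight K (bar a) ∘ₗ LinearMap.mulRight K b) := by
    ext1 c
    exact (congrArg (entry h (k + 2))
      (lie_lie_ofEntry_ofEntry_add_two h hbar hmul k a b c)).trans (by simp [hg])
  have hend : killingEnd bar a b = (triality bar 2 b).flip a + (triality bar 2 a).flip b
      + LinearMap.mulLeft K (bar a) ∘ₗ LinearMap.mulLeft K b
      + LinearMap.mulRight K (bar a) ∘ₗ LinearMap.mulRight K b := rfl
  rw [killingForm_eq_trace_add_sum_trace, sum_fin_three k, hinner, h₀, h₁, h₂, hend]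
  simp only [map_smul, map_add, smul_eq_mul, LinearMap.trace_comp_comm' eval, heval]
  ring

theorem killingForm_ofInner_innerTriple (hbar : ∀ a, bar (bar a) = a)
    (hmul : ∀ a b, bar (a * b) = bar b * bar a) (k : Fin 3) (a b : A) (T : innerTriples bar) :
    killingForm K (LieOn h) (ofInner h (innerTriple bar (k + 1) a b)) (ofInner h T) =
      LinearMap.trace K A (killingEnd bar a ((T : Fin 3 → Module.End K A) k b)) := by
  have hinv : killingForm K (LieOn h) ⁅ofEntry h k a, ofEntry h k b⁆ (ofInner h T) =
      killingForm K (LieOn h) (ofEntry h k a) ⁅ofEntry h k b, ofInner h T⁆ :=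
    LieModule.traceForm_apply_lie_apply K (LieOn h) (LieOn h) _ _ _
  rw [lie_ofEntry_ofEntry, lie_ofEntry_ofInner, map_neg, killingForm_ofEntry_ofEntry h hbar hmul,
    map_smul, LinearMap.smul_apply, neg_mul, neg_neg, smul_eq_mul] at hinv
  exact mul_left_cancel₀ (by simp) hinv

theorem killingForm_eq_zero {x y : LieOn h}
    (hinner : ∀ T, innerPart h ⁅x, ⁅y, ofInner h T⁆⁆ = 0)
    (hentry : ∀ k c, entry h k ⁅x, ⁅y, ofEntry h k c⁆⁆ = 0) : killingForm K (LieOn h) x y = 0 := by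
  have hinner' : innerPart h ∘ₗ (LieAlgebra.ad K _ x ∘ₗ LieAlgebra.ad K _ y) ∘ₗ ofInner h = 0 :=
    LinearMap.ext hinner
  have hentry' (k : Fin 3) :
      entry h k ∘ₗ (LieAlgebra.ad K _ x ∘ₗ LieAlgebra.ad K _ y) ∘ₗ ofEntry h k = 0 :=
    LinearMap.ext (hentry k)
  simp only [killingForm_eq_trace_add_sum_trace, hinner', hentry', map_zero, Finset.sum_const_zero,
    add_zero]

theorem killingForm_ofInner_ofEntry (T : innerTriples bar) (k : Fin 3) (a : A) :
    killingForm K (LieOn h) (ofInner h T) (ofEntry h k a) = 0 := by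
  refine killingForm_eq_zero h (fun S => ?_) fun l c => ?_
  · rw [lie_ofEntry_ofInner, lie_neg, lie_ofInner_ofEntry, map_neg, innerPart_ofEntry, neg_zero]
  · obtain rfl | rfl | rfl : l = k ∨ l = k + 1 ∨ l = k + 2 := by grind
    · rw [lie_ofEntry_ofEntry, lie_smul, map_smul, entry_lie_ofInner_ofInner, smul_zero]
    · rw [lie_ofEntry_ofEntry_add_one, lie_neg, lie_ofInner_ofEntry, map_neg,
        entry_ofEntry_of_ne h (by grind), neg_zero]
    · rw [lie_ofEntry_ofEntry_add_two, lie_ofInner_ofEntry, entry_ofEntry_of_ne h (by grind)]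

theorem killingForm_ofEntry_ofInner (k : Fin 3) (a : A) (T : innerTriples bar) :
    killingForm K (LieOn h) (ofEntry h k a) (ofInner h T) = 0 :=
  (LieModule.traceForm_comm K (LieOn h) (LieOn h) _ _).trans (killingForm_ofInner_ofEntry h T k a)

theorem killingForm_ofEntry_ofEntry_add_one (k : Fin 3) (a b : A) :
    killingForm K (LieOn h) (ofEntry h k a) (ofEntry h (k + 1) b) = 0 := by
  refine killingForm_eq_zero h (fun T => ?_) fun l c => ?_
  · rw [lie_ofEntry_ofInner, lie_neg, lie_ofEntry_ofEntry_add_one, neg_neg, innerPart_ofEntry]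
  · obtain rfl | rfl | rfl : l = k + 1 ∨ l = k + 2 ∨ l = k := by grind
    · rw [lie_ofEntry_ofEntry, lie_smul, lie_ofEntry_ofInner, map_smul, map_neg,
        entry_ofEntry_of_ne h (by grind), neg_zero, smul_zero]
    · rw [show k + 2 = k + 1 + 1 by grind, lie_ofEntry_ofEntry_add_one, lie_neg,
        show k + 1 + 2 = k by grind, lie_ofEntry_ofEntry, map_neg, map_smul, entry_ofInner,
        smul_zero, neg_zero]
    · have hlie := lie_ofEntry_ofEntry_add_two h (l + 1) b c
      rw [show l + 1 + 2 = l by grind, show l + 1 + 1 = l + 2 by grind] at hlie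
      rw [hlie, lie_ofEntry_ofEntry_add_two, entry_ofEntry_of_ne h (by grind)]

theorem killingForm_ofEntry_ofEntry_of_ne {k l : Fin 3} (hkl : k ≠ l) (a b : A) :
    killingForm K (LieOn h) (ofEntry h k a) (ofEntry h l b) = 0 := by
  obtain rfl | rfl : l = k + 1 ∨ k = l + 1 := by grind
  · exact killingForm_ofEntry_ofEntry_add_one h k a b
  · exact (LieModule.traceForm_comm K (LieOn h) (LieOn h) _ _).trans
      (killingForm_ofEntry_ofEntry_add_one h l b a)

theorem killingForm_self (T : innerTriples bar) (v : Fin 3 → A) :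
    killingForm K (LieOn h) (ofInner h T + ∑ k, ofEntry h k (v k))
        (ofInner h T + ∑ k, ofEntry h k (v k)) =
      killingForm K (LieOn h) (ofInner h T) (ofInner h T) +
        ∑ k, killingForm K (LieOn h) (ofEntry h k (v k)) (ofEntry h k (v k)) := by
  simp only [map_add, map_sum, LinearMap.add_apply, LinearMap.sum_apply,
    killingForm_ofInner_ofEntry, killingForm_ofEntry_ofInner, Finset.sum_const_zero, add_zero,
    zero_add]
  congr 1
  refine Finset.sum_congr rfl fun k _ => Finset.sum_eq_single_of_mem k (Finset.mem_univ k) ?_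
  exact fun l _ hl => killingForm_ofEntry_ofEntry_of_ne h hl _ _

end AllisonFaulkner

/-! ### The trace of `killingEnd` on a tensor product -/

section PolarTensor

variable {E V W : Type*} [CommRing E] [AddCommGroup V] [Module E V] [AddCommGroup W] [Module E W]

/-- The tensor product of the polar forms of two quadratic forms; it is twice the polar form of
the tensor product. -/
def polarTensor (n : QuadraticForm E V) (m : QuadraticForm E W) :
    LinearMap.BilinForm E (V ⊗[E] W) :=
  LinearMap.BilinForm.tmul n.polarBilin m.polarBilin

theorem polarTensor_tmul (n : QuadraticForm E V) (m : QuadraticForm E W) (a b : V) (a' b' : W) :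
    polarTensor n m (a ⊗ₜ a') (b ⊗ₜ b') = polar n a b * polar m a' b' := by
  rw [polarTensor, LinearMap.BilinForm.tensorDistrib_tmul]
  simp only [QuadraticMap.polarBilin_apply_apply, smul_eq_mul, mul_comm]

theorem polarTensor_self [Invertible (2 : E)] (n : QuadraticForm E V) (m : QuadraticForm E W)
    (t : V ⊗[E] W) : polarTensor n m t t = 4 * n.tmul m t := by
  have hassociated : polarTensor n m = (4 : E) • QuadraticMap.associated (n.tmul m) := by
    ext a a' b b'
    simp only [TensorProduct.AlgebraTensorModule.curry_apply, LinearMap.restrictScalars_self,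
      TensorProduct.curry_apply, polarTensor_tmul, QuadraticForm.associated_tmul,
      LinearMap.smul_apply, LinearMap.BilinForm.tensorDistrib_tmul, polar_eq_two_mul_associated]
    simp only [smul_eq_mul]
    ring
  rw [hassociated, LinearMap.smul_apply, LinearMap.smul_apply,
    QuadraticMap.associated_eq_self_apply, smul_eq_mul]

end PolarTensor

namespace IsCompositionAlgebra

variable {E C D : Type*} [CommRing E] [NonAssocRing C] [Module E C] [NonAssocRing D] [Module E D]
  [SMulCommClass E C C] [IsScalarTower E C C] [SMulCommClass E D D] [IsScalarTower E D D]
  {n : QuadraticForm E C} {m : QuadraticForm E D}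

theorem flip_triality_tmul (hn : IsCompositionAlgebra n) (hm : IsCompositionAlgebra m)
    (h2 : IsUnit (2 : E)) (a b : C) (a' b' : D) :
    (triality (tensorConj n m) 2 (b ⊗ₜ b')).flip (a ⊗ₜ a') =
      polar n a b • ((m.polarBilin b').smulRight a').lTensor C
        + polar m a' b' • ((n.polarBilin b).smulRight a).rTensor D
        - TensorProduct.map ((n.polarBilin a).smulRight b) ((m.polarBilin b').smulRight a')
        - TensorProduct.map ((n.polarBilin b).smulRight a) ((m.polarBilin a').smulRight b') := by
  ext c c'
  simp only [TensorProduct.AlgebraTensorModule.curry_apply, LinearMap.restrictScalars_self,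
    TensorProduct.curry_apply, LinearMap.flip_apply]
  refine h2.smul_left_cancel.1 ?_
  rw [← LinearMap.smul_apply, hn.two_smul_triality_tmul hm]
  simp only [LinearMap.smul_apply, LinearMap.add_apply, LinearMap.sub_apply,
    TensorProduct.map_tmul, LinearMap.rTensor_tmul, LinearMap.lTensor_tmul, hn.triality_two,
    hm.triality_two, LinearMap.smulRight_apply, QuadraticMap.polarBilin_apply_apply,
    TensorProduct.tmul_sub, TensorProduct.sub_tmul, TensorProduct.tmul_smul,
    ← TensorProduct.smul_tmul', QuadraticMap.polar_comm n c a, QuadraticMap.polar_comm m c' a',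
    QuadraticMap.polar_comm n b a, QuadraticMap.polar_comm m b' a']
  module

variable [Module.Free E C] [Module.Finite E C] [Module.Free E D] [Module.Finite E D]

theorem trace_flip_triality_tmul (hn : IsCompositionAlgebra n) (hm : IsCompositionAlgebra m)
    (h2 : IsUnit (2 : E)) (a b : C) (a' b' : D) :
    LinearMap.trace E _ ((triality (tensorConj n m) 2 (b ⊗ₜ b')).flip (a ⊗ₜ a')) =
      (Module.finrank E C + Module.finrank E D - 2) * (polar n a b * polar m a' b') := by
  nontriviality E
  rw [hn.flip_triality_tmul hm h2, LinearMap.lTensor, LinearMap.rTensor]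
  simp only [map_add, map_sub, map_smul, LinearMap.trace_tensorProduct', LinearMap.trace_id,
    LinearMap.trace_smulRight, QuadraticMap.polarBilin_apply_apply, smul_eq_mul,
    QuadraticMap.polar_comm n b a, QuadraticMap.polar_comm m b' a']
  ring

variable [IsArtinianRing E]

theorem four_mul_trace_mulLeft_mulLeft_tmul (hn : IsCompositionAlgebra n)
    (hm : IsCompositionAlgebra m) (h2 : IsUnit (2 : E)) (a b : C) (a' b' : D) :
    4 * LinearMap.trace E _ (LinearMap.mulLeft E (tensorConj n m (a ⊗ₜ a')) ∘ₗ
        LinearMap.mulLeft E (b ⊗ₜ[E] b')) =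
      Module.finrank E C * Module.finrank E D * (polar n a b * polar m a' b') := by
  have hmap : LinearMap.mulLeft E (tensorConj n m (a ⊗ₜ a')) ∘ₗ LinearMap.mulLeft E (b ⊗ₜ b') =
      TensorProduct.map (LinearMap.mulLeft E (octConj n a) ∘ₗ LinearMap.mulLeft E b)
        (LinearMap.mulLeft E (octConj m a') ∘ₗ LinearMap.mulLeft E b') := by
    ext c c'
    simp
  rw [hmap, LinearMap.trace_tensorProduct']
  linear_combination 2 * LinearMap.trace E _
        (LinearMap.mulLeft E (octConj n a) ∘ₗ LinearMap.mulLeft E b) *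
          hm.two_mul_trace_mulLeft_mulLeft h2 a' b' +
      Module.finrank E D * polar m a' b' * hn.two_mul_trace_mulLeft_mulLeft h2 a b

theorem four_mul_trace_mulRight_mulRight_tmul (hn : IsCompositionAlgebra n)
    (hm : IsCompositionAlgebra m) (h2 : IsUnit (2 : E)) (a b : C) (a' b' : D) :
    4 * LinearMap.trace E _ (LinearMap.mulRight E (tensorConj n m (a ⊗ₜ a')) ∘ₗ
        LinearMap.mulRight E (b ⊗ₜ[E] b')) =
      Module.finrank E C * Module.finrank E D * (polar n a b * polar m a' b') := by
  have hmap : LinearMap.mulRight E (tensorConj n m (a ⊗ₜ a')) ∘ₗ LinearMap.mulRight E (b ⊗ₜ b') =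
      TensorProduct.map (LinearMap.mulRight E (octConj n a) ∘ₗ LinearMap.mulRight E b)
        (LinearMap.mulRight E (octConj m a') ∘ₗ LinearMap.mulRight E b') := by
    ext c c'
    simp
  rw [hmap, LinearMap.trace_tensorProduct']
  linear_combination 2 * LinearMap.trace E _
        (LinearMap.mulRight E (octConj n a) ∘ₗ LinearMap.mulRight E b) *
          hm.two_mul_trace_mulRight_mulRight h2 a' b' +
      Module.finrank E D * polar m a' b' * hn.two_mul_trace_mulRight_mulRight h2 a b

theorem two_mul_trace_killingEnd_tensorConj (hn : IsCompositionAlgebra n)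
    (hm : IsCompositionAlgebra m) (h2 : IsUnit (2 : E)) (a b : C ⊗[E] D) :
    2 * LinearMap.trace E _ (killingEnd (tensorConj n m) a b) =
      (4 * (Module.finrank E C + Module.finrank E D - 2)
        + Module.finrank E C * Module.finrank E D) * polarTensor n m a b := by
  induction a with
  | zero => simp only [map_zero, LinearMap.zero_apply, mul_zero]
  | add a a' ha ha' =>
    simp only [map_add, LinearMap.add_apply, mul_add] at ha ha' ⊢
    rw [ha, ha']
  | tmul a a' =>
    induction b with
    | zero => simp only [map_zero, mul_zero]
    | add b b' hb hb' =>
      simp only [map_add, mul_add] at hb hb' ⊢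
      rw [hb, hb']
    | tmul b b' =>
      have hsum : killingEnd (tensorConj n m) (a ⊗ₜ a') (b ⊗ₜ b') =
        (triality (tensorConj n m) 2 (b ⊗ₜ b')).flip (a ⊗ₜ a')
          + (triality (tensorConj n m) 2 (a ⊗ₜ a')).flip (b ⊗ₜ b')
          + LinearMap.mulLeft E (tensorConj n m (a ⊗ₜ a')) ∘ₗ LinearMap.mulLeft E (b ⊗ₜ b')
          + LinearMap.mulRight E (tensorConj n m (a ⊗ₜ a')) ∘ₗ LinearMap.mulRight E (b ⊗ₜ b') :=
        rfl
      refine h2.mul_left_cancel ?_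
      rw [hsum, polarTensor_tmul]
      simp only [map_add]
      rw [hn.trace_flip_triality_tmul hm h2, hn.trace_flip_triality_tmul hm h2,
        QuadraticMap.polar_comm n b, QuadraticMap.polar_comm m b']
      linear_combination hn.four_mul_trace_mulLeft_mulLeft_tmul hm h2 a b a' b' +
        hn.four_mul_trace_mulRight_mulRight_tmul hm h2 a b a' b'

end IsCompositionAlgebra

/-! ### The inner triples of a transfer -/

section DiagEnd

variable {K E V : Type*} [Field K] [CommRing E] [Algebra K E] {ι : E ≃ₐ[K] E}
  [AddCommGroup V] [Module E V] [Module K V]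

/-- The endomorphism `ᶥf ⊗ 1 + 1 ⊗ f` of `ᶥV ⊗ V`. -/
def diagTensor (ι : E ≃ₐ[K] E) (f : Module.End E V) : Module.End E (Conjugate ι V ⊗[E] V) :=
  (Conjugate.map ι f).rTensor V + f.lTensor (Conjugate ι V)

theorem diagTensor_add (f g : Module.End E V) :
    diagTensor ι (f + g) = diagTensor ι f + diagTensor ι g := by
  have hmap : Conjugate.map ι (f + g) = Conjugate.map ι f + Conjugate.map ι g := rfl
  rw [diagTensor, diagTensor, diagTensor, hmap, LinearMap.rTensor_add, LinearMap.lTensor_add]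
  abel

theorem diagTensor_algebraMap_smul (c : K) (f : Module.End E V) :
    diagTensor ι (algebraMap K E c • f) = algebraMap K E c • diagTensor ι f := by
  have hmap : Conjugate.map ι (algebraMap K E c • f) =
      algebraMap K E c • Conjugate.map ι f := by
    ext x
    rw [LinearMap.smul_apply, Conjugate.smul_def, AlgEquiv.commutes]
    rfl
  rw [diagTensor, diagTensor, hmap, LinearMap.rTensor_smul, LinearMap.lTensor_smul, smul_add]

variable (hι : orderOf ι = 2) [IsScalarTower K E V]

theorem switch_lTensor (f : Module.End E V) (t : Conjugate ι V ⊗[E] V) :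
    switch hι V (f.lTensor _ t) = (Conjugate.map ι f).rTensor V (switch hι V t) := by
  induction t with
  | zero => simp only [map_zero]
  | add s t hs ht => simp only [map_add, hs, ht]
  | tmul x y => rfl

theorem switch_diagTensor (f : Module.End E V) (t : Conjugate ι V ⊗[E] V) :
    switch hι V (diagTensor ι f t) = diagTensor ι f (switch hι V t) := by
  have hswitch := switch_lTensor hι f (switch hι V t)
  rw [switch_switch] at hswitch
  rw [diagTensor, LinearMap.add_apply, LinearMap.add_apply, map_add, switch_lTensor, ← hswitch,
    switch_switch, add_comm]

/-- The restriction of `ᶥf ⊗ 1 + 1 ⊗ f` to the transfer. -/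
def diagEnd : Module.End E V →ₗ[K] Module.End K (Transfer hι V) where
  toFun f := ((diagTensor ι f).restrictScalars K).restrict (p := transferSubmodule hι V)
    (q := transferSubmodule hι V) fun t ht => (switch_diagTensor hι f t).trans (congrArg _ ht)
  map_add' f g := by
    refine LinearMap.ext fun a => Transfer.val_injective hι ?_
    exact congr($(diagTensor_add f g) (Transfer.val hι V a))
  map_smul' c f := by
    refine LinearMap.ext fun a => Transfer.val_injective hι ?_
    have hsmul := congr($(diagTensor_algebraMap_smul (ι := ι) c f) (Transfer.val hι V a))
    rw [LinearMap.smul_apply, algebraMap_smul, algebraMap_smul] at hsmul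
    exact hsmul

theorem val_diagEnd (f : Module.End E V) (a : Transfer hι V) :
    (diagEnd hι f a).val hι V = diagTensor ι f (a.val hι V) := rfl

theorem polarTensor_switch (q : QuadraticForm E V) (s t : Conjugate ι V ⊗[E] V) :
    polarTensor (Conjugate.quadraticForm hι q) q (switch hι V s) (switch hι V t) =
      ι (polarTensor (Conjugate.quadraticForm hι q) q s t) := by
  induction s with
  | zero => simp only [map_zero, LinearMap.zero_apply]
  | add s s' hs hs' => simp only [map_add, LinearMap.add_apply, hs, hs']
  | tmul x y =>
    induction t with
    | zero => simp only [map_zero]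
    | add t t' ht ht' => simp only [map_add, ht, ht']
    | tmul x' y' =>
      rw [switch_tmul, switch_tmul, polarTensor_tmul, polarTensor_tmul,
        Conjugate.polar_quadraticForm, Conjugate.polar_quadraticForm, map_mul,
        apply_apply_of_orderOf_eq_two hι, mul_comm]
      rfl

theorem trace_polarTensor_diagEnd (q : QuadraticForm E V) (f : Module.End E V)
    (a b : Transfer hι V) :
    Algebra.trace K E (polarTensor (Conjugate.quadraticForm hι q) q (a.val hι V)
        ((diagEnd hι f b).val hι V)) =
      2 * Algebra.trace K E (polarTensor (Conjugate.quadraticForm hι q) q (a.val hι V)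
        (f.lTensor _ (b.val hι V))) := by
  have hswitch := polarTensor_switch hι q (a.val hι V) (f.lTensor _ (b.val hι V))
  rw [switch_lTensor, a.switch_val, b.switch_val] at hswitch
  rw [val_diagEnd, diagTensor, LinearMap.add_apply, map_add, hswitch, map_add,
    Algebra.trace_eq_of_algEquiv, two_mul]

end DiagEnd

section WedgePairing

variable {K E V : Type*} [Field K] [CommRing E] [Algebra K E] {ι : E ≃ₐ[K] E}
  (hι : orderOf ι = 2) [AddCommGroup V] [Module E V] [Module K V]

/-- The bilinear map `(a₁ ⊗ a₂, b₁ ⊗ b₂) ↦ ᶥq(a₁, b₁) a₂ ∧ b₂`, where `ᶥq(a₁, b₁)` denotes the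
polar form. -/
def wedgePairing (q : QuadraticForm E V) :
    (Conjugate ι V ⊗[E] V) →ₗ[E] (Conjugate ι V ⊗[E] V) →ₗ[E] ⋀[E]^2 V :=
  (TensorProduct.map₂ (Conjugate.quadraticForm hι q).polarBilin wedge).compr₂
    (TensorProduct.lid E (⋀[E]^2 V)).toLinearMap

theorem wedgePairing_tmul (q : QuadraticForm E V) (a b : Conjugate ι V) (a' b' : V) :
    wedgePairing hι q (a ⊗ₜ a') (b ⊗ₜ b') =
      polar (Conjugate.quadraticForm hι q) a b • wedge a' b' := by
  simp [wedgePairing]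

end WedgePairing

section Algebra

open AllisonFaulkner

variable {K E C : Type*} [Field K] [CommRing E] [Algebra K E] {ι : E ≃ₐ[K] E}
  (hι : orderOf ι = 2) [NonAssocRing C] [Module E C] [Module K C] {n : QuadraticForm E C}

theorem wedgePairing_one_tmul_add (hn : IsCompositionAlgebra n) (x y : C) :
    wedgePairing hι n (Conjugate.of ι 1 ⊗ₜ x + Conjugate.of ι x ⊗ₜ 1)
        (Conjugate.of ι 1 ⊗ₜ y + Conjugate.of ι y ⊗ₜ 1) =
      (2 : E) • wedge x y + wedge (ι (polar n 1 y) • x) 1 + wedge 1 (ι (polar n x 1) • y) := by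
  simp only [map_add, LinearMap.add_apply, wedgePairing_tmul, Conjugate.polar_quadraticForm,
    LinearEquiv.symm_apply_apply, wedge_self, smul_zero, add_zero, hn.polar_one_one, map_ofNat,
    map_smul, LinearMap.smul_apply]
  abel

theorem IsCompositionAlgebra.eq_zero_of_diagTensor_eq_zero (hn : IsCompositionAlgebra n)
    (hι : orderOf ι = 2) (h2 : IsUnit (2 : E)) {f : Module.End E C}
    (hskew : n.polarBilin.IsSkewAdjoint f) (hf : diagTensor ι f = 0) : f = 0 := by
  have hone : polar n (f 1) 1 = 0 := by
    have h := polar_apply_left_of_isSkewAdjoint hskew 1 1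
    rwa [QuadraticMap.polar_comm n 1, eq_neg_iff_add_eq_zero, ← two_mul,
      h2.mul_right_eq_zero] at h
  refine LinearMap.ext fun x => eq_of_forall_polar_eq hn.nondegenerate fun z => ?_
  have h := congr(polarTensor (Conjugate.norm hι n) n ($hf (Conjugate.of ι x ⊗ₜ 1))
    (Conjugate.of ι z ⊗ₜ 1))
  simp only [diagTensor, LinearMap.add_apply, LinearMap.rTensor_tmul, LinearMap.lTensor_tmul,
    map_add, polarTensor_tmul, hone, mul_zero, add_zero, map_zero, LinearMap.zero_apply,
    hn.polar_one_one, Conjugate.polar_quadraticForm] at h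
  rw [mul_comm, h2.mul_right_eq_zero] at h
  rw [LinearMap.zero_apply, QuadraticMap.polar_zero_left]
  exact (map_eq_zero_iff ι ι.injective).1 h

variable [SMulCommClass E C C] [IsScalarTower E C C]

theorem triality_octConj_norm (j : Fin 3) (x y : Conjugate ι C) :
    triality (octConj (Conjugate.norm hι n)) j x y = Conjugate.map ι
      (triality (octConj n) j ((Conjugate.of ι).symm x) ((Conjugate.of ι).symm y)) := by
  rw [Conjugate.octConj_norm]
  ext z
  fin_cases j
  · exact (triality_zero_apply _ x y z).trans
      congr(Conjugate.of ι $(triality_zero_apply (octConj n) _ _ _)).symm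
  · exact (triality_one_apply _ x y z).trans
      congr(Conjugate.of ι $(triality_one_apply (octConj n) _ _ _)).symm
  · exact (triality_two_apply _ x y z).trans
      congr(Conjugate.of ι $(triality_two_apply (octConj n) _ _ _)).symm

theorem polarTensor_lTensor_wedgeTriality (hn : IsCompositionAlgebra n) [Invertible (2 : E)]
    (w : ⋀[E]^2 C) (s t : Conjugate ι C ⊗[E] C) :
    polarTensor (Conjugate.norm hι n) n s ((wedgeTriality n 2 w).lTensor _ t) =
      -8 * lambdaSqBilin n w (wedgePairing hι n s t) := by
  induction w using wedge_induction with
  | hz => simp only [map_zero, LinearMap.lTensor_zero, LinearMap.zero_apply, mul_zero]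
  | ha w w' hw hw' =>
    simp only [map_add, LinearMap.lTensor_add, LinearMap.add_apply, hw, hw', mul_add]
  | hw u v =>
    induction s with
    | zero => simp only [map_zero, LinearMap.zero_apply, mul_zero]
    | add s s' hs hs' => simp only [map_add, LinearMap.add_apply, hs, hs', mul_add]
    | tmul x y =>
      induction t with
      | zero => simp only [map_zero, mul_zero]
      | add t t' ht ht' => simp only [map_add, ht, ht', mul_add]
      | tmul x' y' =>
        rw [LinearMap.lTensor_tmul, polarTensor_tmul, wedgePairing_tmul, wedgeTriality_wedge,
          hn.triality_two, map_smul, smul_eq_mul, QuadraticMap.polar_smul_right,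
          QuadraticMap.polar_sub_right, QuadraticMap.polar_smul_right,
          QuadraticMap.polar_smul_right, smul_eq_mul, smul_eq_mul, smul_eq_mul,
          QuadraticMap.polar_comm n y, QuadraticMap.polar_comm n y]
        linear_combination (2 * polar (Conjugate.norm hι n) x x') *
          four_mul_lambdaSqBilin_wedge n u v y y'

variable [IsScalarTower K E C]

theorem two_smul_triality_tensorConj_norm (hn : IsCompositionAlgebra n) (j : Fin 3)
    (a b : Conjugate ι C ⊗[E] C) :
    (2 : E) • triality (tensorConj (Conjugate.norm hι n) n) j a b =
      (Conjugate.map ι (wedgeTriality n j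
        (wedgePairing hι n (switch hι C a) (switch hι C b)))).rTensor C
      + (wedgeTriality n j (wedgePairing hι n a b)).lTensor (Conjugate ι C) := by
  have hzero : Conjugate.map ι (0 : Module.End E C) = 0 := rfl
  have hadd (f g : Module.End E C) :
      Conjugate.map ι (f + g) = Conjugate.map ι f + Conjugate.map ι g := rfl
  have hsmul (e : E) (f : Module.End E C) :
      Conjugate.map ι (ι e • f) = e • Conjugate.map ι f := rfl
  induction a with
  | zero => simp only [map_zero, LinearMap.zero_apply, smul_zero, hzero, LinearMap.rTensor_zero,
      LinearMap.lTensor_zero, add_zero]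
  | add a a' ha ha' =>
    simp only [map_add, LinearMap.add_apply, smul_add, ha, ha', hadd, LinearMap.rTensor_add,
      LinearMap.lTensor_add]
    abel
  | tmul a a' =>
    induction b with
    | zero => simp only [map_zero, smul_zero, hzero, LinearMap.rTensor_zero,
        LinearMap.lTensor_zero, add_zero]
    | add b b' hb hb' =>
      simp only [map_add, smul_add, hb, hb', hadd, LinearMap.rTensor_add, LinearMap.lTensor_add]
      abel
    | tmul b b' =>
      rw [(Conjugate.isCompositionAlgebra_norm hι hn).two_smul_triality_tmul hn, switch_tmul,
        switch_tmul, wedgePairing_tmul, wedgePairing_tmul, Conjugate.polar_quadraticForm hι a b,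
        Conjugate.polar_quadraticForm, LinearEquiv.symm_apply_apply,
        LinearEquiv.symm_apply_apply, map_smul, map_smul, hsmul, wedgeTriality_wedge,
        wedgeTriality_wedge, LinearMap.rTensor_smul, LinearMap.lTensor_smul,
        triality_octConj_norm]

theorem two_smul_triality_transfer (hn : IsCompositionAlgebra n) (j : Fin 3)
    (a b : Transfer hι C) :
    (2 : K) • triality (transferInvolution hι n) j a b =
      diagEnd hι (wedgeTriality n j (wedgePairing hι n (a.val hι C) (b.val hι C))) := by
  refine LinearMap.ext fun x => Transfer.val_injective hι ?_
  rw [val_diagEnd, LinearMap.smul_apply, map_smul, Transfer.val_triality,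
    ← algebraMap_smul E (2 : K), map_ofNat, ← LinearMap.smul_apply,
    two_smul_triality_tensorConj_norm hι hn, a.switch_val, b.switch_val]
  rfl

/-- The triples of endomorphisms of the transfer given by elements of `⋀² C`. -/
def wedgeTriple (n : QuadraticForm E C) : ⋀[E]^2 C →ₗ[K] Fin 3 → Module.End K (Transfer hι C) :=
  LinearMap.pi fun k => diagEnd hι ∘ₗ (wedgeTriality n k).restrictScalars K

theorem wedgeTriple_apply (w : ⋀[E]^2 C) (k : Fin 3) :
    wedgeTriple hι n w k = diagEnd hι (wedgeTriality n k w) := rfl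

theorem wedgeTriple_wedgePairing (hn : IsCompositionAlgebra n) (a b : Transfer hι C) :
    wedgeTriple hι n (wedgePairing hι n (a.val hι C) (b.val hι C)) =
      (2 : K) • triple (transferInvolution hι n) 0 a b := by
  funext k
  rw [wedgeTriple_apply, ← two_smul_triality_transfer hι hn, Pi.smul_apply, triple_apply, sub_zero]

variable [Invertible (2 : K)]

/-- Pairing the symmetric tensors `1 ⊗ x + x ⊗ 1` gives first `4 x ∧ 1` and then `2 x ∧ y`. -/
theorem span_wedgePairing (hn : IsCompositionAlgebra n) :
    Submodule.span K {w | ∃ a b : Transfer hι C,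
      w = wedgePairing hι n (a.val hι C) (b.val hι C)} = ⊤ := by
  set M := Submodule.span K {w | ∃ a b : Transfer hι C,
      w = wedgePairing hι n (a.val hι C) (b.val hι C)}
  have hsymm (x y : C) : (2 : K) • wedge (R := E) x y + wedge (ι (polar n 1 y) • x) 1
      + wedge 1 (ι (polar n x 1) • y) ∈ M := by
    have hval (z : C) : Conjugate.of ι 1 ⊗ₜ[E] z + Conjugate.of ι z ⊗ₜ 1 =
        ((2 : K) • Transfer.symmetrize hι (Conjugate.of ι 1 ⊗ₜ z)).val hι C := by
      rw [map_smul, Transfer.val_symmetrize, smul_invOf_smul]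
      rfl
    rw [← algebraMap_smul E (2 : K), map_ofNat, ← wedgePairing_one_tmul_add hι hn, hval, hval]
    exact Submodule.subset_span ⟨_, _, rfl⟩
  have hdouble (w : ⋀[E]^2 C) (hw : (2 : K) • w ∈ M) : w ∈ M :=
    (M.smul_mem_iff (Invertible.ne_zero 2)).1 hw
  have hone (x : C) : wedge (R := E) x 1 ∈ M := by
    have hx := hsymm x 1
    rw [hn.polar_one_one, map_ofNat, map_smul, map_smul, LinearMap.smul_apply, wedge_self,
      smul_zero, add_zero, ← map_ofNat (algebraMap K E), algebraMap_smul, ← smul_add,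
      ← two_smul K] at hx
    exact hdouble _ (hdouble _ hx)
  rw [eq_top_iff]
  rintro w -
  induction w using wedge_induction with
  | hw x y =>
    refine hdouble _ ?_
    have hxy := M.add_mem (M.sub_mem (hsymm x y) (hone (ι (polar n 1 y) • x)))
      (hone (ι (polar n x 1) • y))
    rwa [wedge_swap 1, add_sub_right_comm, add_sub_cancel_right, neg_add_cancel_right] at hxy
  | hz => exact M.zero_mem
  | ha x y hx hy => exact M.add_mem hx hy

theorem range_wedgeTriple (hn : IsCompositionAlgebra n) [IsArtinianRing E] [IsReduced E]
    [Invertible (2 : E)] [Module.Free E C] [Module.Finite E C] (hC : 4 < Module.finrank E C) :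
    LinearMap.range (wedgeTriple hι n) = innerTriples (transferInvolution hι n) := by
  refine le_antisymm ?_ (Submodule.span_le.2 ?_)
  · rw [LinearMap.range_eq_map, ← span_wedgePairing hι hn, Submodule.map_le_iff_le_comap,
      Submodule.span_le]
    rintro _ ⟨a, b, rfl⟩
    rw [SetLike.mem_coe, Submodule.mem_comap, wedgeTriple_wedgePairing hι hn]
    exact Submodule.smul_mem _ _ (triple_mem_innerTriples _ 0 a b)
  · rintro _ ⟨i, a, b, rfl⟩
    have hskew := mem_skewTriples.1
      (hn.wedgeTriality_mem_skewTriples (wedgePairing hι n (a.val hι C) (b.val hι C)))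
    have hrotated : (fun k => wedgeTriality n (k - i)
        (wedgePairing hι n (a.val hι C) (b.val hι C))) ∈ skewTriples n :=
      mem_skewTriples.2 ⟨fun k => hskew.1 (k - i), fun k x y => by
        simpa only [sub_add_eq_add_sub] using hskew.2 (k - i) x y⟩
    obtain ⟨w, hw⟩ := hn.exists_wedgeTriality_eq (isUnit_of_invertible 2) hC hrotated
    refine (Submodule.smul_mem_iff _ (Invertible.ne_zero (2 : K))).1 ⟨w, funext fun k => ?_⟩
    rw [wedgeTriple_apply, hw, ← two_smul_triality_transfer hι hn, Pi.smul_apply, tripleFun_apply]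

theorem diagTensor_eq_zero_of_diagEnd_eq_zero [IsReduced E] (hE : Module.finrank K E = 2)
    {f : Module.End E C} (hf : diagEnd hι f = 0) : diagTensor ι f = 0 := by
  obtain ⟨d, hd⟩ := exists_units_apply_eq_neg hE hι
  refine LinearMap.ext fun t => ?_
  obtain ⟨⟨a, b⟩, rfl⟩ := (Transfer.prodEquiv hι hd).surjective t
  rw [Transfer.prodEquiv_apply, map_add, map_smul, ← val_diagEnd, ← val_diagEnd, hf,
    LinearMap.zero_apply, LinearMap.zero_apply, map_zero, smul_zero, add_zero,
    LinearMap.zero_apply]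

theorem wedgeTriple_injective (hn : IsCompositionAlgebra n) [IsReduced E] [IsArtinianRing E]
    [Invertible (2 : E)] [Module.Free E C] [Module.Finite E C]
    (hE : Module.finrank K E = 2) : Function.Injective (wedgeTriple hι n) := by
  refine (injective_iff_map_eq_zero _).2 fun w hw => ?_
  have h2 : IsUnit (2 : E) := isUnit_of_invertible 2
  have hskew := (mem_skewTriples.1 (hn.wedgeTriality_mem_skewTriples w)).1 2
  have hdiag := diagTensor_eq_zero_of_diagEnd_eq_zero hι hE (congrFun hw 2)
  refine hn.wedgeTriality_two_injective h2 ?_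
  rw [hn.eq_zero_of_diagTensor_eq_zero hι h2 hskew hdiag, map_zero]

end Algebra

/-! ### The isometry -/

section KillingForm

open AllisonFaulkner

variable {K E C : Type*} [Field K] [CommRing E] [Algebra K E] {ι : E ≃ₐ[K] E}
  (hι : orderOf ι = 2) [NonAssocRing C] [Module E C] [Module K C] [IsScalarTower K E C]
  {n : QuadraticForm E C}

theorem eight_mul_transferForm [Invertible (2 : K)] [Invertible (2 : E)] (v : Transfer hι C) :
    8 * transferForm hι n v =
      Algebra.trace K E (polarTensor (Conjugate.norm hι n) n (v.val hι C) (v.val hι C)) := by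
  have hform : transferForm hι n v =
      ⅟(2 : K) * Algebra.trace K E (conjTensorForm hι n (v.val hι C)) := rfl
  have hself : polarTensor (Conjugate.norm hι n) n (v.val hι C) (v.val hι C) =
      (4 : K) • conjTensorForm hι n (v.val hι C) := by
    rw [polarTensor_self, Algebra.smul_def, map_ofNat]
    rfl
  rw [hself, map_smul, smul_eq_mul, hform]
  linear_combination 4 * Algebra.trace K E (conjTensorForm hι n (v.val hι C)) *
    mul_invOf_self (2 : K)

variable [SMulCommClass E C C] [IsScalarTower E C C]

theorem val_killingEnd (a b x : Transfer hι C) :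
    (killingEnd (transferInvolution hι n) a b x).val hι C =
      killingEnd (tensorConj (Conjugate.norm hι n) n) (a.val hι C) (b.val hι C)
        (x.val hι C) := by
  rw [killingEnd_apply, killingEnd_apply, map_add, map_add, map_add, Transfer.val_triality,
    Transfer.val_triality, Transfer.val_mul, Transfer.val_mul, Transfer.val_mul,
    Transfer.val_mul, Transfer.val_involution]

variable [Invertible (2 : K)] [Invertible (2 : E)] [IsReduced E] [IsArtinianRing E]

theorem IsOctonionAlgebra.trace_killingEnd_transferInvolution (hn : IsOctonionAlgebra n)
    (hE : Module.finrank K E = 2) (a b : Transfer hι C) :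
    LinearMap.trace K _ (killingEnd (transferInvolution hι n) a b) =
      30 * Algebra.trace K E
        (polarTensor (Conjugate.norm hι n) n (a.val hι C) (b.val hι C)) := by
  have := hn.free
  have := hn.finite
  have := hn.nontrivial
  have := Conjugate.free (V := C) hι
  have := Conjugate.finite (V := C) hι
  have h2 : IsUnit (2 : E) := isUnit_of_invertible 2
  have htensor := (Conjugate.isCompositionAlgebra_norm hι
    hn.isCompositionAlgebra).two_mul_trace_killingEnd_tensorConj hn.isCompositionAlgebra h2
    (a.val hι C) (b.val hι C)
  rw [Conjugate.finrank_eq hι, hn.finrank_eq] at htensor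
  have hsixty : LinearMap.trace E _ (killingEnd (tensorConj (Conjugate.norm hι n) n)
      (a.val hι C) (b.val hι C)) =
      (60 : K) • polarTensor (Conjugate.norm hι n) n (a.val hι C) (b.val hι C) := by
    refine h2.mul_left_cancel (htensor.trans ?_)
    rw [Algebra.smul_def, map_ofNat]
    push_cast
    ring
  rw [Transfer.trace_eq hι hE _ _ (val_killingEnd hι a b), hsixty, map_smul, smul_eq_mul]
  linear_combination 30 * Algebra.trace K E
    (polarTensor (Conjugate.norm hι n) n (a.val hι C) (b.val hι C)) * invOf_mul_self (2 : K)

theorem killingForm_ofEntry_inv_four_smul (hn : IsOctonionAlgebra n)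
    (hE : Module.finrank K E = 2) [Module.Finite K (Transfer hι C)] {γ : Fin 3 → Kˣ}
    (h : IsLieOn (bracket (transferInvolution hι n) γ) (space (transferInvolution hι n)))
    (k : Fin 3) (a : Transfer hι C) :
    killingForm K (LieOn h) (ofEntry h k ((4 : K)⁻¹ • a)) (ofEntry h k ((4 : K)⁻¹ • a)) =
      -15 * (((γ (k + 1) : K) * (γ (k + 2) : K)⁻¹) * transferForm hι n a) := by
  have h4 : (4 : K) ≠ 0 := by
    rw [← show (2 : K) ^ 2 = 4 by norm_num]
    exact pow_ne_zero 2 (Invertible.ne_zero 2)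
  have htri := hn.isCompositionAlgebra.isTrialitarian_transferInvolution hι
  rw [map_smul, map_smul, map_smul, LinearMap.smul_apply,
    killingForm_ofEntry_ofEntry h htri.bar_bar htri.bar_mul,
    hn.trace_killingEnd_transferInvolution hι hE, ← eight_mul_transferForm, smul_eq_mul,
    smul_eq_mul]
  field_simp
  ring

/-- The inner triples of a bi-octonion algebra form an exterior square. -/
def wedgeEquiv (hn : IsOctonionAlgebra n) (hE : Module.finrank K E = 2) :
    (⋀[E]^2 C) ≃ₗ[K] innerTriples (transferInvolution hι n) :=
  have := hn.free
  have := hn.finite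
  have hC : 4 < Module.finrank E C := by rw [hn.finrank_eq]; norm_num
  (LinearEquiv.ofInjective (wedgeTriple hι n)
    (wedgeTriple_injective hι hn.isCompositionAlgebra hE)).trans
    (LinearEquiv.ofEq _ _ (range_wedgeTriple hι hn.isCompositionAlgebra hC))

variable (hn : IsOctonionAlgebra n) (hE : Module.finrank K E = 2)

theorem coe_wedgeEquiv (w : ⋀[E]^2 C) :
    (wedgeEquiv hι hn hE w : Fin 3 → Module.End K (Transfer hι C)) = wedgeTriple hι n w := rfl

theorem wedgeEquiv_wedgePairing (a b : Transfer hι C) :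
    wedgeEquiv hι hn hE (wedgePairing hι n (a.val hι C) (b.val hι C)) =
      (2 : K) • innerTriple (transferInvolution hι n) (2 + 1) a b :=
  Subtype.ext (wedgeTriple_wedgePairing hι hn.isCompositionAlgebra a b)

variable {γ : Fin 3 → Kˣ}
  (h : IsLieOn (bracket (transferInvolution hι n) γ) (space (transferInvolution hι n)))

/-- The linear isomorphism underlying the isometry: an element of `⋀² C` is divided by `8` and
the entries by `4`, which brings the coefficients `-960` and `-240` of the Killing form to
`-15`. The `m`-th component goes to the entry opposite to the index `m + 2`, that is, to
`A[m, m+1]`. -/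
def lieOnEquiv : ((⋀[E]^2 C) × (Fin 3 → Transfer hι C)) ≃ₗ[K] LieOn h :=
  have h4 : (4 : K) ≠ 0 := by
    rw [← show (2 : K) ^ 2 = 4 by norm_num]
    exact pow_ne_zero 2 (Invertible.ne_zero 2)
  have h8 : (8 : K) ≠ 0 := by
    rw [← show (2 : K) ^ 3 = 8 by norm_num]
    exact pow_ne_zero 3 (Invertible.ne_zero 2)
  LinearEquiv.ofLinearMap
    (((8 : K)⁻¹ • (ofInner h ∘ₗ (wedgeEquiv hι hn hE).toLinearMap)).coprod
      (∑ k, (4 : K)⁻¹ • (ofEntry h k ∘ₗ LinearMap.proj (k + 1))))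
    (((8 : K) • ((wedgeEquiv hι hn hE).symm.toLinearMap ∘ₗ innerPart h)).prod
      (LinearMap.pi fun m => (4 : K) • entry h (m + 2)))
    (LinearMap.ext fun x => by
      have hindex (k : Fin 3) : k + 1 + 2 = k := by grind
      conv_rhs => rw [LinearMap.id_apply, ← ofInner_add_sum_ofEntry h x]
      simp [smul_smul, h4, h8, hindex])
    (LinearMap.ext fun x => by
      have hindex (k : Fin 3) : k + 2 + 1 = k := by grind
      refine Prod.ext ?_ (funext fun m => ?_)
      · simp [LinearMap.sum_apply, h8]
      · simp [LinearMap.sum_apply, entry_ofEntry, h4, Finset.sum_pi_single, hindex])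

theorem lieOnEquiv_apply (x : (⋀[E]^2 C) × (Fin 3 → Transfer hι C)) :
    lieOnEquiv hι hn hE h x = ofInner h (wedgeEquiv hι hn hE ((8 : K)⁻¹ • x.1)) +
      ∑ k, ofEntry h k ((4 : K)⁻¹ • x.2 (k + 1)) := by
  simp [lieOnEquiv, LinearMap.sum_apply]

variable [Module.Finite K (Transfer hι C)]

theorem killingForm_wedgeEquiv_wedgePairing (a b : Transfer hι C) (w : ⋀[E]^2 C) :
    killingForm K (LieOn h)
        (ofInner h (wedgeEquiv hι hn hE (wedgePairing hι n (a.val hι C) (b.val hι C))))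
        (ofInner h (wedgeEquiv hι hn hE w)) =
      -960 * Algebra.trace K E
        (lambdaSqBilin n w (wedgePairing hι n (a.val hι C) (b.val hι C))) := by
  have htri := hn.isCompositionAlgebra.isTrialitarian_transferInvolution hι
  have hsmul (e : E) : -8 * e = (-8 : K) • e := by rw [Algebra.smul_def, map_neg, map_ofNat]
  rw [wedgeEquiv_wedgePairing, map_smul, map_smul, LinearMap.smul_apply,
    killingForm_ofInner_innerTriple h htri.bar_bar htri.bar_mul,
    hn.trace_killingEnd_transferInvolution hι hE, coe_wedgeEquiv, wedgeTriple_apply,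
    trace_polarTensor_diagEnd, polarTensor_lTensor_wedgeTriality hι hn.isCompositionAlgebra,
    hsmul, map_smul, smul_eq_mul, smul_eq_mul]
  ring

theorem killingForm_wedgeEquiv (w w' : ⋀[E]^2 C) :
    killingForm K (LieOn h) (ofInner h (wedgeEquiv hι hn hE w))
        (ofInner h (wedgeEquiv hι hn hE w')) =
      -960 * Algebra.trace K E (lambdaSqBilin n w' w) := by
  let f : (⋀[E]^2 C) →ₗ[K] K := (killingForm K (LieOn h)).flip
    (ofInner h (wedgeEquiv hι hn hE w')) ∘ₗ ofInner h ∘ₗ (wedgeEquiv hι hn hE).toLinearMap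
  let g : (⋀[E]^2 C) →ₗ[K] K :=
    (-960 : K) • (Algebra.trace K E ∘ₗ (lambdaSqBilin n w').restrictScalars K)
  suffices hfg : f = g from congr($hfg w)
  refine LinearMap.ext_on (span_wedgePairing hι hn.isCompositionAlgebra) ?_
  rintro _ ⟨a, b, rfl⟩
  exact killingForm_wedgeEquiv_wedgePairing hι hn hE h a b w'

theorem killingForm_ofInner_wedgeEquiv_inv_eight_smul (w : ⋀[E]^2 C) :
    killingForm K (LieOn h) (ofInner h (wedgeEquiv hι hn hE ((8 : K)⁻¹ • w)))
        (ofInner h (wedgeEquiv hι hn hE ((8 : K)⁻¹ • w))) =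
      -15 * traceTransfer K (lambdaSq n) w := by
  have h8 : (8 : K) ≠ 0 := by
    rw [← show (2 : K) ^ 3 = 8 by norm_num]
    exact pow_ne_zero 3 (Invertible.ne_zero 2)
  have hform : traceTransfer K (lambdaSq n) w = Algebra.trace K E (lambdaSqBilin n w w) := rfl
  rw [killingForm_wedgeEquiv, hform]
  simp only [map_smul, LinearMap.map_smul_of_tower, LinearMap.smul_apply, smul_eq_mul]
  field_simp
  ring

theorem killingForm_lieOnEquiv (x : (⋀[E]^2 C) × (Fin 3 → Transfer hι C)) :
    killingForm K (LieOn h) (lieOnEquiv hι hn hE h x) (lieOnEquiv hι hn hE h x) =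
      ((-15 : K) • (traceTransfer K (lambdaSq n)).prod (QuadraticMap.pi fun m : Fin 3 =>
        ((γ m : K) * (γ (m + 1) : K)⁻¹) • transferForm hι n)) x := by
  have hshift := Equiv.sum_comp (Equiv.addRight (1 : Fin 3)) fun m =>
    (((γ m : K) * (γ (m + 1) : K)⁻¹) • transferForm hι n) (x.2 m)
  have hentry (k : Fin 3) := killingForm_ofEntry_inv_four_smul hι hn hE h k (x.2 (k + 1))
  rw [lieOnEquiv_apply, killingForm_self, killingForm_ofInner_wedgeEquiv_inv_eight_smul,
    Finset.sum_congr rfl fun k _ => hentry k, ← Finset.mul_sum, ← mul_add,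
    smul_apply, QuadraticMap.prod_apply, QuadraticMap.pi_apply, ← hshift]
  simp only [Equiv.coe_addRight, smul_apply, smul_eq_mul, add_assoc,
    show (1 : Fin 3) + 1 = 2 from rfl]

end KillingForm

end

theorem mainTheorem4_general {K E C : Type*} [Field K] [Invertible (2 : K)]
    [CommRing E] [Algebra K E] [Algebra.Etale K E] (hE : Module.finrank K E = 2)
    [Invertible (2 : E)] (ι : E ≃ₐ[K] E) (hι : orderOf ι = 2)
    [NonAssocRing C] [Module E C] [SMulCommClass E C C] [IsScalarTower E C C]
    [Module K C] [IsScalarTower K E C]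
    (n : QuadraticForm E C) (hn : IsOctonionAlgebra n) (γ : Fin 3 → Kˣ) :
    ∃ h : IsLieOn (AllisonFaulkner.bracket (transferInvolution hι n) γ)
        (AllisonFaulkner.space (transferInvolution hι n)),
      QuadraticMap.Equivalent
        (LinearMap.BilinMap.toQuadraticMap (killingForm K (LieOn h)))
        ((-15 : K) • (traceTransfer K (lambdaSq n)).prod
          (QuadraticMap.pi fun m : Fin 3 =>
            ((γ m : K) * (γ (m + 1) : K)⁻¹) • transferForm hι n)) := by
  have : IsReduced E := Algebra.FormallyUnramified.isReduced_of_field K E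
  have : Module.Finite K E := Module.finite_of_finrank_pos (by lia)
  have : IsArtinianRing E := IsArtinianRing.of_finite K E
  have := hn.free
  have := hn.finite
  have := Transfer.finite (V := C) hι
  have h := (hn.isCompositionAlgebra.isTrialitarian_transferInvolution hι).isLieOn γ
  exact ⟨h, .symm ⟨⟨lieOnEquiv hι hn hE h, killingForm_lieOnEquiv hι hn hE h⟩⟩⟩

theorem mainTheorem4 {K E C : Type*} [Field K] [Invertible (2 : K)] (h3 : (3 : K) ≠ 0)
    [CommRing E] [Algebra K E] [Algebra.Etale K E] (hE : Module.finrank K E = 2)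
    [Invertible (2 : E)] (ι : E ≃ₐ[K] E) (hι : orderOf ι = 2)
    [NonAssocRing C] [Module E C] [SMulCommClass E C C] [IsScalarTower E C C]
    [Module K C] [IsScalarTower K E C]
    (n : QuadraticForm E C) (hn : IsOctonionAlgebra n) (γ : Fin 3 → Kˣ) :
    ∃ h : IsLieOn (AllisonFaulkner.bracket (transferInvolution hι n) γ)
        (AllisonFaulkner.space (transferInvolution hι n)),
      QuadraticMap.Equivalent
        (LinearMap.BilinMap.toQuadraticMap (killingForm K (LieOn h)))
        ((-15 : K) • (traceTransfer K (lambdaSq n)).prod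
          (QuadraticMap.pi fun m : Fin 3 =>
            ((γ m : K) * (γ (m + 1) : K)⁻¹) • transferForm hι n)) :=
  mainTheorem4_general hE ι hι n hn γ
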